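/- Let $I:\mathbb{R}\to[0,\infty]$ be a convex, lower semicontinuous function with compact level sets, with $I(-\delta)=0$ for some $\delta>0$ and $I(0)>0$. Suppose that $-\delta$ lies in the interior of $\{I<\infty\}$ and that $I$ is differentiable on this interior. Let $\theta^{\downarrow},\theta^{\uparrow}\in(0,\infty]$, where $\theta^{\uparrow}<\infty$ only if $I(r)<\infty$ for all $r>0$. Put $\bar r=\sup\{r: I(r)<\infty\}$; $I$ is called non-coercive if $\bar r<\infty$ and $\lim_{r\uparrow\bar r}I(r)<\infty$, and coercive otherwise. For a non-negative càdlàg function $\psi$ of finite variation on $[0,1]$ write $\psi(t)=\int_0^t\dot\psi^{(a)}(s)\,ds+\psi^{\uparrow}(t)-\psi^{\downarrow}(t)$, where $\dot\psi^{(a)}$ is the density of the absolutely continuous part and $\psi^{\uparrow},\psi^{\downarrow}$ are the distribution functions of the positive and negative parts of the singular component (a value $\psi(0)>0$ counts as a jump at time $0$), and let $$J(\psi)=\int_0^1\Big(I(\dot\psi^{(a)}(s))1_{\{\psi(s)>0\}}+\inf_{y\le 0}I(y)\,1_{\{\psi(s)=0\}}\Big)ds+\theta^{\downarrow}\psi^{\downarrow}(1)+\theta^{\uparrow}\psi^{\uparrow}(1),$$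 with $\infty\cdot 0=0$. Let $z>0$ and let $\psi^*$ be an optimal path: it minimizes $J$ over all such $\psi$ with $\int_0^1\psi(s)\,ds=z$, and $J(\psi^*)<\infty$. Let $T_0=\inf\{t:\psi^*(t)>0\}$, $T_1=\sup\{t:\psi^*(t)>0\}$, and let $T_0^0$ be the supremum of the times $t\in(0,1]$ at which the left derivative of $\psi^*$ equals $\bar r$, if $0<\bar r<\infty$ and there are such times, and $T_0^0=T_0$ otherwise. (a) If $T_0^0<T_1$, there are constants $b\in\mathbb{R}$ and $\lambda^*>0$ such that $$\nabla I(\dot\psi^*(t))=b-\lambda^*t\qquad\text{for all } T_0^0<t<T_1 .$$ Here the left and the right derivative of $\psi^*$ at $t$ exist and both satisfy the equation; unless $\nabla I$ takes the value $b-\lambda^* t$ at more than one point, $\psi^*$ is differentiable at $t$. (b) If $I$ is coercive, then $T_0^0=T_0<T_1$, and, with the same $b,\lambda^*$, the equation holds for all $t\in[0,1]$ with $\psi^*(t)>0$. Here, for $t\neq T_0$, the left derivative and, if $t<1$, the right derivative of $\psi^*$ at $t$ exist and satisfy it; at $t=T_0$ (which occurs only if $\psi^*$ jumps at $T_0$)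 the right derivative satisfies it whenever it is finite. -/

import Mathlib

open Set Filter Topology MeasureTheory
open scoped NNReal ENNReal

namespace RRW

noncomputable section

/-- A good convex rate function on the real line: `[0, ∞]`-valued, convex, lower semicontinuous,
with compact level sets. -/
structure IsGoodConvexRate (I : ℝ → ℝ≥0∞) : Prop where
  convex : ConvexOn ℝ≥0 univ I
  lsc : LowerSemicontinuous I
  compact_level : ∀ a : ℝ≥0, IsCompact {y : ℝ | I y ≤ a}

/-- The effective domain of `I`. -/
def effDom (I : ℝ → ℝ≥0∞) : Set ℝ := {y | I y ≠ ⊤}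

/-- `∇I(v) = p`: the function `I` is finite near `v` and differentiable at `v` with
derivative `p`. -/
def HasGradient (I : ℝ → ℝ≥0∞) (p v : ℝ) : Prop :=
  v ∈ interior (effDom I) ∧ HasDerivAt (fun y => (I y).toReal) p v

/-- `r̄ = sup {r : I r < ∞}`, an extended real number. -/
def rbar (I : ℝ → ℝ≥0∞) : EReal := sSup ((fun r : ℝ => (r : EReal)) '' effDom I)

/-- `I` is non-coercive: `r̄ < ∞` and `lim_{r ↑ r̄} I r < ∞`. -/
def NonCoercive (I : ℝ → ℝ≥0∞) : Prop :=
  ∃ r : ℝ, (r : EReal) = rbar I ∧ ∃ l : ℝ≥0∞, l < ⊤ ∧ Tendsto I (𝓝[<] r) (𝓝 l)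

/-- `I` is coercive: it is not non-coercive. -/
def Coercive (I : ℝ → ℝ≥0∞) : Prop := ¬ NonCoercive I

/-- Càdlàg functions on `[0,1]` (only the values on `[0,1]` matter). -/
structure IsCadlag (ψ : ℝ → ℝ) : Prop where
  right_cont : ∀ t ∈ Ico (0 : ℝ) 1, ContinuousWithinAt ψ (Icc t 1) t
  left_lim : ∀ t ∈ Ioc (0 : ℝ) 1, ∃ l : ℝ, Tendsto ψ (𝓝[Ico 0 t] t) (𝓝 l)

/-- The class `L⁺[0,1]`: non-negative càdlàg functions on `[0,1]` of finite variation. -/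
structure MemLPlus (ψ : ℝ → ℝ) : Prop where
  cadlag : IsCadlag ψ
  finite_variation : BoundedVariationOn ψ (Icc 0 1)
  nonneg : ∀ t ∈ Icc (0 : ℝ) 1, 0 ≤ ψ t

/-- The Lebesgue decomposition of a càdlàg function `ψ` of finite variation on `[0,1]`:
`ψ t = ∫₀ᵗ f + μ [0,t] - ν [0,t]`, where `f` is the density of the absolutely continuous part and
`μ`, `ν` are the positive and the negative part of the singular component.
A non-zero initial value counts as a jump at time `0`, i.e. as an atom of `μ` or `ν` at `0`. -/
structure IsLebesgueDecomp (ψ f : ℝ → ℝ) (μ ν : Measure ℝ) : Prop where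
  integrable : IntegrableOn f (Icc 0 1)
  finite_pos : IsFiniteMeasure μ
  finite_neg : IsFiniteMeasure ν
  supp_pos : μ (Icc 0 1)ᶜ = 0
  supp_neg : ν (Icc 0 1)ᶜ = 0
  singular_pos : μ ⟂ₘ volume
  singular_neg : ν ⟂ₘ volume
  hahn : μ ⟂ₘ ν
  repr : ∀ t ∈ Icc (0 : ℝ) 1,
    ψ t = (∫ s in (0 : ℝ)..t, f s) + μ.real (Icc 0 t) - ν.real (Icc 0 t)

/-- The cost of a non-negative path `ψ` with Lebesgue decomposition `(f, μ, ν)`: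
`∫₀¹ (I(f) 1{ψ > 0} + (inf_{y ≤ 0} I y) 1{ψ = 0}) + θ↓ ν[0,1] + θ↑ μ[0,1]`.
In `[0, ∞]` we have `⊤ * 0 = 0`, so an infinite `θ` charges nothing if there is no singular part. -/
def cost (I : ℝ → ℝ≥0∞) (θdown θup : ℝ≥0∞) (ψ f : ℝ → ℝ) (μ ν : Measure ℝ) : ℝ≥0∞ :=
  (∫⁻ s in Icc (0 : ℝ) 1,
      ({s | 0 < ψ s}.indicator (fun s => I (f s)) s
        + {s | ψ s = 0}.indicator (fun _ => ⨅ y ∈ Iic (0 : ℝ), I y) s))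
    + θdown * ν (Icc 0 1) + θup * μ (Icc 0 1)

/-- The objective function `J`. The Lebesgue decomposition of a function in `L⁺[0,1]` exists and is
unique (`f` up to null sets), so the infimum is over a single value; it is `⊤` for functions that
have no such decomposition. -/
def J (I : ℝ → ℝ≥0∞) (θdown θup : ℝ≥0∞) (ψ : ℝ → ℝ) : ℝ≥0∞ :=
  ⨅ (f : ℝ → ℝ) (μ : Measure ℝ) (ν : Measure ℝ) (_ : IsLebesgueDecomp ψ f μ ν),
    cost I θdown θup ψ f μ ν

/-- `ψ` is feasible: `ψ ∈ L⁺[0,1]` and `∫₀¹ ψ = z`. -/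
def IsFeasible (z : ℝ) (ψ : ℝ → ℝ) : Prop :=
  MemLPlus ψ ∧ ∫ s in (0 : ℝ)..1, ψ s = z

/-- `ψ` is an optimal path: it minimizes `J` among the feasible paths, and the minimum is
finite. -/
structure IsOptimalPath (I : ℝ → ℝ≥0∞) (θdown θup : ℝ≥0∞) (z : ℝ) (ψ : ℝ → ℝ) : Prop where
  feasible : IsFeasible z ψ
  minimal : ∀ φ : ℝ → ℝ, IsFeasible z φ → J I θdown θup ψ ≤ J I θdown θup φ
  finite : J I θdown θup ψ < ⊤

/-- `T₀`, the first time at which the path is non-zero. -/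
def T0 (ψ : ℝ → ℝ) : ℝ := sInf {t | t ∈ Icc (0 : ℝ) 1 ∧ 0 < ψ t}

/-- `T₁`, the last time at which the path is non-zero. -/
def T1 (ψ : ℝ → ℝ) : ℝ := sSup {t | t ∈ Icc (0 : ℝ) 1 ∧ 0 < ψ t}

/-- The times at which the left derivative of the path is `r̄`, where `0 < r̄ < ∞`
(the set is empty if `r̄` is not a positive real number). -/
def maxSlopeTimes (I : ℝ → ℝ≥0∞) (ψ : ℝ → ℝ) : Set ℝ :=
  {t | t ∈ Ioc (0 : ℝ) 1 ∧
    ∃ r : ℝ, 0 < r ∧ (r : EReal) = rbar I ∧ HasDerivWithinAt ψ r (Iic t) t}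

open Classical in
/-- `T₀⁰`, the supremum of the times at which the left derivative of the path is `r̄`, and `T₀` if
there is no such time. -/
def T00 (I : ℝ → ℝ≥0∞) (ψ : ℝ → ℝ) : ℝ :=
  if (maxSlopeTimes I ψ).Nonempty then sSup (maxSlopeTimes I ψ) else T0 ψ

/-- The left derivative `v` of `ψ` at `t` exists and `∇I(v) = p`. -/
def LeftEL (I : ℝ → ℝ≥0∞) (ψ : ℝ → ℝ) (p t : ℝ) : Prop :=
  ∃ v : ℝ, HasDerivWithinAt ψ v (Iic t) t ∧ HasGradient I p v

/-- The right derivative `v` of `ψ` at `t` exists and `∇I(v) = p`. -/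
def RightEL (I : ℝ → ℝ≥0∞) (ψ : ℝ → ℝ) (p t : ℝ) : Prop :=
  ∃ v : ℝ, HasDerivWithinAt ψ v (Ici t) t ∧ HasGradient I p v

/-- The equation `∇I(ψ'(t)) = p` at an interior time `t`: both one-sided derivatives of `ψ` at `t`
exist and satisfy it; and, unless `I` has the slope `p` at several points, `ψ` is differentiable
at `t`, so that the equation holds for the two-sided derivative. -/
def EulerLagrangeAt (I : ℝ → ℝ≥0∞) (ψ : ℝ → ℝ) (p t : ℝ) : Prop :=
  LeftEL I ψ p t ∧ RightEL I ψ p t ∧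
    ((∀ u w : ℝ, HasGradient I p u → HasGradient I p w → u = w) →
      ∃ v : ℝ, HasDerivAt ψ v t ∧ HasGradient I p v)

end

end RRW

/-! Scaling. Shrinking time and space by the same factor c ≤ 1 keeps the slopes, multiplies the cost
by c and the area by c²; the time freed at the start is spent at zero, which is free because I(-δ) =
0. So a path of area a ≥ z, turned into one of area z, shows that the optimal cost is at most √(z/a)
times its cost (`IsOptimalPath.le_openCost`). A jump at time 1 adds no area, hence an optimal path
has none. Moreover no path of at most the optimal cost has more area (`IsOptimalTriple.area_le`),
and extra area has a price of at least cost/(3z) per unit for small perturbations. The positivity of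
this price is what makes λ* positive.

Shape. Exchanging the increments over two adjacent blocks does not raise the cost, provided that the
new path stays non-negative and is positive only where the old one was, up to the time change. So it
cannot gain area (`IsOptimalTriple.blockSwap_le`), and this is the three-point inequality of
concavity. It applies near every time at which the path is positive, and, used on a whole excursion,
it also shows that the path cannot return to zero between positive times. Descending with slope -δ
is free, so a path lying below such a descent could be improved (`IsOptimalTriple.patch_false`);
this excludes jumps to zero and slopes below -δ. Hence the path is concave and continuous on (T₀,
T₁), where its density is its right derivative g.

Variation. Perturb g by ε k, where k is bounded, has mean zero and is supported in a compact
subinterval on which g stays in the interior of the domain. Letting ε ↓ 0 gives (cost/(3z)) · (-∫ s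
k) ≤ ∫ k ∇I(g) whenever -∫ s k ≥ 0 (`IsOptimalTriple.first_order`). Projecting ∇I(g) on the affine
functions shows that it is affine with slope at most -cost/(3z) (`ae_eq_affine_of_variation`,
`IsOptimalTriple.exists_affine`).

End points. The slopes decrease and stay above -δ, so they can leave the interior of the domain only
by being equal to r̄, and this ends at T₀⁰ (`IsOptimalTriple.rightDeriv_mem_interior`). In the
coercive case I is infinite at r̄, so this never happens. The one-sided statements follow because ∇I
is continuous and the slopes have one-sided limits. -/

namespace RRW

/-! ### Convexity and differentiability of the rate function -/

section Rate

variable {I : ℝ → ℝ≥0∞} {δ : ℝ}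

lemma IsGoodConvexRate.measurable (hI : IsGoodConvexRate I) : Measurable I := hI.lsc.measurable

lemma IsGoodConvexRate.le_combo (hI : IsGoodConvexRate I) (x y : ℝ) {a b : ℝ} (ha : 0 ≤ a)
    (hb : 0 ≤ b) (hab : a + b = 1) :
    I (a * x + b * y) ≤ ENNReal.ofReal a * I x + ENNReal.ofReal b * I y := by
  have := hI.convex.2 (mem_univ x) (mem_univ y) (zero_le (a := a.toNNReal))
    (zero_le (a := b.toNNReal))
    (by rw [← Real.toNNReal_add ha hb, hab, Real.toNNReal_one])
  simpa [NNReal.smul_def, ha, hb, ENNReal.smul_def, ENNReal.ofReal] using this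

lemma IsGoodConvexRate.convex_effDom (hI : IsGoodConvexRate I) : Convex ℝ (effDom I) := by
  intro x hx y hy a b ha hb hab
  have h := hI.le_combo x y ha hb hab
  refine ne_top_of_le_ne_top ?_ h
  exact ENNReal.add_ne_top.2 ⟨ENNReal.mul_ne_top ENNReal.ofReal_ne_top hx,
    ENNReal.mul_ne_top ENNReal.ofReal_ne_top hy⟩

lemma IsGoodConvexRate.convexOn_toReal (hI : IsGoodConvexRate I) :
    ConvexOn ℝ (effDom I) fun y => (I y).toReal := by
  refine ⟨hI.convex_effDom, ?_⟩
  intro x hx y hy a b ha hb hab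
  have h := hI.le_combo x y ha hb hab
  have hx' : ENNReal.ofReal a * I x ≠ ⊤ := ENNReal.mul_ne_top ENNReal.ofReal_ne_top hx
  have hy' : ENNReal.ofReal b * I y ≠ ⊤ := ENNReal.mul_ne_top ENNReal.ofReal_ne_top hy
  have h2 := ENNReal.toReal_mono (ENNReal.add_ne_top.2 ⟨hx', hy'⟩) h
  rw [ENNReal.toReal_add hx' hy', ENNReal.toReal_mul, ENNReal.toReal_mul,
    ENNReal.toReal_ofReal ha, ENNReal.toReal_ofReal hb] at h2
  simpa using h2

lemma iInf_nonpos_eq_zero (hδ : 0 < δ) (hIδ : I (-δ) = 0) : (⨅ y ∈ Iic (0 : ℝ), I y) = 0 := by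
  refine le_antisymm ?_ (zero_le)
  rw [← hIδ]
  exact iInf₂_le (-δ) (by simp [hδ.le])

/-- Since I vanishes at -δ, writing x as a convex combination of -δ and y bounds I x by a weight in
[0, 1] times I y. -/
lemma IsGoodConvexRate.mono (hI : IsGoodConvexRate I) (hIδ : I (-δ) = 0) {x y : ℝ}
    (hx : -δ ≤ x) (hxy : x ≤ y) : I x ≤ I y := by
  rcases hx.eq_or_lt with rfl | hx
  · simp [hIδ]
  have hy : 0 < y + δ := by linarith
  have h := hI.le_combo (-δ) y (a := (y - x) / (y + δ)) (b := (x + δ) / (y + δ))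
    (div_nonneg (by linarith) hy.le) (div_nonneg (by linarith) hy.le)
    (by field_simp; ring)
  rw [hIδ, mul_zero, zero_add] at h
  have e : (y - x) / (y + δ) * -δ + (x + δ) / (y + δ) * y = x := by field_simp; ring
  rw [e] at h
  refine h.trans ?_
  refine mul_le_of_le_one_left (zero_le) ?_
  rw [ENNReal.ofReal_le_one]
  exact (div_le_one hy).2 (by linarith)

lemma IsGoodConvexRate.neg_of_eq_zero (hI : IsGoodConvexRate I) (hδ : 0 < δ) (hIδ : I (-δ) = 0)
    (h0 : I 0 ≠ 0) {y : ℝ} (hy : I y = 0) : y < 0 := by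
  by_contra hc
  push Not at hc
  have := hI.mono hIδ (x := 0) (y := y) (by linarith) hc
  rw [hy] at this
  exact h0 (le_antisymm this zero_le)

/-- The domain is an interval that contains a point strictly to the left of -δ, so x has room on
both sides. -/
lemma IsGoodConvexRate.mem_interior (hI : IsGoodConvexRate I)
    (h_dom : -δ ∈ interior (effDom I)) {x y : ℝ} (hx : -δ ≤ x) (hxy : x < y)
    (hy : y ∈ effDom I) : x ∈ interior (effDom I) := by
  obtain ⟨l, hl, hs⟩ := Metric.isOpen_iff.1 isOpen_interior (-δ) h_dom
  have hw : -δ - l / 2 ∈ effDom I := by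
    apply interior_subset (hs _)
    rw [Metric.mem_ball, Real.dist_eq, show -δ - l / 2 - -δ = -(l/2) by ring, abs_neg,
      abs_of_pos (by linarith)]
    linarith
  rw [_root_.mem_interior]
  refine ⟨Ioo (-δ - l / 2) y, ?_, isOpen_Ioo, ⟨by linarith, hxy⟩⟩
  exact Ioo_subset_Icc_self.trans ((hI.convex_effDom.ordConnected).out hw hy)

lemma coe_le_rbar {y : ℝ} (hy : y ∈ effDom I) : (y : EReal) ≤ rbar I :=
  le_sSup (mem_image_of_mem _ hy)

lemma IsGoodConvexRate.mem_interior_of_lt_rbar (hI : IsGoodConvexRate I)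
    (h_dom : -δ ∈ interior (effDom I)) {x : ℝ} (hx : -δ ≤ x) (hxr : (x : EReal) < rbar I) :
    x ∈ interior (effDom I) := by
  obtain ⟨_, ⟨y, hy, rfl⟩, hxy⟩ := lt_sSup_iff.1 hxr
  exact hI.mem_interior h_dom hx (EReal.coe_lt_coe_iff.1 hxy) hy

/-- If `I` is finite at `r̄`, then `I` is non-coercive. -/
lemma IsGoodConvexRate.nonCoercive (hI : IsGoodConvexRate I) (hIδ : I (-δ) = 0)
    (h_dom : -δ ∈ interior (effDom I)) {r : ℝ}
    (hr : (r : EReal) = rbar I) (hfin : I r < ⊤) : NonCoercive I := by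
  have hδr : -δ < r := by
    obtain ⟨l, hl, hs⟩ := Metric.isOpen_iff.1 isOpen_interior (-δ) h_dom
    have hw : -δ + l / 2 ∈ effDom I := by
      apply interior_subset (hs _)
      rw [Metric.mem_ball, Real.dist_eq, show -δ + l / 2 - -δ = (l/2) by ring,
        abs_of_pos (by linarith)]
      linarith
    have := coe_le_rbar hw
    rw [← hr, EReal.coe_le_coe_iff] at this
    linarith
  refine ⟨r, hr, I r, hfin, ?_⟩
  -- Lower semicontinuity bounds the limit from below, monotonicity on [-δ, ∞) from above.
  rw [tendsto_order]
  constructor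
  · intro a ha
    exact nhdsWithin_le_nhds (hI.lsc r a ha)
  · intro a ha
    filter_upwards [Ioo_mem_nhdsLT hδr] with y hy
    exact (hI.mono hIδ hy.1.le hy.2.le).trans_lt ha

/-- The slope inequality at interior points of the domain. -/
lemma IsGoodConvexRate.deriv_mul_le (hI : IsGoodConvexRate I)
    (h_diff : ∀ v ∈ interior (effDom I), DifferentiableAt ℝ (fun y => (I y).toReal) v)
    {x y : ℝ} (hx : x ∈ interior (effDom I)) (hy : y ∈ effDom I) :
    (I x).toReal + deriv (fun y => (I y).toReal) x * (y - x) ≤ (I y).toReal := by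
  have hc := hI.convexOn_toReal
  rcases lt_trichotomy x y with h | h | h
  · have := hc.deriv_le_slope (interior_subset hx) hy h (h_diff x hx)
    rw [slope_def_field, le_div_iff₀ (by linarith)] at this
    linarith
  · simp [h]
  · have := hc.slope_le_deriv hy (interior_subset hx) h (h_diff x hx)
    rw [slope_def_field, div_le_iff₀ (by linarith)] at this
    linarith

lemma IsGoodConvexRate.monotoneOn_deriv (hI : IsGoodConvexRate I)
    (h_diff : ∀ v ∈ interior (effDom I), DifferentiableAt ℝ (fun y => (I y).toReal) v) :
    MonotoneOn (deriv fun y => (I y).toReal) (interior (effDom I)) :=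
  (hI.convexOn_toReal.subset interior_subset hI.convex_effDom.interior).monotoneOn_deriv h_diff

/-- A convex function that is differentiable on the interior of its domain is continuously
differentiable there. -/
lemma IsGoodConvexRate.continuousOn_deriv (hI : IsGoodConvexRate I)
    (h_diff : ∀ v ∈ interior (effDom I), DifferentiableAt ℝ (fun y => (I y).toReal) v) :
    ContinuousOn (deriv fun y => (I y).toReal) (interior (effDom I)) := by
  set g : ℝ → ℝ := fun y => (I y).toReal with hg
  intro x hx
  apply ContinuousAt.continuousWithinAt
  have hnhds : interior (effDom I) ∈ 𝓝 x := isOpen_interior.mem_nhds hx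
  have hder : HasDerivAt g (deriv g x) x := (h_diff x hx).hasDerivAt
  have hslope := hder.tendsto_slope
  have hcont : ∀ y ∈ interior (effDom I), ContinuousAt g y := fun y hy => (h_diff y hy).continuousAt
  rw [ContinuousAt, tendsto_order]
  constructor
  · intro a ha
    -- Some secant from y < x already has slope above a. Its slope varies continuously with the
    -- right end point w, and the derivative at w dominates it by convexity. The upper bound is
    -- symmetric.
    have h1 : ∀ᶠ y in 𝓝[<] x, a < slope g x y :=
      (hslope.mono_left (nhdsWithin_mono _ (fun y hy => ne_of_lt hy))).eventually_const_lt ha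
    have h2 : ∀ᶠ y in 𝓝[<] x, y ∈ interior (effDom I) := nhdsWithin_le_nhds hnhds
    obtain ⟨y, ⟨hy1, hy2⟩, hy3⟩ := ((h1.and h2).and self_mem_nhdsWithin).exists
    have hyx : y < x := hy3
    have hc : ContinuousAt (fun w => slope g y w) x := by
      simp only [slope_def_field]
      exact ((hcont x hx).sub continuousAt_const).div (by fun_prop) (by linarith)
    rw [slope_comm] at hy1
    filter_upwards [hc.eventually (lt_mem_nhds hy1), hnhds, lt_mem_nhds hyx] with w hw hw2 hw3
    exact hw.trans_le (hI.convexOn_toReal.slope_le_deriv (interior_subset hy2)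
      (interior_subset hw2) hw3 (h_diff w hw2))
  · intro a ha
    have h1 : ∀ᶠ y in 𝓝[>] x, slope g x y < a :=
      (hslope.mono_left (nhdsWithin_mono _ (fun y hy => ne_of_gt hy))).eventually_lt_const ha
    have h2 : ∀ᶠ y in 𝓝[>] x, y ∈ interior (effDom I) := nhdsWithin_le_nhds hnhds
    obtain ⟨y, ⟨hy1, hy2⟩, hy3⟩ := ((h1.and h2).and self_mem_nhdsWithin).exists
    have hyx : x < y := hy3
    have hc : ContinuousAt (fun w => slope g w y) x := by
      simp only [slope_def_field]
      exact (continuousAt_const.sub (hcont x hx)).div (by fun_prop) (by linarith)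
    filter_upwards [hc.eventually (gt_mem_nhds hy1), hnhds, gt_mem_nhds hyx] with w hw hw2 hw3
    exact (hI.convexOn_toReal.deriv_le_slope (interior_subset hw2)
      (interior_subset hy2) hw3 (h_diff w hw2)).trans_lt hw

end Rate

/-! ### Paths of signed measures and their left limits -/

/-- The mass of `S` under the signed measure `f dt + μ - ν`. -/
noncomputable def incr (f : ℝ → ℝ) (μ ν : Measure ℝ) (S : Set ℝ) : ℝ :=
  (∫ s in S, f s) + μ.real S - ν.real S

/-- The path with density `f` and singular parts `μ`, `ν`. -/
noncomputable def path (f : ℝ → ℝ) (μ ν : Measure ℝ) (t : ℝ) : ℝ := incr f μ ν (Icc 0 t)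

/-- The left limits of `path f μ ν`. -/
noncomputable def prePath (f : ℝ → ℝ) (μ ν : Measure ℝ) (t : ℝ) : ℝ := incr f μ ν (Ico 0 t)

/-- An integrable density with two finite, singular and mutually singular measures. -/
structure IsTriple (f : ℝ → ℝ) (μ ν : Measure ℝ) : Prop where
  integrable : Integrable f
  finite_pos : IsFiniteMeasure μ
  finite_neg : IsFiniteMeasure ν
  singular_pos : μ ⟂ₘ volume
  singular_neg : ν ⟂ₘ volume
  hahn : μ ⟂ₘ ν

section Triple

variable {f : ℝ → ℝ} {μ ν : Measure ℝ}

lemma IsTriple.incr_union (h : IsTriple f μ ν) {S T : Set ℝ} (hd : Disjoint S T)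
    (hT : MeasurableSet T) : incr f μ ν (S ∪ T) = incr f μ ν S + incr f μ ν T := by
  have := h.finite_pos
  have := h.finite_neg
  unfold incr
  rw [setIntegral_union hd hT h.integrable.integrableOn h.integrable.integrableOn,
    measureReal_union hd hT, measureReal_union hd hT]
  ring

/-- Dominated convergence for the density and for the indicators under the finite measures. All
one-sided limits of `path` and `prePath` are instances. -/
lemma IsTriple.tendsto_incr (h : IsTriple f μ ν) {ι : Type*} {l : Filter ι}
    [l.IsCountablyGenerated] {S : ι → Set ℝ} {T : Set ℝ} (hS : ∀ i, MeasurableSet (S i))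
    (hT : MeasurableSet T) (hlim : ∀ x, ∀ᶠ i in l, x ∈ S i ↔ x ∈ T) :
    Tendsto (fun i => incr f μ ν (S i)) l (𝓝 (incr f μ ν T)) := by
  have := h.finite_pos
  have := h.finite_neg
  have hm : ∀ (ρ : Measure ℝ) [IsFiniteMeasure ρ],
      Tendsto (fun i => ρ.real (S i)) l (𝓝 (ρ.real T)) := by
    intro ρ _
    rcases l.eq_or_neBot with rfl | hl
    · simp
    exact (ENNReal.tendsto_toReal (measure_ne_top _ _)).comp
      (tendsto_measure_of_tendsto_indicator_of_isFiniteMeasure l ρ hS hlim)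
  refine Tendsto.sub (Tendsto.add ?_ (hm μ)) (hm ν)
  simp only [← integral_indicator (hS _), ← integral_indicator hT]
  refine tendsto_integral_filter_of_dominated_convergence (fun x => ‖f x‖) ?_ ?_
    h.integrable.norm ?_
  · exact Eventually.of_forall fun i => (h.integrable.indicator (hS i)).aestronglyMeasurable
  · exact Eventually.of_forall fun i => Eventually.of_forall fun x =>
      norm_indicator_le_norm_self _ _
  · refine Eventually.of_forall fun x => ?_
    refine tendsto_const_nhds.congr' ?_
    filter_upwards [hlim x] with i hi
    by_cases hx : x ∈ T <;> simp [indicator, hi, hx]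

/-- Only the side from which s tends to t decides whether t belongs to the limit set, not whether
the intervals are closed. This is why `path` and `prePath` have the same one-sided limits. -/
lemma eventually_mem_Icc_iff (t x : ℝ) :
    (∀ᶠ s in 𝓝[>] t, x ∈ Icc 0 s ↔ x ∈ Icc 0 t) ∧ (∀ᶠ s in 𝓝[>] t, x ∈ Ico 0 s ↔ x ∈ Icc 0 t) ∧
    (∀ᶠ s in 𝓝[<] t, x ∈ Icc 0 s ↔ x ∈ Ico 0 t) ∧
    (∀ᶠ s in 𝓝[<] t, x ∈ Ico 0 s ↔ x ∈ Ico 0 t) := by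
  rcases lt_trichotomy x t with h | h | h
  · have h1 : ∀ᶠ s in 𝓝[<] t, x < s := eventually_nhdsWithin_of_eventually_nhds (lt_mem_nhds h)
    refine ⟨?_, ?_, ?_, ?_⟩
    · filter_upwards [self_mem_nhdsWithin] with s (hs : t < s)
      simp only [mem_Icc]; grind
    · filter_upwards [self_mem_nhdsWithin] with s (hs : t < s)
      simp only [mem_Icc, mem_Ico]; grind
    · filter_upwards [h1] with s hs
      simp only [mem_Icc, mem_Ico]; grind
    · filter_upwards [h1] with s hs
      simp only [mem_Ico]; grind
  · subst h
    refine ⟨?_, ?_, ?_, ?_⟩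
    all_goals
      filter_upwards [self_mem_nhdsWithin] with s hs
      simp only [mem_Icc, mem_Ico, mem_Iio, mem_Ioi] at *; grind
  · have h1 : ∀ᶠ s in 𝓝[>] t, s < x := eventually_nhdsWithin_of_eventually_nhds (gt_mem_nhds h)
    refine ⟨?_, ?_, ?_, ?_⟩
    · filter_upwards [h1] with s hs
      simp only [mem_Icc]; grind
    · filter_upwards [h1] with s hs
      simp only [mem_Icc, mem_Ico]; grind
    · filter_upwards [self_mem_nhdsWithin] with s (hs : s < t)
      simp only [mem_Icc, mem_Ico]; grind
    · filter_upwards [self_mem_nhdsWithin] with s (hs : s < t)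
      simp only [mem_Ico]; grind

lemma IsTriple.path_right (h : IsTriple f μ ν) (t : ℝ) :
    Tendsto (path f μ ν) (𝓝[>] t) (𝓝 (path f μ ν t)) :=
  h.tendsto_incr (fun _ => measurableSet_Icc) measurableSet_Icc
    fun x => (eventually_mem_Icc_iff t x).1

lemma IsTriple.prePath_right (h : IsTriple f μ ν) (t : ℝ) :
    Tendsto (prePath f μ ν) (𝓝[>] t) (𝓝 (path f μ ν t)) :=
  h.tendsto_incr (fun _ => measurableSet_Ico) measurableSet_Icc
    fun x => (eventually_mem_Icc_iff t x).2.1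

lemma IsTriple.path_left (h : IsTriple f μ ν) (t : ℝ) :
    Tendsto (path f μ ν) (𝓝[<] t) (𝓝 (prePath f μ ν t)) :=
  h.tendsto_incr (fun _ => measurableSet_Icc) measurableSet_Ico
    fun x => (eventually_mem_Icc_iff t x).2.2.1

lemma IsTriple.prePath_left (h : IsTriple f μ ν) (t : ℝ) :
    Tendsto (prePath f μ ν) (𝓝[<] t) (𝓝 (prePath f μ ν t)) :=
  h.tendsto_incr (fun _ => measurableSet_Ico) measurableSet_Ico
    fun x => (eventually_mem_Icc_iff t x).2.2.2

lemma IsTriple.path_eq (h : IsTriple f μ ν) {s t : ℝ} (hs : 0 ≤ s) (hst : s ≤ t) :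
    path f μ ν t = path f μ ν s + incr f μ ν (Ioc s t) := by
  rw [path, path, ← h.incr_union _ measurableSet_Ioc, Icc_union_Ioc_eq_Icc hs hst]
  exact Set.disjoint_left.2 fun x hx hx' => absurd hx.2 (not_le.2 hx'.1)

lemma IsTriple.prePath_eq (h : IsTriple f μ ν) {s t : ℝ} (hs : 0 ≤ s) (hst : s ≤ t) :
    prePath f μ ν t = prePath f μ ν s + incr f μ ν (Ico s t) := by
  rw [prePath, prePath, ← h.incr_union _ measurableSet_Ico, Ico_union_Ico_eq_Ico hs hst]
  exact Set.disjoint_left.2 fun x hx hx' => absurd hx.2 (not_lt.2 hx'.1)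

lemma IsTriple.path_eq_prePath (h : IsTriple f μ ν) {s t : ℝ} (hs : 0 ≤ s) (hst : s ≤ t) :
    path f μ ν t = prePath f μ ν s + incr f μ ν (Icc s t) := by
  rw [path, prePath, ← h.incr_union _ measurableSet_Icc, Ico_union_Icc_eq_Icc hs hst]
  exact Set.disjoint_left.2 fun x hx hx' => absurd hx.2 (not_lt.2 hx'.1)

lemma incr_singleton (f : ℝ → ℝ) (μ ν : Measure ℝ) (t : ℝ) :
    incr f μ ν {t} = μ.real {t} - ν.real {t} := by
  simp [incr]

lemma IsTriple.path_eq_atom (h : IsTriple f μ ν) {t : ℝ} (ht : 0 ≤ t) :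
    path f μ ν t = prePath f μ ν t + μ.real {t} - ν.real {t} := by
  rw [h.path_eq_prePath ht le_rfl, Icc_self, incr_singleton]
  ring

lemma prePath_of_nonpos (f : ℝ → ℝ) (μ ν : Measure ℝ) {t : ℝ} (ht : t ≤ 0) :
    prePath f μ ν t = 0 := by
  simp [prePath, Ico_eq_empty (not_lt.2 ht), incr]

lemma IsTriple.path_cadlag (h : IsTriple f μ ν) : IsCadlag (path f μ ν) := by
  constructor
  · intro t _
    have : ContinuousWithinAt (path f μ ν) (Ioi t) t := h.path_right t
    exact (continuousWithinAt_Ioi_iff_Ici.1 this).mono Icc_subset_Ici_self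
  · intro t _
    exact ⟨_, (h.path_left t).mono_left (nhdsWithin_mono _ Ico_subset_Iio_self)⟩

lemma boundedVariationOn_of_le {φ g : ℝ → ℝ} {s : Set ℝ} (hg : BoundedVariationOn g s)
    (hle : ∀ x ∈ s, ∀ y ∈ s, |φ x - φ y| ≤ |g x - g y|) : BoundedVariationOn φ s := by
  refine ne_top_of_le_ne_top hg ?_
  refine iSup_le fun p => ?_
  refine le_trans ?_ (eVariationOn.sum_le (f := g) (n := p.1) p.2.2.1 p.2.2.2)
  refine Finset.sum_le_sum fun i _ => ?_
  rw [edist_dist, edist_dist]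
  exact ENNReal.ofReal_le_ofReal (hle _ (p.2.2.2 _) _ (p.2.2.2 _))

/-- The increments are dominated by those of the monotone function built from |f|, μ and ν. -/
lemma IsTriple.path_boundedVariationOn (h : IsTriple f μ ν) :
    BoundedVariationOn (path f μ ν) (Icc 0 1) := by
  have := h.finite_pos
  have := h.finite_neg
  set g : ℝ → ℝ := fun t => (∫ s in Icc 0 t, |f s|) + μ.real (Icc 0 t) + ν.real (Icc 0 t) with hg
  have hmono : ∀ ⦃s t : ℝ⦄, s ≤ t → (∫ x in Icc 0 s, |f x|) ≤ ∫ x in Icc 0 t, |f x| := by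
    intro s t hst
    exact setIntegral_mono_set h.integrable.abs.integrableOn
      (Eventually.of_forall fun x => abs_nonneg _) (Icc_subset_Icc_right hst).eventuallyLE
  have hm2 : ∀ (ρ : Measure ℝ) [IsFiniteMeasure ρ] ⦃s t : ℝ⦄, s ≤ t →
      ρ.real (Icc 0 s) ≤ ρ.real (Icc 0 t) :=
    fun ρ _ s t hst => measureReal_mono (Icc_subset_Icc_right hst)
  have hgm : Monotone g := by
    intro s t hst
    exact add_le_add (add_le_add (hmono hst) (hm2 μ hst)) (hm2 ν hst)
  have hbv : BoundedVariationOn g (Icc 0 1) := by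
    refine (hgm.monotoneOn _).boundedVariationOn (C := |g 0| + |g 1|) fun x hx => ?_
    have h1 := hgm hx.1
    have h2 := hgm hx.2
    rw [abs_le]
    constructor
    · linarith [neg_abs_le (g 0), abs_nonneg (g 1)]
    · linarith [le_abs_self (g 1), abs_nonneg (g 0)]
  refine boundedVariationOn_of_le hbv ?_
  have key : ∀ s ∈ Icc (0 : ℝ) 1, ∀ t, s ≤ t → |path f μ ν t - path f μ ν s| ≤ g t - g s := by
    intro s hs t hst
    have h1 : (∫ x in Icc 0 t, |f x|) = (∫ x in Icc 0 s, |f x|) + ∫ x in Ioc s t, |f x| := by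
      rw [← setIntegral_union _ measurableSet_Ioc h.integrable.abs.integrableOn
        h.integrable.abs.integrableOn, Icc_union_Ioc_eq_Icc hs.1 hst]
      exact Set.disjoint_left.2 fun x hx hx' => absurd hx.2 (not_le.2 hx'.1)
    have h2 : ∀ (ρ : Measure ℝ) [IsFiniteMeasure ρ],
        ρ.real (Icc 0 t) = ρ.real (Icc 0 s) + ρ.real (Ioc s t) := by
      intro ρ _
      rw [← measureReal_union _ measurableSet_Ioc, Icc_union_Ioc_eq_Icc hs.1 hst]
      exact Set.disjoint_left.2 fun x hx hx' => absurd hx.2 (not_le.2 hx'.1)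
    rw [h.path_eq hs.1 hst]
    simp only [hg, h1, h2 μ, h2 ν, incr]
    have h3 : |∫ x in Ioc s t, f x| ≤ ∫ x in Ioc s t, |f x| := abs_integral_le_integral_abs
    have h4 : 0 ≤ μ.real (Ioc s t) := measureReal_nonneg
    have h5 : 0 ≤ ν.real (Ioc s t) := measureReal_nonneg
    rw [abs_le] at h3 ⊢
    constructor <;> linarith [h3.1, h3.2]
  intro x hx y hy
  rcases le_total x y with hxy | hxy
  · rw [abs_sub_comm, abs_sub_comm (g x)]
    exact (key x hx y hxy).trans (le_abs_self _)
  · exact (key y hy x hxy).trans (le_abs_self _)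

lemma IsTriple.path_measurable (h : IsTriple f μ ν) : Measurable (path f μ ν) := by
  have := h.finite_pos
  have := h.finite_neg
  have hm : ∀ (ρ : Measure ℝ) [IsFiniteMeasure ρ], Measurable fun t => ρ.real (Icc 0 t) :=
    fun ρ _ => Monotone.measurable fun s t hst => measureReal_mono (Icc_subset_Icc_right hst)
  have hp : Monotone fun t => ∫ s in Icc 0 t, max (f s) 0 := by
    intro s t hst
    exact setIntegral_mono_set h.integrable.pos_part.integrableOn
      (Eventually.of_forall fun x => le_max_right _ _) (Icc_subset_Icc_right hst).eventuallyLE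
  have hn : Monotone fun t => ∫ s in Icc 0 t, max (-f s) 0 := by
    intro s t hst
    exact setIntegral_mono_set h.integrable.neg_part.integrableOn
      (Eventually.of_forall fun x => le_max_right _ _) (Icc_subset_Icc_right hst).eventuallyLE
  have e : path f μ ν = fun t => ((∫ s in Icc 0 t, max (f s) 0) - ∫ s in Icc 0 t, max (-f s) 0)
      + μ.real (Icc 0 t) - ν.real (Icc 0 t) := by
    funext t
    rw [← integral_sub h.integrable.pos_part.integrableOn h.integrable.neg_part.integrableOn]
    simp only [path, incr]
    congr 3
    funext x
    rcases le_total (f x) 0 with hx | hx <;> simp [hx]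
  rw [e]
  exact ((hp.measurable.sub hn.measurable).add (hm μ)).sub (hm ν)

lemma IsTriple.exists_bound (h : IsTriple f μ ν) : ∃ M, ∀ t, |path f μ ν t| ≤ M := by
  have := h.finite_pos
  have := h.finite_neg
  refine ⟨(∫ x, |f x|) + μ.real univ + ν.real univ, fun t => ?_⟩
  have h1 : |∫ x in Icc 0 t, f x| ≤ ∫ x, |f x| :=
    abs_integral_le_integral_abs.trans (setIntegral_le_integral h.integrable.abs
      (Eventually.of_forall fun x => abs_nonneg _))
  have h2 : μ.real (Icc 0 t) ≤ μ.real univ := measureReal_mono (subset_univ _)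
  have h3 : ν.real (Icc 0 t) ≤ ν.real univ := measureReal_mono (subset_univ _)
  have h4 : 0 ≤ μ.real (Icc 0 t) := measureReal_nonneg
  have h5 : 0 ≤ ν.real (Icc 0 t) := measureReal_nonneg
  simp only [path, incr]
  rw [abs_le] at h1 ⊢
  constructor <;> linarith [h1.1, h1.2]

lemma IsTriple.path_integrableOn (h : IsTriple f μ ν) {S : Set ℝ} (hS : volume S ≠ ⊤) :
    IntegrableOn (path f μ ν) S := by
  obtain ⟨M, hM⟩ := h.exists_bound
  exact Measure.integrableOn_of_bounded hS h.path_measurable.aestronglyMeasurable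
    (Eventually.of_forall hM)

/-- If the path is non-negative on `[0, 1)`, then so are its left limits on `[0, 1]`. -/
lemma IsTriple.prePath_nonneg (h : IsTriple f μ ν) (hpos : ∀ t ∈ Ico (0 : ℝ) 1, 0 ≤ path f μ ν t)
    {t : ℝ} (ht : t ≤ 1) : 0 ≤ prePath f μ ν t := by
  rcases le_or_gt t 0 with h0 | h0
  · rw [prePath_of_nonpos _ _ _ h0]
  · refine ge_of_tendsto (h.path_left t) ?_
    filter_upwards [Ioo_mem_nhdsLT h0] with s hs
    exact hpos s ⟨hs.1.le, hs.2.trans_le ht⟩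

/-- Restricting the measures to `[0, 1)` and the density to `[0, 1]` makes the path continuous at
`1` and does not change it on `[0, 1)`. -/
lemma IsTriple.truncate (h : IsTriple f μ ν) :
    IsTriple ((Icc 0 1).indicator f) (μ.restrict (Ico 0 1)) (ν.restrict (Ico 0 1)) := by
  have := h.finite_pos
  have := h.finite_neg
  exact ⟨h.integrable.indicator measurableSet_Icc, inferInstance, inferInstance,
    h.singular_pos.restrict _, h.singular_neg.restrict _,
    (h.hahn.restrict _).symm.restrict _ |>.symm⟩

lemma incr_truncate (f : ℝ → ℝ) (μ ν : Measure ℝ) {S : Set ℝ} (hS : S ⊆ Ico 0 1) :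
    incr ((Icc 0 1).indicator f) (μ.restrict (Ico 0 1)) (ν.restrict (Ico 0 1)) S =
      incr f μ ν S := by
  have h1 : ∫ s in S, (Icc 0 1).indicator f s = ∫ s in S, f s := by
    rw [setIntegral_indicator measurableSet_Icc, inter_eq_left.2]
    exact hS.trans Ico_subset_Icc_self
  rw [incr, incr, h1, measureReal_def, measureReal_def, Measure.restrict_eq_self _ hS,
    Measure.restrict_eq_self _ hS]
  rfl

lemma path_truncate (f : ℝ → ℝ) (μ ν : Measure ℝ) {t : ℝ} (ht : t < 1) :
    path ((Icc 0 1).indicator f) (μ.restrict (Ico 0 1)) (ν.restrict (Ico 0 1)) t =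
      path f μ ν t :=
  incr_truncate f μ ν fun _ hx => ⟨hx.1, hx.2.trans_lt ht⟩

end Triple

/-- The cost of the path with density `f` and singular parts `μ`, `ν`, without the cost of the jump
at time `1`. -/
noncomputable def openCost (I : ℝ → ℝ≥0∞) (θdown θup : ℝ≥0∞) (f : ℝ → ℝ) (μ ν : Measure ℝ) :
    ℝ≥0∞ :=
  (∫⁻ s in Icc (0 : ℝ) 1, {s | 0 < path f μ ν s}.indicator (fun s => I (f s)) s)
    + θdown * ν (Ico 0 1) + θup * μ (Ico 0 1)

/-! ### Uniqueness of the Lebesgue decomposition -/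

section Uniqueness

variable {f₁ f₂ : ℝ → ℝ} {μ₁ μ₂ ν₁ ν₂ : Measure ℝ}

/-- A signed measure on the line determines its absolutely continuous density and the Jordan
decomposition of its singular part. -/
lemma IsTriple.unique (h₁ : IsTriple f₁ μ₁ ν₁) (h₂ : IsTriple f₂ μ₂ ν₂)
    (heq : ∀ t, incr f₁ μ₁ ν₁ (Iic t) = incr f₂ μ₂ ν₂ (Iic t)) :
    f₁ =ᵐ[volume] f₂ ∧ μ₁ = μ₂ ∧ ν₁ = ν₂ := by
  have := h₁.finite_pos
  have := h₁.finite_neg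
  have := h₂.finite_pos
  have := h₂.finite_neg
  -- All negative terms are moved to the other side, so that the equality of signed measures becomes
  -- an equality of positive finite measures, which the half-lines determine.
  set g₁ : ℝ → ℝ≥0∞ := fun x => ENNReal.ofReal (f₁ x) + ENNReal.ofReal (-f₂ x) with hg₁
  set g₂ : ℝ → ℝ≥0∞ := fun x => ENNReal.ofReal (f₂ x) + ENNReal.ofReal (-f₁ x) with hg₂
  have m₁ : AEMeasurable f₁ := h₁.integrable.aemeasurable
  have m₂ : AEMeasurable f₂ := h₂.integrable.aemeasurable
  have hg₁m : AEMeasurable g₁ := m₁.ennreal_ofReal.add m₂.neg.ennreal_ofReal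
  have hg₂m : AEMeasurable g₂ := m₂.ennreal_ofReal.add m₁.neg.ennreal_ofReal
  have fin : ∀ {g : ℝ → ℝ} {S : Set ℝ}, Integrable g → ∫⁻ x in S, ENNReal.ofReal (g x) ≠ ⊤ :=
    fun hg => hg.integrableOn.lintegral_lt_top.ne
  have i₁ : Integrable (fun x => -f₁ x) := h₁.integrable.neg
  have i₂ : Integrable (fun x => -f₂ x) := h₂.integrable.neg
  have e₁ : ∀ S, ∫⁻ x in S, g₁ x =
      (∫⁻ x in S, ENNReal.ofReal (f₁ x)) + ∫⁻ x in S, ENNReal.ofReal (-f₂ x) := fun S =>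
    lintegral_add_left' m₁.ennreal_ofReal.restrict _
  have e₂ : ∀ S, ∫⁻ x in S, g₂ x =
      (∫⁻ x in S, ENNReal.ofReal (f₂ x)) + ∫⁻ x in S, ENNReal.ofReal (-f₁ x) := fun S =>
    lintegral_add_left' m₂.ennreal_ofReal.restrict _
  have n₁ : ∀ S, ∫⁻ x in S, g₁ x ≠ ⊤ := fun S => by
    rw [e₁]; exact ENNReal.add_ne_top.2 ⟨fin h₁.integrable, fin i₂⟩
  have n₂ : ∀ S, ∫⁻ x in S, g₂ x ≠ ⊤ := fun S => by
    rw [e₂]; exact ENNReal.add_ne_top.2 ⟨fin h₂.integrable, fin i₁⟩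
  have : IsFiniteMeasure (volume.withDensity g₁) :=
    isFiniteMeasure_withDensity (by simpa using n₁ univ)
  have hsum : (μ₁ + ν₂) + volume.withDensity g₁ = (μ₂ + ν₁) + volume.withDensity g₂ := by
    refine Measure.ext_of_Iic _ _ fun t => ?_
    have h := heq t
    simp only [incr] at h
    rw [integral_eq_lintegral_pos_part_sub_lintegral_neg_part h₁.integrable.integrableOn,
      integral_eq_lintegral_pos_part_sub_lintegral_neg_part h₂.integrable.integrableOn] at h
    simp only [Measure.add_apply, withDensity_apply _ measurableSet_Iic]
    rw [← ENNReal.toReal_eq_toReal_iff'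
      (ENNReal.add_ne_top.2 ⟨ENNReal.add_ne_top.2 ⟨measure_ne_top _ _, measure_ne_top _ _⟩, n₁ _⟩)
      (ENNReal.add_ne_top.2 ⟨ENNReal.add_ne_top.2 ⟨measure_ne_top _ _, measure_ne_top _ _⟩, n₂ _⟩),
      ENNReal.toReal_add
        (ENNReal.add_ne_top.2 ⟨measure_ne_top _ _, measure_ne_top _ _⟩) (n₁ _),
      ENNReal.toReal_add
        (ENNReal.add_ne_top.2 ⟨measure_ne_top _ _, measure_ne_top _ _⟩) (n₂ _), e₁, e₂,
      ENNReal.toReal_add (measure_ne_top _ _) (measure_ne_top _ _),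
      ENNReal.toReal_add (measure_ne_top _ _) (measure_ne_top _ _),
      ENNReal.toReal_add (fin h₁.integrable) (fin i₂),
      ENNReal.toReal_add (fin h₂.integrable) (fin i₁)]
    simp only [measureReal_def] at h
    linarith
  have s₁ : (μ₁ + ν₂) ⟂ₘ volume := h₁.singular_pos.add_left h₂.singular_neg
  have s₂ : (μ₂ + ν₁) ⟂ₘ volume := h₂.singular_pos.add_left h₁.singular_neg
  -- Both densities are the Radon-Nikodym derivative of the same measure.
  have hg : g₁ =ᵐ[volume] g₂ :=
    (Measure.eq_rnDeriv₀ hg₁m s₁ rfl).trans (Measure.eq_rnDeriv₀ hg₂m s₂ hsum).symm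
  have hs : μ₁ + ν₂ = μ₂ + ν₁ := by
    rw [withDensity_congr_ae hg] at hsum
    have : IsFiniteMeasure (volume.withDensity g₂) :=
      isFiniteMeasure_withDensity (by simpa using n₂ univ)
    ext S hS
    have := congrArg (fun ρ : Measure ℝ => ρ S) hsum
    simp only [Measure.add_apply] at this ⊢
    exact (ENNReal.add_left_inj (measure_ne_top _ _)).1 this
  refine ⟨?_, ?_⟩
  · filter_upwards [hg] with x hx
    simp only [hg₁, hg₂] at hx
    have := congrArg ENNReal.toReal hx
    rw [ENNReal.toReal_add ENNReal.ofReal_ne_top ENNReal.ofReal_ne_top,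
      ENNReal.toReal_add ENNReal.ofReal_ne_top ENNReal.ofReal_ne_top] at this
    simp only [ENNReal.toReal_ofReal'] at this
    have a1 : max (f₁ x) 0 - max (-f₁ x) 0 = f₁ x := by
      rcases le_total (f₁ x) 0 with h | h <;> simp [h]
    have a2 : max (f₂ x) 0 - max (-f₂ x) 0 = f₂ x := by
      rcases le_total (f₂ x) 0 with h | h <;> simp [h]
    linarith
  -- Equal singular signed measures have equal Jordan parts; this is where the mutual singularity of
  -- μ and ν enters.
  · let j₁ : JordanDecomposition ℝ := ⟨μ₁, ν₁, h₁.hahn⟩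
    let j₂ : JordanDecomposition ℝ := ⟨μ₂, ν₂, h₂.hahn⟩
    have hj : j₁ = j₂ := by
      apply JordanDecomposition.toSignedMeasure_injective
      have := Measure.toSignedMeasure_congr hs
      rw [Measure.toSignedMeasure_add, Measure.toSignedMeasure_add] at this
      simp only [JordanDecomposition.toSignedMeasure, j₁, j₂]
      rw [sub_eq_sub_iff_add_eq_add, this]
    exact ⟨congrArg JordanDecomposition.posPart hj, congrArg JordanDecomposition.negPart hj⟩

end Uniqueness

section Decomp

variable {f : ℝ → ℝ} {μ ν : Measure ℝ} {ψ : ℝ → ℝ}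

lemma IsLebesgueDecomp.isTriple (h : IsLebesgueDecomp ψ f μ ν) :
    IsTriple ((Icc 0 1).indicator f) μ ν :=
  ⟨(integrable_indicator_iff measurableSet_Icc).2 h.integrable, h.finite_pos, h.finite_neg,
    h.singular_pos, h.singular_neg, h.hahn⟩

lemma IsLebesgueDecomp.path_eq (h : IsLebesgueDecomp ψ f μ ν) {t : ℝ} (ht : t ∈ Icc (0 : ℝ) 1) :
    path ((Icc 0 1).indicator f) μ ν t = ψ t := by
  rw [h.repr t ht, path, incr, intervalIntegral.integral_of_le ht.1, ← integral_Icc_eq_integral_Ioc,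
    setIntegral_indicator measurableSet_Icc, inter_eq_left.2 (Icc_subset_Icc_right ht.2)]

/-- A triple supported on `[0, 1]` is the Lebesgue decomposition of its path. -/
lemma IsTriple.isLebesgueDecomp (h : IsTriple f μ ν) (hμ : μ (Icc 0 1)ᶜ = 0)
    (hν : ν (Icc 0 1)ᶜ = 0) (hψ : ∀ t ∈ Icc (0 : ℝ) 1, ψ t = path f μ ν t) :
    IsLebesgueDecomp ψ f μ ν := by
  refine ⟨h.integrable.integrableOn, h.finite_pos, h.finite_neg, hμ, hν, h.singular_pos,
    h.singular_neg, h.hahn, fun t ht => ?_⟩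
  rw [hψ t ht, path, incr, intervalIntegral.integral_of_le ht.1, ← integral_Icc_eq_integral_Ioc]

lemma incr_inter (hf : ∀ x ∉ Icc (0 : ℝ) 1, f x = 0) (hμ : μ (Icc 0 1)ᶜ = 0)
    (hν : ν (Icc 0 1)ᶜ = 0) (S : Set ℝ) : incr f μ ν (S ∩ Icc 0 1) = incr f μ ν S := by
  have e : ∀ ρ : Measure ℝ, ρ (Icc 0 1)ᶜ = 0 → ρ (S ∩ Icc 0 1) = ρ S := fun ρ hρ =>
    measure_inter_conull hρ
  have e2 : ∫ x in S ∩ Icc 0 1, f x = ∫ x in S, f x := by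
    have : f = (Icc 0 1).indicator f := by
      funext x
      by_cases hx : x ∈ Icc (0 : ℝ) 1
      · simp [hx]
      · rw [indicator_of_notMem hx, hf x hx]
    conv_rhs => rw [this]
    rw [setIntegral_indicator measurableSet_Icc]
  rw [incr, incr, e2, measureReal_def, measureReal_def, e μ hμ, e ν hν]
  rfl

lemma incr_Iic (hf : ∀ x ∉ Icc (0 : ℝ) 1, f x = 0) (hμ : μ (Icc 0 1)ᶜ = 0)
    (hν : ν (Icc 0 1)ᶜ = 0) (t : ℝ) : incr f μ ν (Iic t) = path f μ ν (min t 1) := by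
  rw [path, ← incr_inter hf hμ hν (Iic t)]
  congr 1
  ext x
  simp only [mem_inter_iff, mem_Iic, mem_Icc, le_min_iff]
  tauto

lemma path_of_neg (f : ℝ → ℝ) (μ ν : Measure ℝ) {t : ℝ} (ht : t < 0) : path f μ ν t = 0 := by
  simp [path, Icc_eq_empty (not_le.2 ht), incr]

lemma IsLebesgueDecomp.unique {f₂ : ℝ → ℝ} {μ₂ ν₂ : Measure ℝ} (h : IsLebesgueDecomp ψ f μ ν)
    (h₂ : IsLebesgueDecomp ψ f₂ μ₂ ν₂) :
    (Icc 0 1).indicator f =ᵐ[volume] (Icc 0 1).indicator f₂ ∧ μ = μ₂ ∧ ν = ν₂ := by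
  refine h.isTriple.unique h₂.isTriple fun t => ?_
  rw [incr_Iic (fun x hx => indicator_of_notMem hx _) h.supp_pos h.supp_neg,
    incr_Iic (fun x hx => indicator_of_notMem hx _) h₂.supp_pos h₂.supp_neg]
  rcases lt_or_ge (min t 1) 0 with h0 | h0
  · rw [path_of_neg _ _ _ h0, path_of_neg _ _ _ h0]
  · rw [h.path_eq ⟨h0, min_le_right _ _⟩, h₂.path_eq ⟨h0, min_le_right _ _⟩]

variable {I : ℝ → ℝ≥0∞} {δ : ℝ} {θdown θup : ℝ≥0∞}

lemma IsLebesgueDecomp.J_eq (h : IsLebesgueDecomp ψ f μ ν) :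
    J I θdown θup ψ = cost I θdown θup ψ f μ ν := by
  refine le_antisymm (iInf₂_le_of_le f μ (iInf₂_le ν h)) ?_
  refine le_iInf₂ fun f₂ μ₂ => le_iInf₂ fun ν₂ h₂ => ?_
  obtain ⟨hf, rfl, rfl⟩ := h.unique h₂
  refine le_of_eq ?_
  unfold cost
  congr 2
  refine setLIntegral_congr_fun_ae measurableSet_Icc ?_
  filter_upwards [hf] with x hx hx1
  rw [indicator_of_mem hx1, indicator_of_mem hx1] at hx
  simp [indicator, hx]

/-- Time spent at zero is free, because the infimum over y ≤ 0 is attained at -δ with value 0. -/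
lemma cost_eq (hδ : 0 < δ) (hIδ : I (-δ) = 0) (ψ f : ℝ → ℝ) (μ ν : Measure ℝ) :
    cost I θdown θup ψ f μ ν = (∫⁻ s in Icc (0 : ℝ) 1, {s | 0 < ψ s}.indicator (fun s => I (f s)) s)
      + θdown * ν (Icc 0 1) + θup * μ (Icc 0 1) := by
  simp only [cost, iInf_nonpos_eq_zero hδ hIδ, indicator_zero, add_zero]

end Decomp

/-! ### Time changes and space-time scaling -/

section TimeChange

variable {f : ℝ → ℝ} {μ ν : Measure ℝ} {e : ℝ ≃ᵐ ℝ} {c : ℝ}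

lemma lintegral_timeChange (hvol : volume = ENNReal.ofReal c • volume.map e) (g : ℝ → ℝ≥0∞) :
    ∫⁻ s, g s = ENNReal.ofReal c * ∫⁻ u, g (e u) := by
  conv_lhs => rw [hvol]
  rw [lintegral_smul_measure, lintegral_map_equiv, smul_eq_mul]

lemma integral_timeChange (hc : 0 ≤ c) (hvol : volume = ENNReal.ofReal c • volume.map e)
    (g : ℝ → ℝ) : ∫ s, g s = c * ∫ u, g (e u) := by
  conv_lhs => rw [hvol]
  rw [integral_smul_measure, integral_map_equiv, ENNReal.toReal_ofReal hc, smul_eq_mul]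

/-- The map e multiplies lengths by c. The slopes are transported unchanged and the singular masses
are multiplied by c, so space is scaled like time. The case c < 1 serves the scaling argument, c = 1
the interval exchange. -/
lemma IsTriple.timeChange (h : IsTriple f μ ν)
    (hvol : volume = ENNReal.ofReal c • volume.map e) :
    IsTriple (f ∘ e.symm) (ENNReal.ofReal c • μ.map e) (ENNReal.ofReal c • ν.map e) := by
  have := h.finite_pos
  have := h.finite_neg
  have hs : ∀ ρ : Measure ℝ, ρ ⟂ₘ volume → (ENNReal.ofReal c • ρ.map e) ⟂ₘ volume := by
    intro ρ hρ
    rw [hvol]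
    exact ((e.measurableEmbedding.mutuallySingular_map hρ).smul _).symm.smul _ |>.symm
  refine ⟨?_, ?_, ?_, hs μ h.singular_pos, hs ν h.singular_neg, ?_⟩
  · rw [hvol]
    refine Integrable.smul_measure ?_ ENNReal.ofReal_ne_top
    rw [integrable_map_equiv]
    have : (f ∘ e.symm) ∘ e = f := by funext x; simp
    rw [this]
    exact h.integrable
  · exact Measure.smul_finite _ ENNReal.ofReal_ne_top
  · exact Measure.smul_finite _ ENNReal.ofReal_ne_top
  · exact ((e.measurableEmbedding.mutuallySingular_map h.hahn).smul _).symm.smul _ |>.symm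

lemma incr_timeChange (f : ℝ → ℝ) (μ ν : Measure ℝ) (hc : 0 ≤ c)
    (hvol : volume = ENNReal.ofReal c • volume.map e) (S : Set ℝ) :
    incr (f ∘ e.symm) (ENNReal.ofReal c • μ.map e) (ENNReal.ofReal c • ν.map e) S =
      c * incr f μ ν (e ⁻¹' S) := by
  have h1 : ∫ s in S, (f ∘ e.symm) s = c * ∫ s in e ⁻¹' S, f s := by
    conv_lhs => rw [hvol]
    rw [Measure.restrict_smul, integral_smul_measure, setIntegral_map_equiv,
      ENNReal.toReal_ofReal hc, smul_eq_mul]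
    simp
  have h2 : ∀ ρ : Measure ℝ, (ENNReal.ofReal c • ρ.map e).real S = c * ρ.real (e ⁻¹' S) := by
    intro ρ
    rw [measureReal_def, Measure.smul_apply, e.map_apply, smul_eq_mul, ENNReal.toReal_mul,
      ENNReal.toReal_ofReal hc, measureReal_def]
  rw [incr, incr, h1, h2, h2]
  ring

end TimeChange

/-- The map `u ↦ 1 - c + c u`, which shrinks `[0, 1]` onto `[1 - c, 1]`. -/
noncomputable def shrink (c : ℝ) (hc : c ≠ 0) : ℝ ≃ᵐ ℝ :=
  ((Homeomorph.mulLeft₀ c hc).trans (Homeomorph.addRight (1 - c))).toMeasurableEquiv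

lemma shrink_apply {c : ℝ} (hc : c ≠ 0) (u : ℝ) : shrink c hc u = c * u + (1 - c) := rfl

lemma volume_shrink {c : ℝ} (hc : 0 < c) :
    volume = ENNReal.ofReal c • (volume : Measure ℝ).map (shrink c hc.ne') := by
  have : (shrink c hc.ne' : ℝ → ℝ) = (fun x => x + (1 - c)) ∘ (fun x => c * x) := rfl
  rw [this, ← Measure.map_map (by fun_prop) (by fun_prop), ← Measure.map_smul]
  have h := Real.smul_map_volume_mul_left hc.ne'
  rw [abs_of_pos hc] at h
  rw [h, Measure.IsAddRightInvariant.map_add_right_eq_self]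

section

variable {f : ℝ → ℝ} {μ ν : Measure ℝ} {I : ℝ → ℝ≥0∞} {δ : ℝ} {θdown θup : ℝ≥0∞} {z : ℝ}
  {ψ : ℝ → ℝ}

/-- Space-time scaling: a path of area at least `z` yields a feasible path whose cost is smaller
by a factor. -/
lemma IsOptimalPath.le_openCost (hψ : IsOptimalPath I θdown θup z ψ) (hδ : 0 < δ)
    (hIδ : I (-δ) = 0) (hz : 0 < z) (h : IsTriple f μ ν)
    (hpos : ∀ t ∈ Ico (0 : ℝ) 1, 0 ≤ path f μ ν t)
    (ha : z ≤ ∫ s in (0 : ℝ)..1, path f μ ν s) :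
    J I θdown θup ψ ≤ ENNReal.ofReal (√(z / ∫ s in (0 : ℝ)..1, path f μ ν s)) *
      openCost I θdown θup f μ ν := by
  set a := ∫ s in (0 : ℝ)..1, path f μ ν s with ha'
  have ha0 : 0 < a := hz.trans_le ha
  -- The area is multiplied by c², so this factor brings it to exactly z.
  set c := √(z / a) with hc'
  have hc : 0 < c := Real.sqrt_pos.2 (div_pos hz ha0)
  have hc1 : c ≤ 1 := by
    rw [hc', Real.sqrt_le_one]
    exact (div_le_one ha0).2 ha
  have hca : c ^ 2 * a = z := by
    rw [hc', Real.sq_sqrt (div_pos hz ha0).le]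
    field_simp
  set F := (Icc 0 1).indicator f with hF
  -- Dropping the jump at time 1 keeps the area, and the value at 1 becomes a left limit, which is
  -- non-negative although non-negativity is assumed only before time 1.
  set M := μ.restrict (Ico 0 1) with hM
  set N := ν.restrict (Ico 0 1) with hN
  have ht : IsTriple F M N := h.truncate
  have hF0 : ∀ x ∉ Icc (0 : ℝ) 1, F x = 0 := fun x hx => indicator_of_notMem hx _
  have hs0 : ∀ ρ : Measure ℝ, ρ.restrict (Ico 0 1) (Icc 0 1)ᶜ = 0 := by
    intro ρ
    rw [Measure.restrict_apply measurableSet_Icc.compl]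
    convert measure_empty (μ := ρ)
    ext x
    simp only [mem_inter_iff, mem_compl_iff, mem_Icc, mem_Ico, mem_empty_iff_false]
    grind
  have hpath : ∀ t < 1, path F M N t = path f μ ν t := fun t ht => path_truncate f μ ν ht
  have hpathnn : ∀ t ≤ 1, 0 ≤ path F M N t := by
    intro t ht1
    rcases lt_or_ge t 0 with h0 | h0
    · rw [path_of_neg _ _ _ h0]
    rcases ht1.lt_or_eq with h1 | rfl
    · rw [hpath t h1]; exact hpos t ⟨h0, h1⟩
    · rw [ht.path_eq_atom zero_le_one]
      have e : ∀ ρ : Measure ℝ, (ρ.restrict (Ico 0 1)).real {(1 : ℝ)} = 0 := by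
        intro ρ
        rw [measureReal_restrict_apply (measurableSet_singleton _)]
        simp
      rw [e, e]
      simpa using ht.prePath_nonneg (t := 1)
        (fun t ht => by rw [hpath t ht.2]; exact hpos t ht) le_rfl
  set e := shrink c hc.ne' with he
  have hvol := volume_shrink hc
  rw [← he] at hvol
  have hT := ht.timeChange hvol
  set F' := F ∘ e.symm with hF'
  set M' := ENNReal.ofReal c • M.map e with hM'
  set N' := ENNReal.ofReal c • N.map e with hN'
  have he1 : ∀ {u}, u ≤ 1 → e u ≤ 1 := by
    intro u hu
    rw [he, shrink_apply]
    nlinarith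
  have he1' : ∀ {u}, 1 < u → 1 < e u := by
    intro u hu
    rw [he, shrink_apply]
    nlinarith
  have he0 : ∀ {u}, 0 ≤ u → 0 ≤ e u := by
    intro u hu
    rw [he, shrink_apply]
    nlinarith
  have hpath' : ∀ u ≤ 1, path F' M' N' (e u) = c * path F M N u := by
    intro u hu
    rw [path, incr_timeChange F M N hc.le hvol, path, ← incr_inter hF0 (hs0 μ) (hs0 ν)]
    congr 2
    ext x
    simp only [mem_inter_iff, mem_preimage, mem_Icc, he, shrink_apply]
    constructor
    · rintro ⟨⟨h1, h2⟩, h3, h4⟩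
      exact ⟨h3, le_of_mul_le_mul_left (by linarith) hc⟩
    · rintro ⟨h1, h2⟩
      refine ⟨⟨?_, ?_⟩, h1, h2.trans hu⟩ <;> nlinarith
  have hsupp : ∀ ρ : Measure ℝ,
      (ENNReal.ofReal c • (ρ.restrict (Ico 0 1)).map e) (Icc 0 1)ᶜ = 0 := by
    intro ρ
    rw [Measure.smul_apply, e.map_apply, smul_eq_mul]
    refine mul_eq_zero_of_right _ (measure_mono_null ?_ (hs0 ρ))
    exact fun u hu hu' => hu ⟨he0 hu'.1, he1 hu'.2⟩
  have hdec : IsLebesgueDecomp (path F' M' N') F' M' N' :=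
    hT.isLebesgueDecomp (hsupp μ) (hsupp ν) fun t _ => rfl
  have hfeas : IsFeasible z (path F' M' N') := by
    refine ⟨⟨hT.path_cadlag, hT.path_boundedVariationOn, ?_⟩, ?_⟩
    · intro s hs
      obtain ⟨u, rfl⟩ := e.surjective s
      have hu : u ≤ 1 := not_lt.1 fun h1 => absurd hs.2 (not_le.2 (he1' h1))
      rw [hpath' u hu]
      exact mul_nonneg hc.le (hpathnn u hu)
    · rw [intervalIntegral.integral_of_le zero_le_one, ← integral_Icc_eq_integral_Ioc,
        ← integral_indicator measurableSet_Icc, integral_timeChange hc.le hvol]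
      have e1 : ∀ u, (Icc (0 : ℝ) 1).indicator (path F' M' N') (e u) =
          c * (Icc (0 : ℝ) 1).indicator (path F M N) u := by
        intro u
        rcases lt_or_ge 1 u with h1 | h1
        · rw [indicator_of_notMem (fun h => absurd h.2 (not_le.2 (he1' h1))),
            indicator_of_notMem (fun h => absurd h.2 (not_le.2 h1)), mul_zero]
        · rcases lt_or_ge u 0 with h0 | h0
          · rw [indicator_of_notMem (a := u) (fun h => absurd h.1 (not_le.2 h0)), mul_zero,
              indicator_apply_eq_zero]
            intro _
            rw [hpath' u h1, path_of_neg _ _ _ h0, mul_zero]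
          · rw [indicator_of_mem (show u ∈ Icc (0 : ℝ) 1 from ⟨h0, h1⟩),
          indicator_of_mem (show e u ∈ Icc (0 : ℝ) 1 from ⟨he0 h0, he1 h1⟩), hpath' u h1]
      simp only [e1]
      rw [integral_const_mul, integral_indicator measurableSet_Icc, ← mul_assoc, ← sq, ← hca, ha',
        intervalIntegral.integral_of_le zero_le_one, ← integral_Icc_eq_integral_Ioc]
      congr 1
      refine setIntegral_congr_ae measurableSet_Icc ?_
      have : ∀ᵐ x : ℝ, x ≠ 1 := by simp [ae_iff]
      filter_upwards [this] with x hx hx1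
      exact hpath x (lt_of_le_of_ne hx1.2 hx)
  refine (hψ.minimal _ hfeas).trans ?_
  rw [hdec.J_eq, cost_eq hδ hIδ, openCost, mul_add, mul_add, ← mul_assoc _ θdown,
    mul_comm _ θdown, mul_assoc, ← mul_assoc _ θup, mul_comm _ θup, mul_assoc]
  have hmass : ∀ ρ : Measure ℝ, (ENNReal.ofReal c • (ρ.restrict (Ico 0 1)).map e) (Icc 0 1) ≤
      ENNReal.ofReal c * ρ (Ico 0 1) := by
    intro ρ
    rw [Measure.smul_apply, e.map_apply, smul_eq_mul]
    exact mul_le_mul_right ((measure_mono (subset_univ _)).trans_eq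
      (Measure.restrict_apply_univ _)) _
  refine add_le_add (add_le_add ?_ (mul_le_mul_right (hmass ν) _)) (mul_le_mul_right (hmass μ) _)
  rw [← lintegral_indicator measurableSet_Icc, ← lintegral_indicator measurableSet_Icc,
    lintegral_timeChange hvol]
  refine mul_le_mul_right (lintegral_mono_ae ?_) _
  have : ∀ᵐ x : ℝ, x ≠ 1 := by simp [ae_iff]
  filter_upwards [this] with u hu
  rcases lt_or_ge 1 u with h1 | h1
  · rw [indicator_of_notMem (fun h => absurd h.2 (not_le.2 (he1' h1)))]
    exact zero_le
  · rcases lt_or_ge u 0 with h0 | h0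
    · refine le_of_eq_of_le ?_ zero_le
      rw [indicator_apply_eq_zero]
      intro _
      rw [indicator_apply_eq_zero]
      intro h2
      rw [mem_ofPred_eq, hpath' u h1, path_of_neg _ _ _ h0, mul_zero] at h2
      exact absurd h2 (lt_irrefl _)
    · rw [indicator_of_mem (show u ∈ Icc (0 : ℝ) 1 from ⟨h0, h1⟩),
          indicator_of_mem (show e u ∈ Icc (0 : ℝ) 1 from ⟨he0 h0, he1 h1⟩)]
      by_cases h2 : 0 < path f μ ν u
      · rw [indicator_of_mem (s := {s | 0 < path f μ ν s}) h2]
        refine (indicator_le_self _ _ _).trans_eq ?_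
        simp only [hF', Function.comp_apply, e.symm_apply_apply, hF]
        rw [indicator_of_mem (show u ∈ Icc (0 : ℝ) 1 from ⟨h0, h1⟩)]
      · rw [indicator_of_notMem (s := {s | 0 < path F' M' N' s})]
        · exact zero_le
        · rw [mem_ofPred_eq, hpath' u h1, hpath u (lt_of_le_of_ne h1 hu)]
          exact fun h3 => h2 (pos_of_mul_pos_right h3 hc.le)

end

/-! ### Optimal triples and the comparison of areas -/

/-- The Lebesgue decomposition `(f, μ, ν)` of an optimal path, with the comparison inequality that
optimality yields. -/
structure IsOptimalTriple (I : ℝ → ℝ≥0∞) (θdown θup : ℝ≥0∞) (z : ℝ) (f : ℝ → ℝ)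
    (μ ν : Measure ℝ) : Prop where
  triple : IsTriple f μ ν
  nonneg : ∀ t ∈ Icc (0 : ℝ) 1, 0 ≤ path f μ ν t
  area : ∫ s in (0 : ℝ)..1, path f μ ν s = z
  cost_pos : 0 < openCost I θdown θup f μ ν
  cost_lt_top : openCost I θdown θup f μ ν < ⊤
  no_atom_pos : μ {1} = 0
  no_atom_neg : ν {1} = 0
  minimal : ∀ (f' : ℝ → ℝ) (μ' ν' : Measure ℝ), IsTriple f' μ' ν' →
    (∀ t ∈ Ico (0 : ℝ) 1, 0 ≤ path f' μ' ν' t) → z ≤ ∫ s in (0 : ℝ)..1, path f' μ' ν' s →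
    openCost I θdown θup f μ ν ≤ ENNReal.ofReal (√(z / ∫ s in (0 : ℝ)..1, path f' μ' ν' s)) *
      openCost I θdown θup f' μ' ν'

section

variable {f : ℝ → ℝ} {μ ν : Measure ℝ} {I : ℝ → ℝ≥0∞} {δ : ℝ} {θdown θup : ℝ≥0∞} {z : ℝ}
  {ψ : ℝ → ℝ}

/-- A path without upward singular part whose density is non-positive wherever the
path is positive is non-positive. -/
lemma IsTriple.path_nonpos (h : IsTriple f μ ν)
    (hμ : μ (Ico 0 1) = 0) (hf : ∀ᵐ t, t ∈ Ico (0 : ℝ) 1 → 0 < path f μ ν t → f t ≤ 0)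
    {t : ℝ} (ht : t ∈ Ico (0 : ℝ) 1) : path f μ ν t ≤ 0 := by
  by_contra hc
  push Not at hc
  have hμ' : ∀ S ⊆ Ico (0 : ℝ) 1, μ.real S = 0 := fun S hS => by
    rw [measureReal_def, measure_mono_null hS hμ, ENNReal.toReal_zero]
  set S : Set ℝ := {r | r ∈ Icc 0 t ∧ path f μ ν r ≤ 0} with hS
  have h0S : (0 : ℝ) ∈ S := by
    refine ⟨⟨le_rfl, ht.1⟩, ?_⟩
    rw [h.path_eq_atom le_rfl, prePath_of_nonpos _ _ _ le_rfl,
      hμ' _ (singleton_subset_iff.2 ⟨le_rfl, zero_lt_one⟩)]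
    simp
  have hbdd : BddAbove S := ⟨t, fun r hr => hr.1.2⟩
  -- The path need not be continuous, so its value at s = sup S is not controlled. But r ∈ S implies
  -- path t ≤ G r, and G is continuous, so this bound survives at s. The path is positive on (s, t],
  -- which makes G s ≤ 0.
  set G : ℝ → ℝ := fun r => ∫ x in r..t, f x with hG
  have hGc : Continuous G := by
    have : G = fun r => -∫ x in t..r, f x := by
      funext r
      exact intervalIntegral.integral_symm t r
    rw [this]
    exact (intervalIntegral.continuous_primitive
      (fun a b => h.integrable.intervalIntegrable) t).neg
  have hle : ∀ r ∈ S, path f μ ν t ≤ G r := by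
    intro r hr
    have h1 := h.path_eq hr.1.1 hr.1.2
    rw [incr, hμ' (Ioc r t) (fun x hx => ⟨hr.1.1.trans hx.1.le, hx.2.trans_lt ht.2⟩)] at h1
    have h2 : 0 ≤ ν.real (Ioc r t) := measureReal_nonneg
    rw [hG]
    simp only
    rw [intervalIntegral.integral_of_le hr.1.2]
    linarith [hr.2]
  set s := sSup S with hs
  have hsG : path f μ ν t ≤ G s := by
    have hcl : IsClosed {r | path f μ ν t ≤ G r} := isClosed_le continuous_const hGc
    exact hcl.closure_subset_iff.2 hle (csSup_mem_closure ⟨0, h0S⟩ hbdd)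
  have hst : s ≤ t := csSup_le ⟨0, h0S⟩ fun r hr => hr.1.2
  have hs0 : 0 ≤ s := le_csSup hbdd h0S
  have : G s ≤ 0 := by
    rw [hG]
    simp only
    rw [intervalIntegral.integral_of_le hst]
    refine setIntegral_nonpos_of_ae_restrict ?_
    rw [EventuallyLE, ae_restrict_iff' measurableSet_Ioc]
    filter_upwards [hf] with x hx hxs
    refine hx ⟨hs0.trans hxs.1.le, hxs.2.trans_lt ht.2⟩ ?_
    by_contra hcx
    exact absurd (le_csSup hbdd ⟨⟨hs0.trans hxs.1.le, hxs.2⟩, not_lt.1 hcx⟩) (not_le.2 hxs.1)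
  linarith

lemma IsTriple.measurable_cost (hI : IsGoodConvexRate I) (h : IsTriple f μ ν) :
    AEMeasurable ({s | 0 < path f μ ν s}.indicator fun s => I (f s)) :=
  (hI.measurable.comp_aemeasurable h.integrable.aemeasurable).indicator
    (measurableSet_lt measurable_const h.path_measurable)

lemma IsTriple.integral_nonpos (hpath : ∀ t ∈ Ico (0 : ℝ) 1, path f μ ν t ≤ 0) :
    ∫ s in (0 : ℝ)..1, path f μ ν s ≤ 0 := by
  rw [intervalIntegral.integral_of_le zero_le_one, integral_Ioc_eq_integral_Ioo]
  exact setIntegral_nonpos measurableSet_Ioo fun x hx => hpath x ⟨hx.1.le, hx.2⟩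

/-- At zero cost there is no upward singular part before time 1, and the slopes on the positive set
are zeros of I, hence negative. Such a path never leaves zero. -/
lemma openCost_pos (hI : IsGoodConvexRate I) (hδ : 0 < δ) (hIδ : I (-δ) = 0) (h0 : I 0 ≠ 0)
    (hθup : 0 < θup) (h : IsTriple f μ ν)
    (ha : 0 < ∫ s in (0 : ℝ)..1, path f μ ν s) :
    0 < openCost I θdown θup f μ ν := by
  by_contra hc
  rw [not_lt, nonpos_iff_eq_zero, openCost, add_eq_zero, add_eq_zero] at hc
  obtain ⟨⟨h1, -⟩, h2⟩ := hc
  have hμ : μ (Ico 0 1) = 0 := (mul_eq_zero.1 h2).resolve_left hθup.ne'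
  rw [lintegral_eq_zero_iff' (h.measurable_cost hI).restrict, EventuallyEq,
    ae_restrict_iff' measurableSet_Icc] at h1
  refine absurd (IsTriple.integral_nonpos fun t ht => h.path_nonpos hμ ?_ ht) (not_le.2 ha)
  filter_upwards [h1] with x hx hx1 hx2
  have := hx (Ico_subset_Icc_self hx1)
  rw [indicator_of_mem (show x ∈ {s | 0 < path f μ ν s} from hx2)] at this
  exact (hI.neg_of_eq_zero hδ hIδ h0 this).le

/-- The comparison inequality ignores the jump at time 1. Applied to the optimal path itself, it
shows that this jump has zero cost; since both θ are positive, there is none, and J equals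
`openCost`. -/
lemma IsOptimalPath.exists_triple (hI : IsGoodConvexRate I) (hδ : 0 < δ) (hIδ : I (-δ) = 0)
    (h0 : I 0 ≠ 0) (hθdown : 0 < θdown) (hθup : 0 < θup) (hz : 0 < z)
    (hψ : IsOptimalPath I θdown θup z ψ) :
    ∃ f μ ν, IsOptimalTriple I θdown θup z f μ ν ∧ ∀ t ∈ Icc (0 : ℝ) 1, path f μ ν t = ψ t := by
  have hfin := hψ.finite
  simp only [J, iInf_lt_iff] at hfin
  obtain ⟨f₀, μ, ν, hdec, -⟩ := hfin
  set f := (Icc 0 1).indicator f₀ with hf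
  have ht : IsTriple f μ ν := hdec.isTriple
  have := ht.finite_pos
  have := ht.finite_neg
  have hp : ∀ t ∈ Icc (0 : ℝ) 1, path f μ ν t = ψ t := fun t ht => hdec.path_eq ht
  have hpos : ∀ t ∈ Icc (0 : ℝ) 1, 0 ≤ path f μ ν t := fun t ht => by
    rw [hp t ht]; exact hψ.feasible.1.nonneg t ht
  have harea : ∫ s in (0 : ℝ)..1, path f μ ν s = z := by
    rw [← hψ.feasible.2]
    refine intervalIntegral.integral_congr fun x hx => hp x ?_
    rwa [uIcc_of_le zero_le_one] at hx
  have hcost : J I θdown θup ψ = openCost I θdown θup f μ ν + (θdown * ν {1} + θup * μ {1}) := by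
    have e : ∀ ρ : Measure ℝ, ρ (Icc 0 1) = ρ (Ico 0 1) + ρ {1} := by
      intro ρ
      rw [← measure_union (by simp) (measurableSet_singleton _), Ico_union_right zero_le_one]
    rw [hdec.J_eq, cost_eq hδ hIδ, openCost, e, e, mul_add, mul_add]
    have : ∫⁻ s in Icc (0 : ℝ) 1, {s | 0 < ψ s}.indicator (fun s => I (f₀ s)) s =
        ∫⁻ s in Icc (0 : ℝ) 1, {s | 0 < path f μ ν s}.indicator (fun s => I (f s)) s := by
      refine setLIntegral_congr_fun measurableSet_Icc fun x hx => ?_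
      have hfx : f x = f₀ x := indicator_of_mem hx _
      simp only [indicator, mem_ofPred_eq, hp x hx, hfx]
    rw [this]
    ring
  have hle := hψ.le_openCost hδ hIδ hz ht (fun t ht => hpos t (Ico_subset_Icc_self ht)) harea.ge
  -- The area is exactly z, so the scaling factor is 1.
  rw [harea, div_self hz.ne', Real.sqrt_one, ENNReal.ofReal_one, one_mul] at hle
  have hfin : openCost I θdown θup f μ ν < ⊤ := by
    refine lt_of_le_of_lt ?_ hψ.finite
    rw [hcost]
    exact le_self_add
  have hz0 : θdown * ν {1} + θup * μ {1} = 0 := by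
    rw [hcost] at hle
    have : openCost I θdown θup f μ ν + (θdown * ν {1} + θup * μ {1}) ≤
      openCost I θdown θup f μ ν + 0 := by simpa using hle
    simpa using (ENNReal.add_le_add_iff_left hfin.ne).1 this
  rw [add_eq_zero, mul_eq_zero, mul_eq_zero] at hz0
  have hJ : J I θdown θup ψ = openCost I θdown θup f μ ν := by
    rw [hcost, hz0.1.resolve_left hθdown.ne', hz0.2.resolve_left hθup.ne']
    simp
  refine ⟨f, μ, ν, ⟨ht, hpos, harea, ?_, hfin, hz0.2.resolve_left hθup.ne',
    hz0.1.resolve_left hθdown.ne', ?_⟩, hp⟩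
  · exact openCost_pos hI hδ hIδ h0 hθup ht
      (by rw [harea]; exact hz)
  · intro f' μ' ν' h' hpos' ha'
    rw [← hJ]
    exact hψ.le_openCost hδ hIδ hz h' hpos' ha'

/-- No path of the same or smaller cost encloses a larger area. -/
lemma IsOptimalTriple.area_le (h : IsOptimalTriple I θdown θup z f μ ν) (hz : 0 < z)
    {f' : ℝ → ℝ} {μ' ν' : Measure ℝ} (h' : IsTriple f' μ' ν')
    (hpos : ∀ t ∈ Ico (0 : ℝ) 1, 0 ≤ path f' μ' ν' t)
    (hcost : openCost I θdown θup f' μ' ν' ≤ openCost I θdown θup f μ ν) :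
    ∫ s in (0 : ℝ)..1, path f' μ' ν' s ≤ ∫ s in (0 : ℝ)..1, path f μ ν s := by
  rw [h.area]
  by_contra hc
  push Not at hc
  have h1 := h.minimal f' μ' ν' h' hpos hc.le
  set a := ∫ s in (0 : ℝ)..1, path f' μ' ν' s
  have hlt : √(z / a) < 1 := by
    rw [Real.sqrt_lt' one_pos, one_pow]
    exact (div_lt_one (hz.trans hc)).2 hc
  have h2 : openCost I θdown θup f μ ν ≤
      ENNReal.ofReal √(z / a) * openCost I θdown θup f μ ν :=
    h1.trans (mul_le_mul_right hcost _)
  have h3 : ENNReal.ofReal √(z / a) * openCost I θdown θup f μ ν <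
      1 * openCost I θdown θup f μ ν :=
    (ENNReal.mul_lt_mul_iff_left h.cost_pos.ne' h.cost_lt_top.ne).2
      (by rw [ENNReal.ofReal_lt_one]; exact hlt)
  rw [one_mul] at h3
  exact absurd h3 (not_lt.2 h2)

lemma IsOptimalTriple.prePath_one (h : IsOptimalTriple I θdown θup z f μ ν) :
    prePath f μ ν 1 = path f μ ν 1 := by
  rw [h.triple.path_eq_atom zero_le_one, measureReal_def, measureReal_def, h.no_atom_pos,
    h.no_atom_neg]
  simp

lemma IsOptimalTriple.prePath_nonneg (h : IsOptimalTriple I θdown θup z f μ ν) {t : ℝ}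
    (ht : t ≤ 1) : 0 ≤ prePath f μ ν t :=
  h.triple.prePath_nonneg (fun t ht => h.nonneg t (Ico_subset_Icc_self ht)) ht

end

/-! ### Exchanging increments over adjacent blocks -/

/-- The interval exchange of `[a, b)` and `[b, c)`. -/
noncomputable def blockSwap {a b c : ℝ} (hab : a ≤ b) (hbc : b ≤ c) : ℝ ≃ᵐ ℝ where
  toFun t := if t < a then t else if t < b then t + (c - b) else if t < c then t - (b - a) else t
  invFun t := if t < a then t else if t < a + (c - b) then t + (b - a) else
    if t < c then t - (c - b) else t
  left_inv t := by
    simp only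
    split_ifs <;> linarith
  right_inv t := by
    simp only
    split_ifs <;> linarith
  measurable_toFun :=
    Measurable.ite measurableSet_Iio measurable_id <| Measurable.ite measurableSet_Iio
      (by fun_prop) <| Measurable.ite measurableSet_Iio (by fun_prop) measurable_id
  measurable_invFun :=
    Measurable.ite measurableSet_Iio measurable_id <| Measurable.ite measurableSet_Iio
      (by fun_prop) <| Measurable.ite measurableSet_Iio (by fun_prop) measurable_id

section Swap

variable {a b c : ℝ} (hab : a ≤ b) (hbc : b ≤ c)

lemma blockSwap_apply (t : ℝ) : blockSwap hab hbc t =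
    if t < a then t else if t < b then t + (c - b) else if t < c then t - (b - a) else t := rfl

/-- The exchange is a translation on each block and the identity elsewhere. The factor 1 puts it in
the form that the time-change lemmas require. -/
lemma volume_blockSwap :
    volume = ENNReal.ofReal 1 • (volume : Measure ℝ).map (blockSwap hab hbc) := by
  rw [ENNReal.ofReal_one, one_smul]
  set e := blockSwap hab hbc with he
  ext S hS
  rw [e.map_apply]
  have d : ∀ (A : Set ℝ) (x y z : ℝ), MeasurableSet A → x ≤ y → y ≤ z → volume A =
      volume (A ∩ Ico x y) + volume (A ∩ Ico y z) + volume (A \ Ico x z) := by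
    intro A x y z hA hxy hyz
    rw [← measure_inter_add_sdiff A (measurableSet_Ico (a := x) (b := z)),
      ← Ico_union_Ico_eq_Ico hxy hyz, inter_union_distrib_left]
    congr 1
    refine measure_union ?_ (hA.inter measurableSet_Ico)
    exact Set.disjoint_left.2 fun u hu hu' => absurd hu'.2.1 (not_le.2 hu.2.2)
  rw [d S a (a + (c - b)) c hS (by linarith) (by linarith),
    d (e ⁻¹' S) a b c (e.measurable hS) hab hbc]
  have e1 : e ⁻¹' S ∩ Ico a b = (fun x => x + (c - b)) ⁻¹' (S ∩ Ico (a + (c - b)) c) := by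
    ext x
    simp only [mem_inter_iff, mem_preimage, mem_Ico, he, blockSwap_apply]
    constructor
    · rintro ⟨h1, h2, h3⟩
      rw [if_neg (not_lt.2 h2), if_pos h3] at h1
      exact ⟨h1, by linarith, by linarith⟩
    · rintro ⟨h1, h2, h3⟩
      rw [if_neg (by linarith), if_pos (by linarith)]
      exact ⟨h1, by linarith, by linarith⟩
  have e2 : e ⁻¹' S ∩ Ico b c = (fun x => x + -(b - a)) ⁻¹' (S ∩ Ico a (a + (c - b))) := by
    ext x
    simp only [mem_inter_iff, mem_preimage, mem_Ico, he, blockSwap_apply]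
    constructor
    · rintro ⟨h1, h2, h3⟩
      rw [if_neg (by linarith), if_neg (by linarith), if_pos h3] at h1
      exact ⟨h1, by linarith, by linarith⟩
    · rintro ⟨h1, h2, h3⟩
      rw [if_neg (by linarith), if_neg (by linarith), if_pos (by linarith)]
      exact ⟨h1, by linarith, by linarith⟩
  have e3 : e ⁻¹' S \ Ico a c = S \ Ico a c := by
    ext x
    simp only [Set.mem_sdiff, mem_preimage, mem_Ico, he, blockSwap_apply]
    refine and_congr_left fun h => ?_
    rcases lt_or_ge x a with h1 | h1
    · rw [if_pos h1]
    · have : c ≤ x := not_lt.1 fun h2 => h ⟨h1, h2⟩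
      rw [if_neg (by linarith), if_neg (by linarith), if_neg (by linarith)]
  rw [e1, e2, e3, measure_preimage_add_right, measure_preimage_add_right]
  congr 1
  exact add_comm _ _

variable {f : ℝ → ℝ} {μ ν : Measure ℝ} {I : ℝ → ℝ≥0∞} {δ : ℝ} {θdown θup : ℝ≥0∞} {z : ℝ}

/-- The path with the increments over `[a, b)` and `[b, c)` exchanged. -/
lemma IsTriple.path_blockSwap (h : IsTriple f μ ν) (ha : 0 ≤ a) (u : ℝ) :
    path (f ∘ (blockSwap hab hbc).symm) (ENNReal.ofReal 1 • μ.map (blockSwap hab hbc))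
      (ENNReal.ofReal 1 • ν.map (blockSwap hab hbc)) (blockSwap hab hbc u) =
    path f μ ν u + ((Ico a b).indicator (fun _ => prePath f μ ν c - prePath f μ ν b) u +
      (Ico b c).indicator (fun _ => prePath f μ ν a - prePath f μ ν b) u) := by
  rw [path, incr_timeChange f μ ν zero_le_one (volume_blockSwap hab hbc), one_mul]
  -- The blocks are half-open, so an atom at b travels with the second block and the block
  -- increments are differences of left limits.
  have hca : prePath f μ ν c = prePath f μ ν b + incr f μ ν (Ico b c) :=
    h.prePath_eq (ha.trans hab) hbc
  have hba : prePath f μ ν b = prePath f μ ν a + incr f μ ν (Ico a b) := h.prePath_eq ha hab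
  rcases lt_or_ge u a with h1 | h1
  · rw [indicator_of_notMem (fun hx => absurd hx.1 (not_le.2 h1)),
      indicator_of_notMem (fun hx => absurd hx.1 (not_le.2 (h1.trans_le hab))), path]
    simp only [add_zero]
    congr 1
    ext x
    simp only [mem_preimage, mem_Icc, blockSwap_apply, if_pos h1]
    constructor
    · rintro ⟨h2, h3⟩
      split_ifs at h2 h3 <;> constructor <;> linarith
    · rintro ⟨h2, h3⟩
      rw [if_pos (by linarith)]
      exact ⟨h2, h3⟩
  rcases lt_or_ge u b with h2 | h2
  · rw [indicator_of_mem (show u ∈ Ico a b from ⟨h1, h2⟩),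
      indicator_of_notMem (fun hx => absurd hx.1 (not_le.2 h2)), hca, path]
    rw [add_zero, add_sub_cancel_left, ← h.incr_union _ measurableSet_Ico]
    · congr 1
      ext x
      simp only [mem_preimage, mem_Icc, mem_Ico, mem_union, blockSwap_apply, if_neg (not_lt.2 h1),
        if_pos h2]
      constructor
      · rintro ⟨h3, h4⟩
        by_contra hc
        split_ifs at h3 h4 <;> grind
      · rintro (⟨h3, h4⟩ | ⟨h3, h4⟩)
        · split_ifs <;> constructor <;> linarith
        · split_ifs <;> constructor <;> linarith
    · exact Set.disjoint_left.2 fun x hx hx' => absurd hx'.1 (not_le.2 (hx.2.trans_lt h2))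
  rcases lt_or_ge u c with h3 | h3
  · rw [indicator_of_notMem (fun hx => absurd hx.2 (not_lt.2 h2)),
      indicator_of_mem (show u ∈ Ico b c from ⟨h2, h3⟩), hba, path, zero_add]
    have e1 : Icc 0 u = (blockSwap hab hbc ⁻¹' Icc 0 (blockSwap hab hbc u)) ∪ Ico a b := by
      ext x
      simp only [mem_preimage, mem_Icc, mem_Ico, mem_union, blockSwap_apply, if_neg (not_lt.2 h1),
        if_neg (not_lt.2 h2), if_pos h3]
      constructor
      · rintro ⟨h4, h5⟩
        by_cases h6 : a ≤ x ∧ x < b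
        · exact Or.inr h6
        · left
          split_ifs <;> grind
      · rintro (⟨h4, h5⟩ | ⟨h4, h5⟩)
        · split_ifs at h4 h5 <;> constructor <;> linarith
        · constructor <;> linarith
    rw [e1, h.incr_union _ measurableSet_Ico]
    · ring
    · refine Set.disjoint_left.2 fun x hx hx' => ?_
      have h4 := hx.2
      simp only [blockSwap_apply, if_neg (not_lt.2 h1), if_neg (not_lt.2 h2), if_pos h3,
        if_neg (not_lt.2 hx'.1), if_pos hx'.2] at h4
      linarith [hx'.1]
  · rw [indicator_of_notMem (fun hx => absurd hx.2 (not_lt.2 h2)),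
      indicator_of_notMem (fun hx => absurd hx.2 (not_lt.2 h3)), path]
    simp only [add_zero]
    congr 1
    ext x
    simp only [mem_preimage, mem_Icc, blockSwap_apply, if_neg (not_lt.2 h1),
      if_neg (not_lt.2 h2), if_neg (not_lt.2 h3)]
    constructor
    · rintro ⟨h4, h5⟩
      split_ifs at h4 h5 <;> constructor <;> linarith
    · rintro ⟨h4, h5⟩
      split_ifs <;> constructor <;> linarith

lemma blockSwap_mem_iff (ha : 0 ≤ a) (hc : c ≤ 1) (u : ℝ) :
    (blockSwap hab hbc u ∈ Icc (0 : ℝ) 1 ↔ u ∈ Icc (0 : ℝ) 1) ∧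
    (blockSwap hab hbc u ∈ Ico (0 : ℝ) 1 ↔ u ∈ Ico (0 : ℝ) 1) := by
  simp only [blockSwap_apply, mem_Icc, mem_Ico]
  constructor <;> split_ifs <;> grind

/-- Exchanging the increments over two adjacent blocks cannot increase the area. -/
lemma IsOptimalTriple.blockSwap_le {a b c : ℝ} (hab : a ≤ b) (hbc : b ≤ c)
    (h : IsOptimalTriple I θdown θup z f μ ν) (hz : 0 < z)
    (ha : 0 ≤ a) (hc : c ≤ 1)
    (hpos₁ : ∀ u ∈ Ico a b, 0 ≤ path f μ ν u + (prePath f μ ν c - prePath f μ ν b))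
    (hpos₂ : ∀ u ∈ Ico b c, 0 ≤ path f μ ν u + (prePath f μ ν a - prePath f μ ν b))
    (hcost₁ : ∀ᵐ u, u ∈ Ico a b → 0 < path f μ ν u + (prePath f μ ν c - prePath f μ ν b) →
      0 < path f μ ν u)
    (hcost₂ : ∀ᵐ u, u ∈ Ico b c → 0 < path f μ ν u + (prePath f μ ν a - prePath f μ ν b) →
      0 < path f μ ν u) :
    (prePath f μ ν c - prePath f μ ν b) * (b - a) +
      (prePath f μ ν a - prePath f μ ν b) * (c - b) ≤ 0 := by
  set e := blockSwap hab hbc with he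
  have hvol := volume_blockSwap hab hbc
  rw [← he] at hvol
  set k : ℝ → ℝ := fun u => (Ico a b).indicator (fun _ => prePath f μ ν c - prePath f μ ν b) u +
      (Ico b c).indicator (fun _ => prePath f μ ν a - prePath f μ ν b) u with hk
  set F' := f ∘ e.symm with hF'
  set M' := ENNReal.ofReal 1 • μ.map e with hM'
  set N' := ENNReal.ofReal 1 • ν.map e with hN'
  have hT : IsTriple F' M' N' := h.triple.timeChange hvol
  have hpath : ∀ u, path F' M' N' (e u) = path f μ ν u + k u :=
    fun u => h.triple.path_blockSwap hab hbc ha u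
  have hmem := blockSwap_mem_iff hab hbc ha hc
  rw [← he] at hmem
  have hk1 : ∀ u ∈ Ico a b, k u = prePath f μ ν c - prePath f μ ν b := fun u hu => by
    simp only [hk]
    rw [indicator_of_mem hu, indicator_of_notMem (fun hx => absurd hx.1 (not_le.2 hu.2)), add_zero]
  have hk2 : ∀ u ∈ Ico b c, k u = prePath f μ ν a - prePath f μ ν b := fun u hu => by
    simp only [hk]
    rw [indicator_of_mem hu, indicator_of_notMem (fun hx => absurd hx.2 (not_lt.2 hu.1)), zero_add]
  have hk3 : ∀ u, u ∉ Ico a b → u ∉ Ico b c → k u = 0 := fun u hu hu' => by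
    simp only [hk]
    rw [indicator_of_notMem hu, indicator_of_notMem hu', zero_add]
  have hpos : ∀ s ∈ Ico (0 : ℝ) 1, 0 ≤ path F' M' N' s := by
    intro s hs
    obtain ⟨u, rfl⟩ := e.surjective s
    rw [hpath]
    by_cases h1 : u ∈ Ico a b
    · rw [hk1 u h1]; exact hpos₁ u h1
    by_cases h2 : u ∈ Ico b c
    · rw [hk2 u h2]; exact hpos₂ u h2
    rw [hk3 u h1 h2, add_zero]
    exact h.nonneg u (Ico_subset_Icc_self ((hmem u).2.1 hs))
  -- At e u the new density is f u, and the new path is positive there only if the old one is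
  -- positive at u, up to a null set. The integrands compare pointwise, and the singular masses on
  -- [0, 1) are equal.
  have hcost : openCost I θdown θup F' M' N' ≤ openCost I θdown θup f μ ν := by
    have hmass : ∀ ρ : Measure ℝ, (ENNReal.ofReal 1 • ρ.map e) (Ico 0 1) = ρ (Ico 0 1) := by
      intro ρ
      rw [Measure.smul_apply, e.map_apply, smul_eq_mul, ENNReal.ofReal_one, one_mul]
      congr 1
      ext u
      exact (hmem u).2
    rw [openCost, openCost, hM', hN', hmass, hmass, ← hM', ← hN']
    gcongr ?_ + _ + _
    rw [← lintegral_indicator measurableSet_Icc, ← lintegral_indicator measurableSet_Icc,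
      lintegral_timeChange hvol, ENNReal.ofReal_one, one_mul]
    refine lintegral_mono_ae ?_
    filter_upwards [hcost₁, hcost₂] with u hu1 hu2
    by_cases hu : u ∈ Icc (0 : ℝ) 1
    swap
    · rw [indicator_of_notMem fun hx => hu ((hmem u).1.1 hx)]
      exact zero_le
    rw [indicator_of_mem hu, indicator_of_mem ((hmem u).1.2 hu)]
    by_cases hp : 0 < path F' M' N' (e u)
    swap
    · rw [indicator_of_notMem (s := {s | 0 < path F' M' N' s}) hp]
      exact zero_le
    have hp' : 0 < path f μ ν u := by
      rw [hpath] at hp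
      by_cases h1 : u ∈ Ico a b
      · rw [hk1 u h1] at hp; exact hu1 h1 hp
      by_cases h2 : u ∈ Ico b c
      · rw [hk2 u h2] at hp; exact hu2 h2 hp
      rwa [hk3 u h1 h2, add_zero] at hp
    rw [indicator_of_mem (s := {s | 0 < path F' M' N' s}) hp,
      indicator_of_mem (s := {s | 0 < path f μ ν s}) hp']
    simp [hF']
  have harea := h.area_le hz hT hpos hcost
  have hint : ∀ {x y : ℝ} {r : ℝ}, Integrable ((Ico x y).indicator fun _ => r) := by
    intro x y r
    rw [integrable_indicator_iff measurableSet_Ico]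
    exact integrableOn_const (by simp)
  have hki : Integrable k := hint.add hint
  have e1 : ∫ s in (0 : ℝ)..1, path F' M' N' s = (∫ s in (0 : ℝ)..1, path f μ ν s) + ∫ u, k u := by
    rw [intervalIntegral.integral_of_le zero_le_one, intervalIntegral.integral_of_le zero_le_one,
      ← integral_Icc_eq_integral_Ioc, ← integral_Icc_eq_integral_Ioc,
      ← integral_indicator measurableSet_Icc, ← integral_indicator measurableSet_Icc,
      integral_timeChange zero_le_one hvol, one_mul, ← integral_add _ hki]
    · congr 1
      funext u
      by_cases hu : u ∈ Icc (0 : ℝ) 1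
      · rw [indicator_of_mem hu, indicator_of_mem ((hmem u).1.2 hu), hpath]
      · rw [indicator_of_notMem hu, indicator_of_notMem fun hx => hu ((hmem u).1.1 hx),
          hk3 u (fun hx => hu ⟨ha.trans hx.1, hx.2.le.trans (hbc.trans hc)⟩)
            (fun hx => hu ⟨ha.trans (hab.trans hx.1), hx.2.le.trans hc⟩), add_zero]
    · rw [integrable_indicator_iff measurableSet_Icc]
      exact h.triple.path_integrableOn (by simp)
  -- The gain in area: each block is shifted vertically by the increment of the other one, the
  -- second block downwards.
  have e2 : ∫ u, k u = (prePath f μ ν c - prePath f μ ν b) * (b - a) +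
      (prePath f μ ν a - prePath f μ ν b) * (c - b) := by
    rw [hk, integral_add hint hint, integral_indicator measurableSet_Ico,
      integral_indicator measurableSet_Ico, setIntegral_const, setIntegral_const,
      Real.volume_real_Ico_of_le hab, Real.volume_real_Ico_of_le hbc, smul_eq_mul, smul_eq_mul]
    ring
  linarith

end Swap

/-! ### Patching with a free descent; positivity between positive times -/

lemma mutuallySingular_dirac_of_singleton {ρ : Measure ℝ} {x : ℝ} (hx : ρ {x} = 0) (r : ℝ≥0∞) :
    (r • Measure.dirac x) ⟂ₘ ρ :=
  ⟨{x}ᶜ, (measurableSet_singleton x).compl, by simp, by simpa using hx⟩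

section

variable {f : ℝ → ℝ} {μ ν : Measure ℝ} {I : ℝ → ℝ≥0∞} {δ : ℝ} {θdown θup : ℝ≥0∞} {z : ℝ}

/-- On `[c, c')` an optimal path cannot be replaced by a larger path which has slope `-δ` until it
reaches zero, provided that the jump that is necessary at `c'` is not larger than a jump at `c`. -/
lemma IsOptimalTriple.patch_false (h : IsOptimalTriple I θdown θup z f μ ν) (hz : 0 < z)
    (hδ : 0 < δ) (hIδ : I (-δ) = 0) {c c' : ℝ} (hc : 0 ≤ c) (hcc' : c < c') (hc'1 : c' ≤ 1)
    (hjump : c' < 1 → path f μ ν c' ≤ max (prePath f μ ν c - δ * (c' - c)) 0 ∧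
      max (prePath f μ ν c - δ * (c' - c)) 0 - path f μ ν c' ≤ ν.real {c})
    (hle : ∀ s ∈ Ioo c c', path f μ ν s ≤ max (prePath f μ ν c - δ * (s - c)) 0)
    {x y : ℝ} (hcx : c ≤ x) (hxy : x < y) (hyc' : y ≤ c')
    (hlt : ∀ s ∈ Ioo x y, path f μ ν s < max (prePath f μ ν c - δ * (s - c)) 0) : False := by
  have hT := h.triple
  have := hT.finite_pos
  have := hT.finite_neg
  set L := prePath f μ ν c with hL
  have hL0 : 0 ≤ L := h.prePath_nonneg (hcc'.le.trans hc'1)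
  -- The patch starts at the left limit, so it discards any jump at c. It runs at no cost: slope -δ
  -- until it hits zero, at the time d unless c' comes earlier, and zero afterwards.
  set l : ℝ → ℝ := fun s => max (L - δ * (s - c)) 0 with hl
  set d := min c' (c + L / δ) with hd
  have hcd : c ≤ d := le_min hcc'.le (by have := div_nonneg hL0 hδ.le; linarith)
  have hdc' : d ≤ c' := min_le_left _ _
  -- The downward jump at c' that rejoins the old path. If c' = 1, it costs nothing in `openCost`,
  -- so no condition is needed then.
  set κ := l c' - path f μ ν c' with hκ
  set f' : ℝ → ℝ := fun s => (Icc c c')ᶜ.indicator f s +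
    (Ico c d).indicator (fun _ => -δ) s with hf'
  set μ' := μ.restrict (Icc c c')ᶜ with hμ'
  set ν' := ν.restrict (Icc c c')ᶜ + ENNReal.ofReal κ • Measure.dirac c' with hν'
  have hmc : MeasurableSet (Icc c c')ᶜ := measurableSet_Icc.compl
  have hi1 : Integrable ((Icc c c')ᶜ.indicator f) := hT.integrable.indicator hmc
  have hi2 : Integrable ((Ico c d).indicator fun _ => -δ) := by
    rw [integrable_indicator_iff measurableSet_Ico]
    exact integrableOn_const (by simp)
  have hT' : IsTriple f' μ' ν' := by
    have : IsFiniteMeasure (ENNReal.ofReal κ • Measure.dirac c') :=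
      Measure.smul_finite _ ENNReal.ofReal_ne_top
    refine ⟨hi1.add hi2, inferInstance, inferInstance, hT.singular_pos.restrict _,
      (hT.singular_neg.restrict _).add_left (mutuallySingular_dirac_of_singleton (by simp) _), ?_⟩
    refine (((hT.hahn.restrict _).symm.restrict _).add_left
      (mutuallySingular_dirac_of_singleton ?_ _)).symm
    rw [Measure.restrict_apply (measurableSet_singleton _)]
    convert measure_empty (μ := μ)
    ext u
    simp only [mem_inter_iff, mem_singleton_iff, mem_compl_iff, mem_Icc, mem_empty_iff_false,
      iff_false]
    rintro ⟨rfl, h2⟩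
    exact h2 ⟨hcc'.le, le_rfl⟩
  have hincr : ∀ S, MeasurableSet S → incr f' μ' ν' S = incr f μ ν (S ∩ (Icc c c')ᶜ)
      - δ * volume.real (S ∩ Ico c d) - max κ 0 * S.indicator 1 c' := by
    intro S hS
    have e1 : ∫ s in S, f' s = (∫ s in S ∩ (Icc c c')ᶜ, f s) - δ * volume.real (S ∩ Ico c d) := by
      rw [hf', integral_add hi1.integrableOn hi2.integrableOn, setIntegral_indicator hmc,
        setIntegral_indicator measurableSet_Ico, setIntegral_const, smul_eq_mul]
      ring
    have e2 : ν'.real S = ν.real (S ∩ (Icc c c')ᶜ) + max κ 0 * S.indicator 1 c' := by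
      have hfin : (ENNReal.ofReal κ • Measure.dirac c') S ≠ ⊤ := by
        rw [Measure.smul_apply, Measure.dirac_apply' _ hS, smul_eq_mul]
        refine ENNReal.mul_ne_top ENNReal.ofReal_ne_top ?_
        by_cases hu : c' ∈ S <;> simp [hu]
      rw [hν', measureReal_add_apply (measure_ne_top _ _) hfin, measureReal_restrict_apply hS]
      · congr 1
        rw [measureReal_ennreal_smul_apply, ENNReal.toReal_ofReal', measureReal_def,
          Measure.dirac_apply' _ hS]
        by_cases hu : c' ∈ S <;> simp [hu]
    rw [incr, incr, e1, e2, hμ', measureReal_restrict_apply hS]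
    ring
  have hlt_path : ∀ t < c, path f' μ' ν' t = path f μ ν t := by
    intro t ht
    rw [path, hincr _ measurableSet_Icc, indicator_of_notMem (fun hx => by linarith [hx.2]), path]
    have e1 : Icc 0 t ∩ (Icc c c')ᶜ = Icc 0 t :=
      inter_eq_left.2 fun u hu hu' => by linarith [hu.2, hu'.1]
    have e2 : Icc 0 t ∩ Ico c d = ∅ := by
      ext u; simp only [mem_inter_iff, mem_Icc, mem_Ico, mem_empty_iff_false]; grind
    rw [e1, e2]
    simp
  have hIco : ∀ t, c ≤ t → t ≤ c' → Icc 0 t ∩ (Icc c c')ᶜ = Ico 0 c := by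
    intro t h1 h2
    ext u; simp only [mem_inter_iff, mem_Icc, mem_Ico, mem_compl_iff]; grind
  have hmid_path : ∀ t, c ≤ t → t < c' → path f' μ' ν' t = l t := by
    intro t h1 h2
    rw [path, hincr _ measurableSet_Icc, indicator_of_notMem (fun hx => by linarith [hx.2]),
      hIco t h1 h2.le, mul_zero, sub_zero]
    have e2 : (Icc 0 t ∩ Ico c d : Set ℝ) =ᵐ[volume] (Ico c (min t d) : Set ℝ) := by
      have : ∀ᵐ u : ℝ, u ≠ t := by simp [ae_iff]
      filter_upwards [this] with u hu
      refine propext ?_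
      change (u ∈ Icc 0 t ∩ Ico c d) ↔ u ∈ Ico c (min t d)
      simp only [mem_inter_iff, mem_Icc, mem_Ico, lt_min_iff]
      grind
    rw [measureReal_congr e2, Real.volume_real_Ico_of_le (le_min h1 hcd), hl]
    simp only
    change L - _ = _
    rcases le_total t (c + L / δ) with h3 | h3
    · have h4 : δ * (t - c) ≤ L := by
        have : t - c ≤ L / δ := by linarith
        rw [le_div_iff₀ hδ] at this
        linarith
      rw [min_eq_left (le_min h2.le h3), max_eq_left (by linarith)]
    · have h4 : L ≤ δ * (t - c) := by
        have : L / δ ≤ t - c := by linarith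
        rw [div_le_iff₀ hδ] at this
        linarith
      have h5 : min t d = c + L / δ := by
        rw [hd, min_eq_right (h3.trans h2.le), min_eq_right h3]
      rw [h5, max_eq_right (by linarith)]
      field_simp
      ring
  have hgt_path : ∀ t, c' ≤ t → c' < 1 → path f' μ' ν' t = path f μ ν t := by
    intro t h1 h2
    have hd' : δ * (d - c) = L - l c' := by
      simp only [hl, hd]
      rcases le_total c' (c + L / δ) with h3 | h3
      · have h4 : δ * (c' - c) ≤ L := by
          have : c' - c ≤ L / δ := by linarith
          rw [le_div_iff₀ hδ] at this
          linarith
        rw [min_eq_left h3, max_eq_left (by linarith)]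
        ring
      · have h4 : L ≤ δ * (c' - c) := by
          have : L / δ ≤ c' - c := by linarith
          rw [div_le_iff₀ hδ] at this
          linarith
        rw [min_eq_right h3, max_eq_right (by linarith)]
        field_simp
        ring
    have hc'0 : 0 ≤ c' := hc.trans hcc'.le
    have hκ0 : 0 ≤ κ := sub_nonneg.2 (hjump h2).1
    have e0 : path f' μ' ν' c' = path f μ ν c' := by
      rw [path, hincr _ measurableSet_Icc,
        indicator_of_mem (show c' ∈ Icc 0 c' from ⟨hc'0, le_rfl⟩),
        hIco c' hcc'.le le_rfl, max_eq_left hκ0]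
      have e2 : Icc 0 c' ∩ Ico c d = Ico c d :=
        inter_eq_right.2 fun u hu => ⟨hc.trans hu.1, hu.2.le.trans hdc'⟩
      rw [e2, Real.volume_real_Ico_of_le hcd, hd']
      change L - _ - _ = _
      simp [hκ]
    rw [hT'.path_eq hc'0 h1, hT.path_eq hc'0 h1, e0, hincr _ measurableSet_Ioc,
      indicator_of_notMem (fun hx => lt_irrefl _ hx.1)]
    have e1 : Ioc c' t ∩ (Icc c c')ᶜ = Ioc c' t :=
      inter_eq_left.2 fun u hu hu' => by linarith [hu.1, hu'.2]
    have e2 : Ioc c' t ∩ Ico c d = ∅ := by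
      ext u; simp only [mem_inter_iff, mem_Ioc, mem_Ico, mem_empty_iff_false]; grind
    rw [e1, e2]
    simp
  have hall : ∀ t ∈ Ico (0 : ℝ) 1,
      path f' μ' ν' t = if t ∈ Ico c c' then l t else path f μ ν t := by
    intro t ht
    rcases lt_or_ge t c with h1 | h1
    · rw [if_neg (fun hx => by linarith [hx.1]), hlt_path t h1]
    rcases lt_or_ge t c' with h2 | h2
    · rw [if_pos ⟨h1, h2⟩, hmid_path t h1 h2]
    · rw [if_neg (fun hx => by linarith [hx.2]), hgt_path t h2 (h2.trans_lt ht.2)]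
  have hpos : ∀ t ∈ Ico (0 : ℝ) 1, 0 ≤ path f' μ' ν' t := by
    intro t ht
    rw [hall t ht]
    split_ifs
    · exact le_max_right _ _
    · exact h.nonneg t (Ico_subset_Icc_self ht)
  have hcost : openCost I θdown θup f' μ' ν' ≤ openCost I θdown θup f μ ν := by
    unfold openCost
    refine add_le_add (add_le_add ?_ (mul_le_mul_right ?_ _)) (mul_le_mul_right ?_ _)
    · refine lintegral_mono_ae ?_
      rw [ae_restrict_iff' measurableSet_Icc]
      have h1 : ∀ᵐ u : ℝ, u ≠ 1 := by simp [ae_iff]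
      have h2 : ∀ᵐ u : ℝ, u ≠ c' := by simp [ae_iff]
      filter_upwards [h1, h2] with s hs1 hsc' hs
      have hs' : s ∈ Ico (0 : ℝ) 1 := ⟨hs.1, lt_of_le_of_ne hs.2 hs1⟩
      simp only [indicator, mem_ofPred_eq, hall s hs']
      by_cases hsc : s ∈ Ico c c'
      · rw [if_pos hsc]
        by_cases hpl : 0 < l s
        · rw [if_pos hpl]
          have hsd : s ∈ Ico c d := by
            refine ⟨hsc.1, lt_min hsc.2 ?_⟩
            simp only [hl, lt_max_iff, lt_irrefl, or_false, sub_pos] at hpl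
            have : s - c < L / δ := by
              rw [lt_div_iff₀ hδ]; linarith
            linarith
          have : f' s = -δ := by
            simp only [hf']
            rw [indicator_of_mem hsd, indicator_of_notMem, zero_add]
            exact fun hx => hx ⟨hsc.1, hsc.2.le⟩
          rw [this, hIδ]
          exact zero_le
        · rw [if_neg hpl]
          exact zero_le
      · rw [if_neg hsc]
        have hsc2 : s ∉ Icc c c' := fun hx => hsc ⟨hx.1, lt_of_le_of_ne hx.2 hsc'⟩
        have : f' s = f s := by
          simp only [hf']
          rw [indicator_of_mem (show s ∈ (Icc c c')ᶜ from hsc2), indicator_of_notMem, add_zero]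
          exact fun hx => hsc2 ⟨hx.1, hx.2.le.trans hdc'⟩
        rw [this]
    · rw [hν', Measure.add_apply, Measure.restrict_apply measurableSet_Ico, Measure.smul_apply,
        Measure.dirac_apply' _ measurableSet_Ico]
      -- The new jump at c' is paid for by the downward jump at c, which the patch has removed.
      by_cases h1 : c' < 1
      · have hsub : Ico (0 : ℝ) 1 ∩ (Icc c c')ᶜ ∪ {c} ⊆ Ico 0 1 := by
          rintro u (hu | rfl)
          · exact hu.1
          · exact ⟨hc, hcc'.trans h1⟩
        refine le_trans ?_ (measure_mono hsub)
        rw [measure_union _ (measurableSet_singleton _)]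
        · refine add_le_add le_rfl ?_
          rw [indicator_of_mem (show c' ∈ Ico (0 : ℝ) 1 from ⟨hc.trans hcc'.le, h1⟩)]
          simp only [Pi.one_apply, smul_eq_mul, mul_one]
          exact ENNReal.ofReal_le_of_le_toReal (hjump h1).2
        · rw [disjoint_singleton_right]
          exact fun hx => hx.2 ⟨le_rfl, hcc'.le⟩
      · rw [indicator_of_notMem (fun hx => h1 hx.2), smul_zero, add_zero]
        exact measure_mono inter_subset_left
    · exact Measure.restrict_apply_le _ _
  have harea := h.area_le hz hT' hpos hcost
  have hlc : Continuous l := by fun_prop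
  have hg : IntegrableOn (fun s => l s - path f μ ν s) (Ioo c c') :=
    ((hlc.integrableOn_Icc (a := c) (b := c')).mono_set Ioo_subset_Icc_self).sub
      (hT.path_integrableOn (by simp))
  have e1 : ∫ s in (0 : ℝ)..1, path f' μ' ν' s =
      (∫ s in (0 : ℝ)..1, path f μ ν s) + ∫ s in Ioo c c', (l s - path f μ ν s) := by
    rw [intervalIntegral.integral_of_le zero_le_one, intervalIntegral.integral_of_le zero_le_one,
      integral_Ioc_eq_integral_Ioo, integral_Ioc_eq_integral_Ioo]
    have e2 : ∫ s in Ioo c c', (l s - path f μ ν s) =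
        ∫ s in Ioo (0 : ℝ) 1, (Ioo c c').indicator (fun s => l s - path f μ ν s) s := by
      rw [setIntegral_indicator measurableSet_Ioo]
      congr 2
      exact (inter_eq_right.2 (Ioo_subset_Ioo hc hc'1)).symm
    rw [e2, ← integral_add (hT.path_integrableOn (by simp))]
    · refine setIntegral_congr_ae measurableSet_Ioo ?_
      have h1 : ∀ᵐ u : ℝ, u ≠ c := by simp [ae_iff]
      filter_upwards [h1] with s hsc hs
      rw [hall s ⟨hs.1.le, hs.2⟩]
      by_cases h2 : s ∈ Ico c c'
      · rw [if_pos h2, indicator_of_mem (show s ∈ Ioo c c' from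
          ⟨lt_of_le_of_ne h2.1 (Ne.symm hsc), h2.2⟩)]
        ring
      · rw [if_neg h2, indicator_of_notMem (fun hx => h2 ⟨hx.1.le, hx.2⟩), add_zero]
    · exact ((integrable_indicator_iff measurableSet_Ioo).2 hg).integrableOn
  have e2 : 0 < ∫ s in Ioo c c', (l s - path f μ ν s) := by
    rw [setIntegral_pos_iff_support_of_nonneg_ae _ hg]
    · refine lt_of_lt_of_le ?_ (measure_mono (show Ioo x y ⊆ _ from ?_))
      · rw [Real.volume_Ioo, ENNReal.ofReal_pos]
        linarith
      · intro s hs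
        exact ⟨(sub_pos.2 (hlt s hs)).ne', hcx.trans_lt hs.1, hs.2.trans_le hyc'⟩
    · rw [EventuallyLE, ae_restrict_iff' measurableSet_Ioo]
      exact Eventually.of_forall fun s hs => sub_nonneg.2 (hle s hs)
  linarith

/-- An optimal path does not jump down to zero. -/
lemma IsOptimalTriple.prePath_eq_zero (h : IsOptimalTriple I θdown θup z f μ ν) (hz : 0 < z)
    (hδ : 0 < δ) (hIδ : I (-δ) = 0) {c : ℝ} (hc : c ∈ Icc (0 : ℝ) 1) (hzero : path f μ ν c = 0) :
    prePath f μ ν c = 0 := by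
  rcases hc.2.eq_or_lt with rfl | hc1
  · rw [h.prePath_one, hzero]
  by_contra hne
  have hL : 0 < prePath f μ ν c := lt_of_le_of_ne (h.prePath_nonneg hc.2) (Ne.symm hne)
  set L := prePath f μ ν c with hLdef
  -- Just after a jump from L to zero the path is below L/2, while the free descent from L is still
  -- above L/2. Postponing the jump would therefore gain area.
  have h1 : ∀ᶠ s in 𝓝[>] c, path f μ ν s < L / 2 :=
    (h.triple.path_right c).eventually_lt_const (by rw [hzero]; linarith)
  have h2 : ∀ᶠ s in 𝓝[>] c, δ * (s - c) < L / 2 := by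
    have : Tendsto (fun s => δ * (s - c)) (𝓝[>] c) (𝓝 (δ * (c - c))) :=
      (Continuous.tendsto (by fun_prop) c).mono_left nhdsWithin_le_nhds
    exact this.eventually_lt_const (by rw [sub_self, mul_zero]; linarith)
  obtain ⟨r, hr, hr'⟩ := (mem_nhdsGT_iff_exists_Ioo_subset' hc1).1 ((h1.and h2).and
    (Ioo_mem_nhdsGT hc1))
  have hr : c < r := hr
  have key : ∀ s ∈ Ioo c r, path f μ ν s < max (L - δ * (s - c)) 0 := by
    intro s hs
    have := (hr' hs).1
    exact lt_max_of_lt_left (by linarith [this.1, this.2])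
  have hm : (c + r) / 2 ∈ Ioo c r := ⟨by linarith, by linarith⟩
  have hm1 := (hr' hm).2.2
  have hν : L ≤ ν.real {c} := by
    have := h.triple.path_eq_atom hc.1
    have h3 : 0 ≤ μ.real {c} := measureReal_nonneg
    linarith
  refine h.patch_false hz hδ hIδ hc.1 hm.1 hm1.le (fun _ => ⟨(key _ hm).le, ?_⟩)
    (fun s hs => (key s ⟨hs.1, hs.2.trans hm.2⟩).le) le_rfl hm.1 le_rfl
    (fun s hs => key s ⟨hs.1, hs.2.trans hm.2⟩)
  have h4 : 0 ≤ path f μ ν ((c + r) / 2) := h.nonneg _ ⟨hc.1.trans hm.1.le, hm1.le⟩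
  have h5 : max (L - δ * ((c + r) / 2 - c)) 0 ≤ L := by
    refine max_le ?_ hL.le
    have := mul_pos hδ (sub_pos.2 hm.1)
    linarith
  linarith

lemma IsOptimalTriple.path_pos (h : IsOptimalTriple I θdown θup z f μ ν) (hz : 0 < z)
    (hδ : 0 < δ) (hIδ : I (-δ) = 0) {c : ℝ} (hc : c ∈ Icc (0 : ℝ) 1)
    (hpos : 0 < prePath f μ ν c) : 0 < path f μ ν c :=
  lt_of_le_of_ne (h.nonneg c hc) fun h0 =>
    hpos.ne' (h.prePath_eq_zero hz hδ hIδ hc h0.symm)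

/-- An optimal path stays positive between two times at which it is positive. -/
lemma IsOptimalTriple.prePath_pos_of_between (h : IsOptimalTriple I θdown θup z f μ ν) (hz : 0 < z)
    (hδ : 0 < δ) (hIδ : I (-δ) = 0) {x t y : ℝ} (hx0 : 0 ≤ x) (hy1 : y ≤ 1) (hxt : x < t)
    (hty : t < y) (hx : 0 < path f μ ν x) (hy : 0 < path f μ ν y) : 0 < prePath f μ ν t := by
  by_contra hc
  have ht0 : prePath f μ ν t = 0 :=
    le_antisymm (not_lt.1 hc) (h.prePath_nonneg (hty.le.trans hy1))
  obtain ⟨x₁, hx₁, hx₁'⟩ : ∃ x₁, 0 < prePath f μ ν x₁ ∧ x₁ ∈ Ioo x t :=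
    (((h.triple.prePath_right x).eventually_const_lt hx).and (Ioo_mem_nhdsGT hxt)).exists
  obtain ⟨τ, hτ, hτ'⟩ : ∃ τ, 0 < prePath f μ ν τ ∧ τ ∈ Ioc t 1 := by
    rcases hy1.eq_or_lt with rfl | hy1
    · exact ⟨1, by rw [h.prePath_one]; exact hy, hty, le_rfl⟩
    · obtain ⟨τ, h1, h2⟩ := (((h.triple.prePath_right y).eventually_const_lt hy).and
        (Ioo_mem_nhdsGT hy1)).exists
      exact ⟨τ, h1, hty.trans h2.1, h2.2.le⟩
  -- The excursion around x₁ runs from its last zero a before x₁ to its first zero b after x₁. Zeros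
  -- of the left limits are used, and a = 0 is always available.
  set A := {s | s ∈ Icc 0 x₁ ∧ prePath f μ ν s = 0} with hA
  have hA0 : (0 : ℝ) ∈ A := ⟨⟨le_rfl, hx0.trans hx₁'.1.le⟩, prePath_of_nonpos _ _ _ le_rfl⟩
  have hAb : BddAbove A := ⟨x₁, fun s hs => hs.1.2⟩
  set a := sSup A with ha
  have ha0 : 0 ≤ a := le_csSup hAb hA0
  have hax : a ≤ x₁ := csSup_le ⟨0, hA0⟩ fun s hs => hs.1.2
  have hx₁1 : x₁ ≤ 1 := hx₁'.2.le.trans (hty.le.trans hy1)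
  have haz : prePath f μ ν a = 0 := by
    by_contra hne
    have hpos := lt_of_le_of_ne (h.prePath_nonneg (hax.trans hx₁1)) (Ne.symm hne)
    have ha0' : 0 < a := lt_of_le_of_ne ha0 fun h0 => hne (by
      rw [← h0, prePath_of_nonpos _ _ _ le_rfl])
    obtain ⟨r, hr, hr'⟩ := (mem_nhdsLT_iff_exists_Ioo_subset' ha0').1
      ((h.triple.prePath_left a).eventually_const_lt hpos)
    obtain ⟨s, hs, hrs⟩ := exists_lt_of_lt_csSup ⟨0, hA0⟩ (show r < sSup A from hr)
    rcases (le_csSup hAb hs).eq_or_lt with h1 | h1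
    · exact hne (by rw [ha, ← h1]; exact hs.2)
    · have : 0 < prePath f μ ν s := hr' ⟨hrs, h1⟩
      linarith [hs.2]
  set B := {s | s ∈ Icc x₁ t ∧ prePath f μ ν s = 0} with hB
  have hB0 : t ∈ B := ⟨⟨hx₁'.2.le, le_rfl⟩, ht0⟩
  have hBb : BddBelow B := ⟨x₁, fun s hs => hs.1.1⟩
  set b := sInf B with hb
  have hbt : b ≤ t := csInf_le hBb hB0
  have hxb : x₁ ≤ b := le_csInf ⟨t, hB0⟩ fun s hs => hs.1.1
  have ht1 : t ≤ 1 := hty.le.trans hy1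
  have hb01 : b ∈ Icc (0 : ℝ) 1 := ⟨ha0.trans (hax.trans hxb), hbt.trans ht1⟩
  have hbz : prePath f μ ν b = 0 := by
    by_contra hne
    have hpos := lt_of_le_of_ne (h.prePath_nonneg hb01.2) (Ne.symm hne)
    -- At b zeros would accumulate from the right, where the limit is the value of the path and not
    -- the left limit; the absence of jumps to zero bridges the gap.
    have hpos' := h.path_pos hz hδ hIδ hb01 hpos
    have hbt' : b < t := lt_of_le_of_ne hbt fun h0 => hne (by rw [h0, ht0])
    obtain ⟨r, hr, hr'⟩ := (mem_nhdsGT_iff_exists_Ioo_subset' hbt').1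
      ((h.triple.prePath_right b).eventually_const_lt hpos')
    obtain ⟨s, hs, hrs⟩ := exists_lt_of_csInf_lt ⟨t, hB0⟩ (show sInf B < r from hr)
    rcases (csInf_le hBb hs).eq_or_lt with h1 | h1
    · exact hne (by rw [hb, h1]; exact hs.2)
    · have : 0 < prePath f μ ν s := hr' ⟨h1, hrs⟩
      linarith [hs.2]
  have hab : a ≤ b := hax.trans hxb
  have hax' : a < x₁ := lt_of_le_of_ne hax fun h0 => hx₁.ne' (by rw [← h0, haz])
  have hpos_ab : ∀ u ∈ Ioo a b, 0 < path f μ ν u := by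
    intro u hu
    have hu01 : u ∈ Icc (0 : ℝ) 1 := ⟨ha0.trans hu.1.le, hu.2.le.trans hb01.2⟩
    refine h.path_pos hz hδ hIδ hu01 (lt_of_le_of_ne (h.prePath_nonneg hu01.2) fun h0 => ?_)
    rcases le_total u x₁ with h1 | h1
    · exact absurd (le_csSup hAb ⟨⟨hu01.1, h1⟩, h0.symm⟩) (not_le.2 hu.1)
    · exact absurd (csInf_le hBb ⟨⟨h1, hu.2.le.trans hbt⟩, h0.symm⟩) (not_le.2 hu.2)
  -- Exchange the excursion with the block [b, τ). Its increment is zero, so that block keeps its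
  -- height, while the excursion is lifted by the positive left limit at τ: a gain in area.
  have hswap := h.blockSwap_le hab (hbt.trans hτ'.1.le) hz ha0 hτ'.2
    (fun u hu => add_nonneg (h.nonneg u ⟨ha0.trans hu.1, hu.2.le.trans hb01.2⟩)
      (by rw [hbz]; linarith))
    (fun u hu => add_nonneg (h.nonneg u ⟨hb01.1.trans hu.1, hu.2.le.trans hτ'.2⟩)
      (by rw [haz, hbz, sub_zero]))
    (by
      have h1 : ∀ᵐ u : ℝ, u ≠ a := by simp [ae_iff]
      filter_upwards [h1] with u hua hu _
      exact hpos_ab u ⟨lt_of_le_of_ne hu.1 (Ne.symm hua), hu.2⟩)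
    (Eventually.of_forall fun u _ h1 => by rwa [haz, hbz, sub_zero, add_zero] at h1)
  rw [haz, hbz, sub_zero, sub_zero, zero_mul, add_zero] at hswap
  have : 0 < prePath f μ ν τ * (b - a) := mul_pos hτ (by linarith)
  linarith

end

/-! ### Concavity of the optimal path -/

/-- A locally concave function on an open interval is concave. -/
lemma concaveOn_Ioo_of_locally {g : ℝ → ℝ} {α β : ℝ}
    (h : ∀ t ∈ Ioo α β, ∃ r > 0, ∀ a b c : ℝ, t - r < a → a < b → b < c → c < t + r →
      (g c - g b) * (b - a) ≤ (g b - g a) * (c - b)) : ConcaveOn ℝ (Ioo α β) g := by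
  have hcont : ContinuousOn g (Ioo α β) := by
    intro t ht
    obtain ⟨r, hr, hr'⟩ := h t ht
    have : ConcaveOn ℝ (Ioo (t - r) (t + r)) g := by
      refine concaveOn_of_slope_anti_adjacent (convex_Ioo _ _) ?_
      intro x y w hx hw hxy hyw
      rw [div_le_div_iff₀ (by linarith) (by linarith)]
      exact hr' x y w hx.1 hxy hyw hw.2
    exact ((this.continuousOn isOpen_Ioo).continuousAt
      (Ioo_mem_nhds (by linarith) (by linarith))).continuousWithinAt
  refine concaveOn_of_slope_anti_adjacent (convex_Ioo _ _) ?_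
  intro x y w hx hw hxy hyw
  by_contra hc
  push Not at hc
  have hsub : Icc x w ⊆ Ioo α β := fun u hu => ⟨hx.1.trans_le hu.1, hu.2.trans_lt hw.2⟩
  set s := (g w - g x) / (w - x) with hs
  have hsw : s * (w - x) = g w - g x := div_mul_cancel₀ _ (by linarith)
  -- If y is below the chord, g minus the chord has a negative interior minimum. Let m be the last
  -- point where it is attained. Local concavity on [m - ε, m + ε] forces m + ε to be a minimum too.
  set G : ℝ → ℝ := fun u => g u - (g x + s * (u - x)) with hG
  have hGc : ContinuousOn G (Icc x w) := (hcont.mono hsub).sub (by fun_prop)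
  obtain ⟨m₀, hm₀, hmin⟩ := isCompact_Icc.exists_isMinOn ⟨x, le_rfl, (hxy.trans hyw).le⟩ hGc
  have hGx : G x = 0 := by simp [hG]
  have hGw : G w = 0 := by simp only [hG]; linarith
  have hGy : G y < 0 := by
    rw [div_lt_div_iff₀ (by linarith) (by linarith)] at hc
    have h1 : g y * (w - x) < g x * (w - x) + (g w - g x) * (y - x) := by nlinarith
    have h2 : (g y - (g x + s * (y - x))) * (w - x) < 0 := by
      have : s * (y - x) * (w - x) = (g w - g x) * (y - x) := by rw [← hsw]; ring
      nlinarith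
    exact neg_of_mul_neg_left h2 (by linarith)
  have hv : G m₀ < 0 := (hmin (show y ∈ Icc x w from ⟨hxy.le, hyw.le⟩)).trans_lt hGy
  have hK : IsCompact (Icc x w ∩ G ⁻¹' Iic (G m₀)) :=
    isCompact_Icc.of_isClosed_subset (hGc.preimage_isClosed_of_isClosed isClosed_Icc isClosed_Iic)
      inter_subset_left
  obtain ⟨m, ⟨hm1, hm2⟩, hm3⟩ := hK.exists_isGreatest ⟨m₀, hm₀, le_refl (G m₀)⟩
  have hm2 : G m ≤ G m₀ := hm2
  have hxm : x < m := lt_of_le_of_ne hm1.1 fun h0 => by rw [← h0, hGx] at hm2; linarith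
  have hmw : m < w := lt_of_le_of_ne hm1.2 fun h0 => by rw [h0, hGw] at hm2; linarith
  obtain ⟨r, hr, hr'⟩ := h m (hsub hm1)
  set ε := min (r / 2) (min (m - x) (w - m)) with hε
  have hε0 : 0 < ε := lt_min (by linarith) (lt_min (by linarith) (by linarith))
  have hε1 : ε ≤ r / 2 := min_le_left _ _
  have hε2 : ε ≤ m - x := (min_le_right _ _).trans (min_le_left _ _)
  have hε3 : ε ≤ w - m := (min_le_right _ _).trans (min_le_right _ _)
  have h1 := hr' (m - ε) m (m + ε) (by linarith) (by linarith) (by linarith) (by linarith)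
  have h2 : g (m + ε) - g m ≤ g m - g (m - ε) := by
    have e1 : m - (m - ε) = ε := by ring
    have e2 : m + ε - m = ε := by ring
    rw [e1, e2] at h1
    exact le_of_mul_le_mul_right h1 hε0
  have h3 : G m₀ ≤ G (m - ε) := hmin (show m - ε ∈ Icc x w from ⟨by linarith, by linarith⟩)
  have h4 : G (m + ε) ≤ G m₀ := by
    simp only [hG] at h3 hm2 ⊢
    nlinarith
  have h5 := hm3 (show m + ε ∈ _ from ⟨⟨by linarith, by linarith⟩, h4⟩)
  linarith

section

variable {f : ℝ → ℝ} {μ ν : Measure ℝ} {I : ℝ → ℝ≥0∞} {δ : ℝ} {θdown θup : ℝ≥0∞} {z : ℝ}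

/-- Where it is positive, an optimal path is locally concave. -/
lemma IsOptimalTriple.exists_local_concave (h : IsOptimalTriple I θdown θup z f μ ν) (hz : 0 < z)
    (hδ : 0 < δ) (hIδ : I (-δ) = 0) {t : ℝ} (ht : t ∈ Ioo (0 : ℝ) 1)
    (hpos : 0 < prePath f μ ν t) : ∃ r > 0, ∀ a b c : ℝ, t - r < a → a < b → b < c → c < t + r →
      (prePath f μ ν c - prePath f μ ν b) * (b - a) ≤
        (prePath f μ ν b - prePath f μ ν a) * (c - b) := by
  have hpos' := h.path_pos hz hδ hIδ (Ioo_subset_Icc_self ht) hpos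
  set m := min (prePath f μ ν t) (path f μ ν t) with hm
  have hm0 : 0 < m := lt_min hpos hpos'
  have hm1 : m ≤ prePath f μ ν t := min_le_left _ _
  have hm2 : m ≤ path f μ ν t := min_le_right _ _
  -- Three values enter the height of the exchanged path, each with an error below η, so it stays
  -- above m - 3η > 0.
  set η := m / 4 with hη
  have hη0 : 0 < η := by positivity
  have hev : ∀ {φ : ℝ → ℝ} {F : Filter ℝ} {l : ℝ}, Tendsto φ F (𝓝 l) →
      ∀ᶠ s in F, φ s ∈ Ioo (l - η) (l + η) := fun hφ =>
    hφ (Ioo_mem_nhds (by linarith) (by linarith))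
  obtain ⟨p, hp, hp'⟩ := (mem_nhdsLT_iff_exists_Ioo_subset' ht.1).1
    (((hev (h.triple.path_left t)).and (hev (h.triple.prePath_left t))).and
      (Ioo_mem_nhdsLT ht.1))
  obtain ⟨q, hq, hq'⟩ := (mem_nhdsGT_iff_exists_Ioo_subset' ht.2).1
    (((hev (h.triple.path_right t)).and (hev (h.triple.prePath_right t))).and
      (Ioo_mem_nhdsGT ht.2))
  have hp : p < t := hp
  have hq : t < q := hq
  refine ⟨min (t - p) (q - t), lt_min (by linarith) (by linarith), ?_⟩
  intro a b c hta hab hbc hct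
  have hr1 : min (t - p) (q - t) ≤ t - p := min_le_left _ _
  have hr2 : min (t - p) (q - t) ≤ q - t := min_le_right _ _
  have hleft : ∀ s, a ≤ s → s < t → path f μ ν s ∈ Ioo (prePath f μ ν t - η) (prePath f μ ν t + η) ∧
      prePath f μ ν s ∈ Ioo (prePath f μ ν t - η) (prePath f μ ν t + η) ∧ 0 < s := fun s h1 h2 => by
    have := hp' (show s ∈ Ioo p t from ⟨by linarith, h2⟩)
    exact ⟨this.1.1, this.1.2, this.2.1⟩
  have hright : ∀ s, t < s → s ≤ c → path f μ ν s ∈ Ioo (path f μ ν t - η) (path f μ ν t + η) ∧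
      prePath f μ ν s ∈ Ioo (path f μ ν t - η) (path f μ ν t + η) ∧ s < 1 := fun s h1 h2 => by
    have := hq' (show s ∈ Ioo t q from ⟨h1, by linarith⟩)
    exact ⟨this.1.1, this.1.2, this.2.2⟩
  have hpre : ∀ s, a ≤ s → s ≤ c → m - η < prePath f μ ν s := by
    intro s h1 h2
    rcases lt_trichotomy s t with h3 | rfl | h3
    · have := (hleft s h1 h3).2.1.1; linarith
    · linarith
    · have := (hright s h3 h2).2.1.1; linarith
  have hpath : ∀ s, a ≤ s → s ≤ c → m - η < path f μ ν s := by
    intro s h1 h2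
    rcases lt_trichotomy s t with h3 | rfl | h3
    · have := (hleft s h1 h3).1.1; linarith
    · linarith
    · have := (hright s h3 h2).1.1; linarith
  have ha0 : 0 ≤ a := by
    rcases lt_or_ge a t with h3 | h3
    · exact (hleft a le_rfl h3).2.2.le
    · linarith [ht.1]
  have hc1 : c ≤ 1 := by
    rcases lt_or_ge t c with h3 | h3
    · exact (hright c h3 le_rfl).2.2.le
    · linarith [ht.2]
  -- The path may still jump at t. In each case the subtracted value at b is matched with a value on
  -- the same side of t, so the two cancel up to 2η.
  have key : (∀ u ∈ Ico a b, 0 ≤ path f μ ν u + (prePath f μ ν c - prePath f μ ν b)) ∧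
      ∀ u ∈ Ico b c, 0 ≤ path f μ ν u + (prePath f μ ν a - prePath f μ ν b) := by
    rcases le_or_gt b t with hbt | hbt
    · have hb : prePath f μ ν b < prePath f μ ν t + η := by
        rcases hbt.lt_or_eq with h3 | rfl
        · exact (hleft b hab.le h3).2.1.2
        · linarith
      constructor
      · intro u hu
        have h1 := (hleft u hu.1 (hu.2.trans_le hbt)).1.1
        have h2 := hpre c (by linarith) le_rfl
        linarith
      · intro u hu
        have h1 := hpath u (hab.le.trans hu.1) hu.2.le
        have h2 := (hleft a le_rfl (hab.trans_le hbt)).2.1.1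
        linarith
    · have hb := (hright b hbt hbc.le).2.1.2
      constructor
      · intro u hu
        have h1 := hpath u hu.1 (hu.2.le.trans hbc.le)
        have h2 := (hright c (hbt.trans hbc) le_rfl).2.1.1
        linarith
      · intro u hu
        have h1 := (hright u (hbt.trans_le hu.1) hu.2.le).1.1
        have h2 := hpre a le_rfl (by linarith)
        linarith
  have hswap := h.blockSwap_le hab.le hbc.le hz ha0 hc1 key.1 key.2
    (Eventually.of_forall fun u hu _ => by
      have := hpath u hu.1 (hu.2.le.trans hbc.le); linarith)
    (Eventually.of_forall fun u hu _ => by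
      have := hpath u (hab.le.trans hu.1) hu.2.le; linarith)
  linarith

lemma IsOptimalTriple.concaveOn_prePath (h : IsOptimalTriple I θdown θup z f μ ν) (hz : 0 < z)
    (hδ : 0 < δ) (hIδ : I (-δ) = 0) {α β : ℝ} (hα : 0 ≤ α) (hβ : β ≤ 1)
    (hpos : ∀ s ∈ Ioo α β, 0 < prePath f μ ν s) : ConcaveOn ℝ (Ioo α β) (prePath f μ ν) :=
  concaveOn_Ioo_of_locally fun t ht =>
    h.exists_local_concave hz hδ hIδ ⟨hα.trans_lt ht.1, ht.2.trans_le hβ⟩ (hpos t ht)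

/-- Concavity makes the left-limit function continuous on the open interval, and its right limits
are the values of the path. So there are no jumps inside. -/
lemma IsOptimalTriple.path_eq_prePath (h : IsOptimalTriple I θdown θup z f μ ν) (hz : 0 < z)
    (hδ : 0 < δ) (hIδ : I (-δ) = 0) {α β : ℝ} (hα : 0 ≤ α) (hβ : β ≤ 1)
    (hpos : ∀ t ∈ Ioo α β, 0 < prePath f μ ν t) {t : ℝ} (ht : t ∈ Ioo α β) :
    path f μ ν t = prePath f μ ν t := by
  have hc := ((h.concaveOn_prePath hz hδ hIδ hα hβ hpos).continuousOn isOpen_Ioo).continuousAt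
    (isOpen_Ioo.mem_nhds ht)
  exact tendsto_nhds_unique (h.triple.prePath_right t) (hc.mono_left nhdsWithin_le_nhds)

lemma IsOptimalTriple.concaveOn_path (h : IsOptimalTriple I θdown θup z f μ ν) (hz : 0 < z)
    (hδ : 0 < δ) (hIδ : I (-δ) = 0) {α β : ℝ} (hα : 0 ≤ α) (hβ : β ≤ 1)
    (hpos : ∀ t ∈ Ioo α β, 0 < prePath f μ ν t) : ConcaveOn ℝ (Ioo α β) (path f μ ν) :=
  (h.concaveOn_prePath hz hδ hIδ hα hβ hpos).congr fun _ ht =>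
    (h.path_eq_prePath hz hδ hIδ hα hβ hpos ht).symm

end

/-! ### One-sided derivatives of concave functions -/

section Concave

variable {φ : ℝ → ℝ} {α β : ℝ}

/-- The right derivative. -/
noncomputable def rightDeriv (φ : ℝ → ℝ) (x : ℝ) : ℝ := derivWithin φ (Ioi x) x

lemma measurable_rightDeriv (φ : ℝ → ℝ) : Measurable (rightDeriv φ) :=
  measurable_derivWithin_Ioi φ

lemma hasDerivWithinAt_rightDeriv (hφ : ConcaveOn ℝ (Ioo α β) φ) {x : ℝ} (hx : x ∈ Ioo α β) :
    HasDerivWithinAt φ (rightDeriv φ x) (Ioi x) x := by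
  have := (hφ.neg.differentiableWithinAt_Ioi_of_mem_interior (by rwa [interior_Ioo])).neg
  rw [neg_neg] at this
  exact this.hasDerivWithinAt

lemma antitoneOn_rightDeriv (hφ : ConcaveOn ℝ (Ioo α β) φ) :
    AntitoneOn (rightDeriv φ) (Ioo α β) := by
  have h := hφ.neg.monotoneOn_rightDeriv
  rw [interior_Ioo] at h
  have e : ∀ x ∈ Ioo α β, derivWithin (-φ) (Ioi x) x = -rightDeriv φ x := fun x hx =>
    (hasDerivWithinAt_rightDeriv hφ hx).neg.derivWithin (uniqueDiffWithinAt_Ioi x)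
  intro x hx y hy hxy
  have := h hx hy hxy
  simp only [e x hx, e y hy] at this
  linarith

lemma integral_rightDeriv (hφ : ConcaveOn ℝ (Ioo α β) φ) {x y : ℝ} (hx : α < x) (hxy : x ≤ y)
    (hy : y < β) : ∫ s in x..y, rightDeriv φ s = φ y - φ x := by
  have hsub : Icc x y ⊆ Ioo α β := fun u hu => ⟨hx.trans_le hu.1, hu.2.trans_lt hy⟩
  refine intervalIntegral.integral_eq_sub_of_hasDeriv_right ?_ ?_ ?_
  · rw [uIcc_of_le hxy]
    exact (hφ.continuousOn isOpen_Ioo).mono hsub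
  · intro s hs
    rw [min_eq_left hxy, max_eq_right hxy] at hs
    exact hasDerivWithinAt_rightDeriv hφ (hsub (Ioo_subset_Icc_self hs))
  · refine ((antitoneOn_rightDeriv hφ).mono ?_).intervalIntegrable
    rwa [uIcc_of_le hxy]

lemma rightDeriv_mul_le (hφ : ConcaveOn ℝ (Ioo α β) φ) {x y : ℝ} (hx : α < x) (hxy : x ≤ y)
    (hy : y < β) : rightDeriv φ y * (y - x) ≤ φ y - φ x ∧ φ y - φ x ≤ rightDeriv φ x * (y - x) := by
  have ha := antitoneOn_rightDeriv hφ
  have hsub : Icc x y ⊆ Ioo α β := fun u hu => ⟨hx.trans_le hu.1, hu.2.trans_lt hy⟩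
  have hint : IntervalIntegrable (rightDeriv φ) volume x y :=
    (ha.mono (by rwa [uIcc_of_le hxy])).intervalIntegrable
  rw [← integral_rightDeriv hφ hx hxy hy]
  have hc : ∀ r : ℝ, r * (y - x) = ∫ _ in x..y, r := fun r => by
    rw [intervalIntegral.integral_const, smul_eq_mul, mul_comm]
  constructor
  · rw [hc]
    refine intervalIntegral.integral_mono_on hxy intervalIntegrable_const hint fun s hs => ?_
    exact ha (hsub hs) (hsub ⟨hxy, le_rfl⟩) hs.2
  · rw [hc]
    refine intervalIntegral.integral_mono_on hxy hint intervalIntegrable_const fun s hs => ?_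
    exact ha (hsub ⟨le_rfl, hxy⟩) (hsub hs) hs.1

/-- A secant from x to w of slope above a keeps such a slope when its left end moves slightly to y >
x, and the right derivative at y dominates it. The upper bound is monotonicity. -/
lemma tendsto_rightDeriv_right (hφ : ConcaveOn ℝ (Ioo α β) φ) {x : ℝ} (hx : x ∈ Ioo α β) :
    Tendsto (rightDeriv φ) (𝓝[>] x) (𝓝 (rightDeriv φ x)) := by
  rw [tendsto_order]
  constructor
  · intro a ha
    have h1 := (hasDerivWithinAt_iff_tendsto_slope' (by simp)).1 (hasDerivWithinAt_rightDeriv hφ hx)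
    obtain ⟨w, hw, hw'⟩ := ((h1.eventually_const_lt ha).and (Ioo_mem_nhdsGT hx.2)).exists
    have hc : Tendsto (fun y => slope φ y w) (𝓝[>] x) (𝓝 (slope φ x w)) := by
      have hφc : ContinuousAt φ x :=
        (hφ.continuousOn isOpen_Ioo).continuousAt (isOpen_Ioo.mem_nhds hx)
      have : ContinuousAt (fun y => slope φ y w) x := by
        simp only [slope_def_field]
        exact (continuousAt_const.sub hφc).div (by fun_prop) (by linarith [hw'.1])
      exact this.mono_left nhdsWithin_le_nhds
    filter_upwards [hc.eventually_const_lt hw, Ioo_mem_nhdsGT hw'.1] with y hy hy'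
    refine hy.trans_le ?_
    rw [slope_def_field, div_le_iff₀ (by linarith [hy'.2])]
    exact (rightDeriv_mul_le hφ (hx.1.trans hy'.1) hy'.2.le hw'.2).2
  · intro a ha
    filter_upwards [Ioo_mem_nhdsGT hx.2] with y hy
    exact (antitoneOn_rightDeriv hφ hx ⟨hx.1.trans hy.1, hy.2⟩ hy.1.le).trans_lt ha

/-- If the right derivative is bounded below, then it has left limits. -/
lemma exists_tendsto_rightDeriv_left (hφ : ConcaveOn ℝ (Ioo α β) φ) {t m : ℝ} (hαt : α < t)
    (htβ : t ≤ β) (hm : ∀ s ∈ Ioo α t, m ≤ rightDeriv φ s) :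
    ∃ v, Tendsto (rightDeriv φ) (𝓝[<] t) (𝓝 v) ∧ m ≤ v ∧ ∀ s ∈ Ioo α t, v ≤ rightDeriv φ s := by
  have ha : AntitoneOn (rightDeriv φ) (Ioo α t) :=
    (antitoneOn_rightDeriv hφ).mono (Ioo_subset_Ioo_right htβ)
  have hb : BddBelow (rightDeriv φ '' Ioo α t) := ⟨m, by rintro _ ⟨s, hs, rfl⟩; exact hm s hs⟩
  have hne : (rightDeriv φ '' Ioo α t).Nonempty := (nonempty_Ioo.2 hαt).image _
  refine ⟨sInf (rightDeriv φ '' Ioo α t), ha.tendsto_nhdsWithin_Ioo_left (nonempty_Ioo.2 hαt) hb,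
    le_csInf hne (by rintro _ ⟨s, hs, rfl⟩; exact hm s hs),
    fun s hs => csInf_le hb (mem_image_of_mem _ hs)⟩

/-- The left limit of the right derivative is the left derivative. -/
lemma hasDerivWithinAt_left_of_tendsto (hφ : ConcaveOn ℝ (Ioo α β) φ) {t v : ℝ} (hαt : α < t)
    (htβ : t ≤ β) (hcont : Tendsto φ (𝓝[<] t) (𝓝 (φ t)))
    (hv : Tendsto (rightDeriv φ) (𝓝[<] t) (𝓝 v)) (hvle : ∀ s ∈ Ioo α t, v ≤ rightDeriv φ s) :
    HasDerivWithinAt φ v (Iic t) t := by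
  have key : ∀ s ∈ Ioo α t, v * (t - s) ≤ φ t - φ s ∧ φ t - φ s ≤ rightDeriv φ s * (t - s) := by
    intro s hs
    have h1 : Tendsto (fun u => φ u - φ s) (𝓝[<] t) (𝓝 (φ t - φ s)) := hcont.sub_const _
    have h2 : ∀ r : ℝ, Tendsto (fun u => r * (u - s)) (𝓝[<] t) (𝓝 (r * (t - s))) := fun r =>
      (Continuous.tendsto (by fun_prop) t).mono_left nhdsWithin_le_nhds
    constructor
    · refine le_of_tendsto_of_tendsto (h2 v) h1 ?_
      filter_upwards [Ioo_mem_nhdsLT hs.2] with u hu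
      refine le_trans ?_ (rightDeriv_mul_le hφ hs.1 hu.1.le (hu.2.trans_le htβ)).1
      exact mul_le_mul_of_nonneg_right (hvle u ⟨hs.1.trans hu.1, hu.2⟩) (by linarith [hu.1])
    · refine le_of_tendsto_of_tendsto h1 (h2 (rightDeriv φ s)) ?_
      filter_upwards [Ioo_mem_nhdsLT hs.2] with u hu
      exact (rightDeriv_mul_le hφ hs.1 hu.1.le (hu.2.trans_le htβ)).2
  rw [← hasDerivWithinAt_Iio_iff_Iic, hasDerivWithinAt_iff_tendsto_slope' (by simp)]
  refine tendsto_of_tendsto_of_tendsto_of_le_of_le' tendsto_const_nhds hv ?_ ?_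
  · filter_upwards [Ioo_mem_nhdsLT hαt] with s hs
    rw [slope_comm, slope_def_field, le_div_iff₀ (by linarith [hs.2])]
    exact (key s hs).1
  · filter_upwards [Ioo_mem_nhdsLT hαt] with s hs
    rw [slope_comm, slope_def_field, div_le_iff₀ (by linarith [hs.2])]
    exact (key s hs).2

/-- A finite right derivative at the left end point is the limit of the right derivatives. -/
lemma tendsto_rightDeriv_of_hasDerivWithinAt (hφ : ConcaveOn ℝ (Ioo α β) φ) {v : ℝ} (hαβ : α < β)
    (hv : HasDerivWithinAt φ v (Ici α) α) :
    Tendsto (rightDeriv φ) (𝓝[>] α) (𝓝 v) ∧ ∀ s ∈ Ioo α β, rightDeriv φ s ≤ v := by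
  have hcont : Tendsto φ (𝓝[>] α) (𝓝 (φ α)) :=
    (hv.continuousWithinAt.mono Ioi_subset_Ici_self)
  have hslope : Tendsto (slope φ α) (𝓝[>] α) (𝓝 v) :=
    (hasDerivWithinAt_iff_tendsto_slope' (by simp)).1 (hasDerivWithinAt_Ioi_iff_Ici.2 hv)
  have ha := antitoneOn_rightDeriv hφ
  have key : ∀ s ∈ Ioo α β, rightDeriv φ s * (s - α) ≤ φ s - φ α := by
    intro s hs
    have h1 : Tendsto (fun u => φ s - φ u) (𝓝[>] α) (𝓝 (φ s - φ α)) := hcont.const_sub _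
    have h2 : Tendsto (fun u => rightDeriv φ s * (s - u)) (𝓝[>] α)
        (𝓝 (rightDeriv φ s * (s - α))) :=
      (Continuous.tendsto (by fun_prop) α).mono_left nhdsWithin_le_nhds
    refine le_of_tendsto_of_tendsto h2 h1 ?_
    filter_upwards [Ioo_mem_nhdsGT hs.1] with u hu
    exact (rightDeriv_mul_le hφ hu.1 hu.2.le hs.2).1
  -- Every upper bound of the slopes bounds the difference quotients at α. Together with `hle`, v is
  -- the supremum of the slopes, and by monotonicity their limit at α.
  have key2 : ∀ m : ℝ, (∀ s ∈ Ioo α β, rightDeriv φ s ≤ m) → v ≤ m := by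
    intro m hm
    refine le_of_tendsto hslope ?_
    filter_upwards [Ioo_mem_nhdsGT hαβ] with s hs
    rw [slope_def_field, div_le_iff₀ (by linarith [hs.1])]
    have h1 : Tendsto (fun u => φ s - φ u) (𝓝[>] α) (𝓝 (φ s - φ α)) := hcont.const_sub _
    have h2 : Tendsto (fun u => m * (s - u)) (𝓝[>] α) (𝓝 (m * (s - α))) :=
      (Continuous.tendsto (by fun_prop) α).mono_left nhdsWithin_le_nhds
    refine le_of_tendsto_of_tendsto h1 h2 ?_
    filter_upwards [Ioo_mem_nhdsGT hs.1] with u hu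
    refine (rightDeriv_mul_le hφ hu.1 hu.2.le hs.2).2.trans ?_
    exact mul_le_mul_of_nonneg_right (hm u ⟨hu.1, hu.2.trans hs.2⟩) (by linarith [hu.2])
  have hle : ∀ s ∈ Ioo α β, rightDeriv φ s ≤ v := by
    intro s hs
    refine ge_of_tendsto hslope ?_
    filter_upwards [Ioo_mem_nhdsGT hs.1] with u hu
    have huβ : u ∈ Ioo α β := ⟨hu.1, hu.2.trans hs.2⟩
    rw [slope_def_field, le_div_iff₀ (by linarith [hu.1])]
    refine le_trans ?_ (key u huβ)
    exact mul_le_mul_of_nonneg_right (ha huβ hs hu.2.le) (by linarith [hu.1])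
  refine ⟨?_, hle⟩
  rw [tendsto_order]
  constructor
  · intro a hav
    obtain ⟨s, hs, hs'⟩ : ∃ s ∈ Ioo α β, a < rightDeriv φ s := by
      by_contra hcon
      push Not at hcon
      exact absurd (key2 a hcon) (not_le.2 hav)
    filter_upwards [Ioo_mem_nhdsGT hs.1] with u hu
    exact hs'.trans_le (ha ⟨hu.1, hu.2.trans hs.2⟩ hs hu.2.le)
  · intro a hav
    filter_upwards [Ioo_mem_nhdsGT hαβ] with s hs
    exact (hle s hs).trans_lt hav

end Concave

/-! ### The slopes of an optimal path -/

section

variable {f f₂ : ℝ → ℝ} {μ ν : Measure ℝ} {I : ℝ → ℝ≥0∞} {δ : ℝ} {θdown θup : ℝ≥0∞} {z : ℝ}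

lemma path_congr_ae (hf : f =ᵐ[volume] f₂) : path f μ ν = path f₂ μ ν := by
  funext t
  rw [path, path, incr, incr, setIntegral_congr_ae measurableSet_Icc
    (by filter_upwards [hf] with x hx _ using hx)]

lemma openCost_congr_ae (hf : f =ᵐ[volume] f₂) :
    openCost I θdown θup f μ ν = openCost I θdown θup f₂ μ ν := by
  unfold openCost
  rw [path_congr_ae hf]
  congr 2
  refine lintegral_congr_ae (ae_restrict_of_ae ?_)
  filter_upwards [hf] with x hx
  simp only [indicator, hx]

lemma IsOptimalTriple.congr_ae (h : IsOptimalTriple I θdown θup z f μ ν) (hf : f =ᵐ[volume] f₂) :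
    IsOptimalTriple I θdown θup z f₂ μ ν := by
  have hp := path_congr_ae (μ := μ) (ν := ν) hf
  have hc := openCost_congr_ae (I := I) (θdown := θdown) (θup := θup) (μ := μ) (ν := ν) hf
  obtain ⟨h1, h2, h3, h4, h5, h6, h7, h8⟩ := h
  rw [hp] at h2 h3
  rw [hc] at h4 h5 h8
  exact ⟨⟨h1.integrable.congr hf, h1.finite_pos, h1.finite_neg, h1.singular_pos, h1.singular_neg,
    h1.hahn⟩, h2, h3, h4, h5, h6, h7, h8⟩

/-- If the path agrees on `[x, y]` with the primitive of `g`, then its density is `g` there. -/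
lemma IsTriple.density_eq (h : IsTriple f μ ν) {g : ℝ → ℝ} {x y : ℝ} (hx : 0 ≤ x) (hxy : x ≤ y)
    (hg : IntervalIntegrable g volume x y)
    (hpath : ∀ t ∈ Icc x y, path f μ ν t - path f μ ν x = ∫ s in x..t, g s) :
    ∀ᵐ s, s ∈ Ioc x y → f s = g s := by
  have := h.finite_pos
  have := h.finite_neg
  have hm : MeasurableSet (Ioc x y) := measurableSet_Ioc
  have h₁ : IsTriple ((Ioc x y).indicator f) (μ.restrict (Ioc x y)) (ν.restrict (Ioc x y)) :=
    ⟨h.integrable.indicator hm, inferInstance, inferInstance, h.singular_pos.restrict _,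
      h.singular_neg.restrict _, ((h.hahn.restrict _).symm.restrict _).symm⟩
  have h₂ : IsTriple ((Ioc x y).indicator g) 0 0 :=
    ⟨(integrable_indicator_iff hm).2 ((intervalIntegrable_iff_integrableOn_Ioc_of_le hxy).1 hg),
      inferInstance, inferInstance, Measure.MutuallySingular.zero_left,
      Measure.MutuallySingular.zero_left, Measure.MutuallySingular.zero_left⟩
  have e1 : ∀ S, MeasurableSet S → incr ((Ioc x y).indicator f) (μ.restrict (Ioc x y))
      (ν.restrict (Ioc x y)) S = incr f μ ν (S ∩ Ioc x y) := by
    intro S hS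
    rw [incr, incr, setIntegral_indicator hm, measureReal_restrict_apply hS,
      measureReal_restrict_apply hS]
  -- Restricted to (x, y], the path and the primitive of g come from the same signed measure.
  obtain ⟨hae, -⟩ := h₁.unique h₂ fun t => by
    rw [e1 _ measurableSet_Iic, incr, incr, setIntegral_indicator hm]
    have e2 : Iic t ∩ Ioc x y = Ioc x (min t y) := by
      ext u; simp only [mem_inter_iff, mem_Iic, mem_Ioc, le_min_iff]; tauto
    rw [e2]
    rcases le_or_gt x (min t y) with hx1 | hx1
    · have := hpath _ ⟨hx1, min_le_right _ _⟩
      rw [h.path_eq hx hx1, intervalIntegral.integral_of_le hx1] at this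
      rw [← this]
      simp [incr]
    · rw [Ioc_eq_empty (not_lt.2 hx1.le)]
      simp
  filter_upwards [hae] with s hs hsm
  rwa [indicator_of_mem hsm, indicator_of_mem hsm] at hs

/-- The interval `(α, β)` on which the path of an optimal triple is positive. -/
structure IsActive (f : ℝ → ℝ) (μ ν : Measure ℝ) (α β : ℝ) : Prop where
  nonneg : 0 ≤ α
  lt : α < β
  le_one : β ≤ 1
  pos : ∀ t ∈ Ioo α β, 0 < prePath f μ ν t
  zero_after : ∀ t ∈ Ico β 1, path f μ ν t = 0

variable {α β : ℝ}

/-- The concave path is the integral of its right derivative on compact subintervals, so the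
uniqueness of the decomposition applies there. Countably many rational intervals suffice. -/
lemma IsOptimalTriple.ae_density_eq (h : IsOptimalTriple I θdown θup z f μ ν) (hz : 0 < z)
    (hδ : 0 < δ) (hIδ : I (-δ) = 0) (ha : IsActive f μ ν α β) :
    ∀ᵐ s, s ∈ Ioo α β → f s = rightDeriv (path f μ ν) s := by
  have hφ := h.concaveOn_path hz hδ hIδ ha.nonneg ha.le_one ha.pos
  have key : ∀ p : ℚ × ℚ, ∀ᵐ s, α < p.1 → (p.1 : ℝ) ≤ p.2 → (p.2 : ℝ) < β →
      s ∈ Ioc (p.1 : ℝ) p.2 → f s = rightDeriv (path f μ ν) s := by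
    rintro ⟨x, y⟩
    by_cases hp : α < x ∧ (x : ℝ) ≤ y ∧ (y : ℝ) < β
    · have hint : IntervalIntegrable (rightDeriv (path f μ ν)) volume x y := by
        refine ((antitoneOn_rightDeriv hφ).mono ?_).intervalIntegrable
        rw [uIcc_of_le hp.2.1]
        exact fun u hu => ⟨hp.1.trans_le hu.1, hu.2.trans_lt hp.2.2⟩
      have := h.triple.density_eq (ha.nonneg.trans hp.1.le) hp.2.1 hint fun t ht =>
        (integral_rightDeriv hφ hp.1 ht.1 (ht.2.trans_lt hp.2.2)).symm
      filter_upwards [this] with s hs _ _ _ using hs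
    · exact Eventually.of_forall fun s h1 h2 h3 => absurd ⟨h1, h2, h3⟩ hp
  filter_upwards [ae_all_iff.2 key] with s hs hsm
  obtain ⟨x, hx1, hx2⟩ := exists_rat_btwn hsm.1
  obtain ⟨y, hy1, hy2⟩ := exists_rat_btwn hsm.2
  exact hs (x, y) hx1 (hx2.trans hy1).le hy2 ⟨hx2, hy1.le⟩

/-- After a change on a null set, the density of an optimal triple is the right derivative of its
path. -/
lemma IsOptimalTriple.exists_density (h : IsOptimalTriple I θdown θup z f μ ν) (hz : 0 < z)
    (hδ : 0 < δ) (hIδ : I (-δ) = 0) (ha : IsActive f μ ν α β) :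
    ∃ f₂, IsOptimalTriple I θdown θup z f₂ μ ν ∧ IsActive f₂ μ ν α β ∧
      path f₂ μ ν = path f μ ν ∧ ∀ s ∈ Ioo α β, f₂ s = rightDeriv (path f₂ μ ν) s := by
  classical
  set f₂ : ℝ → ℝ := fun s => if s ∈ Ioo α β then rightDeriv (path f μ ν) s else f s with hf₂
  have hae : f =ᵐ[volume] f₂ := by
    filter_upwards [h.ae_density_eq hz hδ hIδ ha] with s hs
    simp only [hf₂]
    split_ifs with h1
    · exact hs h1
    · rfl
  have hp : path f₂ μ ν = path f μ ν := (path_congr_ae hae).symm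
  have hpre : prePath f₂ μ ν = prePath f μ ν := by
    funext t
    exact tendsto_nhds_unique ((h.congr_ae hae).triple.path_left t)
      (by rw [hp]; exact h.triple.path_left t)
  refine ⟨f₂, h.congr_ae hae, ⟨ha.nonneg, ha.lt, ha.le_one, by rw [hpre]; exact ha.pos,
    by rw [hp]; exact ha.zero_after⟩, hp, fun s hs => ?_⟩
  rw [hp]
  simp only [hf₂, if_pos hs]

/-- The slopes of an optimal path are at least `-δ`. -/
lemma IsOptimalTriple.le_rightDeriv (h : IsOptimalTriple I θdown θup z f μ ν) (hz : 0 < z)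
    (hδ : 0 < δ) (hIδ : I (-δ) = 0) (ha : IsActive f μ ν α β) {t : ℝ} (ht : t ∈ Ioo α β) :
    -δ ≤ rightDeriv (path f μ ν) t := by
  by_contra hc
  push Not at hc
  have hφ := h.concaveOn_path hz hδ hIδ ha.nonneg ha.le_one ha.pos
  have ht1 : t < 1 := ht.2.trans_le ha.le_one
  -- By concavity a slope below -δ keeps the path below the free descent from t up to β; afterwards
  -- the path is zero. The patch can thus extend to time 1 and needs no return jump.
  have hlt : ∀ s ∈ Ioo t β, path f μ ν s < max (prePath f μ ν t - δ * (s - t)) 0 := by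
    intro s hs
    rw [← h.path_eq_prePath hz hδ hIδ ha.nonneg ha.le_one ha.pos ht]
    have h1 := (rightDeriv_mul_le hφ ht.1 hs.1.le hs.2).2
    have h2 : rightDeriv (path f μ ν) t * (s - t) < -δ * (s - t) :=
      mul_lt_mul_of_pos_right hc (by linarith [hs.1])
    exact lt_max_of_lt_left (by linarith)
  refine h.patch_false hz hδ hIδ (ha.nonneg.trans ht.1.le) ht1 le_rfl
    (fun h1 => absurd h1 (lt_irrefl _)) (fun s hs => ?_) le_rfl ht.2 ha.le_one hlt
  rcases lt_or_ge s β with h1 | h1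
  · exact (hlt s ⟨hs.1, h1⟩).le
  · rw [ha.zero_after s ⟨h1, hs.2⟩]
    exact le_max_right _ _

lemma IsOptimalTriple.lintegral_ne_top (h : IsOptimalTriple I θdown θup z f μ ν) :
    ∫⁻ s in Icc (0 : ℝ) 1, {s | 0 < path f μ ν s}.indicator (fun s => I (f s)) s ≠ ⊤ := by
  have := h.cost_lt_top
  rw [openCost] at this
  exact (lt_of_le_of_lt (le_self_add.trans le_self_add) this).ne

lemma IsOptimalTriple.ae_mem_effDom (h : IsOptimalTriple I θdown θup z f μ ν)
    (hI : IsGoodConvexRate I) :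
    ∀ᵐ s, s ∈ Icc (0 : ℝ) 1 → 0 < path f μ ν s → f s ∈ effDom I := by
  have h1 := ae_lt_top' (h.triple.measurable_cost hI).restrict h.lintegral_ne_top
  rw [ae_restrict_iff' measurableSet_Icc] at h1
  filter_upwards [h1] with s hs hs1 hs2
  have := hs hs1
  rw [indicator_of_mem (show s ∈ {s | 0 < path f μ ν s} from hs2)] at this
  exact this.ne

/-- Arbitrarily close to the left of each time there are slopes in the domain of the rate
function. -/
lemma IsOptimalTriple.exists_mem_effDom (h : IsOptimalTriple I θdown θup z f μ ν) (hz : 0 < z)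
    (hδ : 0 < δ) (hIδ : I (-δ) = 0) (hI : IsGoodConvexRate I) (ha : IsActive f μ ν α β)
    {x y : ℝ} (hx : α ≤ x) (hxy : x < y) (hy : y ≤ β) :
    ∃ s ∈ Ioo x y, rightDeriv (path f μ ν) s ∈ effDom I := by
  have h1 : ∀ᵐ s, s ∈ Ioo x y → rightDeriv (path f μ ν) s ∈ effDom I := by
    filter_upwards [h.ae_mem_effDom hI, h.ae_density_eq hz hδ hIδ ha] with s hs1 hs2 hs
    have hs' : s ∈ Ioo α β := ⟨hx.trans_lt hs.1, hs.2.trans_le hy⟩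
    have hs01 : s ∈ Icc (0 : ℝ) 1 := ⟨ha.nonneg.trans hs'.1.le, hs'.2.le.trans ha.le_one⟩
    rw [← hs2 hs']
    exact hs1 hs01 (h.path_pos hz hδ hIδ hs01 (ha.pos s hs'))
  by_contra hc
  push Not at hc
  have : volume (Ioo x y) = 0 := by
    refine measure_mono_null ?_ (ae_iff.1 h1)
    intro s hs h2
    exact hc s hs (h2 hs)
  rw [Real.volume_Ioo, ENNReal.ofReal_eq_zero] at this
  linarith

/-- Finite cost puts only almost every slope in the domain. Each slope lies between -δ and an
earlier slope in the domain, which is an interval. -/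
lemma IsOptimalTriple.rightDeriv_mem_effDom (h : IsOptimalTriple I θdown θup z f μ ν) (hz : 0 < z)
    (hδ : 0 < δ) (hIδ : I (-δ) = 0) (hI : IsGoodConvexRate I) (h_dom : -δ ∈ interior (effDom I))
    (ha : IsActive f μ ν α β) {t : ℝ} (ht : t ∈ Ioo α β) :
    rightDeriv (path f μ ν) t ∈ effDom I := by
  have hφ := h.concaveOn_path hz hδ hIδ ha.nonneg ha.le_one ha.pos
  obtain ⟨s, hs, hs'⟩ := h.exists_mem_effDom hz hδ hIδ hI ha le_rfl ht.1 ht.2.le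
  exact hI.convex_effDom.ordConnected.out (interior_subset h_dom) hs'
    ⟨h.le_rightDeriv hz hδ hIδ ha ht, antitoneOn_rightDeriv hφ ⟨hs.1, hs.2.trans ht.2⟩ ht hs.2.le⟩

end

/-! ### Perturbing the density: the first-order condition -/

section

variable {f k : ℝ → ℝ} {μ ν : Measure ℝ} {I : ℝ → ℝ≥0∞} {δ : ℝ} {θdown θup : ℝ≥0∞} {z : ℝ}
  {α β x y M : ℝ}

lemma path_add_mul (h : IsTriple f μ ν) (hk : Integrable k) (ε t : ℝ) :
    path (fun s => f s + ε * k s) μ ν t = path f μ ν t + ε * ∫ s in Icc 0 t, k s := by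
  rw [path, path, incr, incr, integral_add h.integrable.integrableOn (hk.const_mul ε).integrableOn,
    integral_const_mul]
  ring

/-- Fubini: the integral of the primitive of a function of mean zero. -/
lemma integral_primitive (hx : 0 ≤ x) (hy : y ≤ 1) (hk : Measurable k) (hM : ∀ s, |k s| ≤ M)
    (hsupp : ∀ s ∉ Icc x y, k s = 0) (h0 : ∫ s in Icc x y, k s = 0) :
    ∫ t in (0 : ℝ)..1, (∫ s in Icc 0 t, k s) = -∫ s in Icc x y, s * k s := by
  have hsub : Icc x y ⊆ Icc 0 1 := Icc_subset_Icc hx hy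
  have e0 : ∀ t ∈ Icc (0 : ℝ) 1, ∫ s in Icc 0 t, k s =
      ∫ s in Icc (0 : ℝ) 1, (Iic t).indicator k s := by
    intro t ht
    rw [setIntegral_indicator measurableSet_Iic]
    congr 2
    ext u; simp only [mem_inter_iff, mem_Iic, mem_Icc]; have := ht.2; grind
  have hprod : Integrable (Function.uncurry fun t s : ℝ => (Iic t).indicator k s)
      ((volume.restrict (Icc (0 : ℝ) 1)).prod (volume.restrict (Icc (0 : ℝ) 1))) := by
    have e : (Function.uncurry fun t s : ℝ => (Iic t).indicator k s) =
        {p : ℝ × ℝ | p.2 ≤ p.1}.indicator fun p => k p.2 := by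
      funext ⟨t, s⟩
      simp [indicator, Function.uncurry]
    rw [e]
    refine Integrable.indicator ?_ (measurableSet_le measurable_snd measurable_fst)
    exact Integrable.of_bound (hk.comp measurable_snd).aestronglyMeasurable M
      (Eventually.of_forall fun p => hM p.2)
  rw [intervalIntegral.integral_of_le zero_le_one, ← integral_Icc_eq_integral_Ioc,
    setIntegral_congr_fun measurableSet_Icc e0, integral_integral_swap hprod]
  -- Slope added at time s contributes to the area for the remaining time 1 - s; mean zero removes
  -- the 1.
  have e1 : ∀ s ∈ Icc (0 : ℝ) 1, ∫ t in Icc (0 : ℝ) 1, (Iic t).indicator k s = (1 - s) * k s := by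
    intro s hs
    have e : (fun t : ℝ => (Iic t).indicator k s) = (Ici s).indicator fun _ => k s := by
      funext t
      simp [indicator]
    rw [e, setIntegral_indicator measurableSet_Ici, setIntegral_const]
    have : Icc (0 : ℝ) 1 ∩ Ici s = Icc s 1 := by
      ext u; simp only [mem_inter_iff, mem_Ici, mem_Icc]; have := hs.1; grind
    rw [this, Real.volume_real_Icc_of_le hs.2, smul_eq_mul]
  rw [setIntegral_congr_fun measurableSet_Icc e1,
    setIntegral_eq_of_subset_of_forall_sdiff_eq_zero measurableSet_Icc hsub
      (fun s hs => by rw [hsupp s hs.2, mul_zero])]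
  have hkint : IntegrableOn k (Icc x y) :=
    Measure.integrableOn_of_bounded (by simp) hk.aestronglyMeasurable (Eventually.of_forall hM)
  have hskint : IntegrableOn (fun s => s * k s) (Icc x y) :=
    (hkint.continuousOn_mul continuousOn_id isCompact_Icc)
  have e2 : ∀ s : ℝ, (1 - s) * k s = k s - s * k s := fun s => by ring
  simp only [e2]
  rw [integral_sub hkint hskint, h0, zero_sub]

/-- Linearizes the scaling factor. With r = w/(3z) ≤ 1 one has (1 + r)² ≤ 1 + 3r = 1 + w/z; using
1/3 instead of the sharp 1/2 absorbs the quadratic term. -/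
lemma mul_le_of_le_sqrt_mul {a b w z : ℝ} (hz : 0 < z) (hw : 0 ≤ w) (hw3 : w ≤ 3 * z) (hb : 0 ≤ b)
    (h : a ≤ √(z / (z + w)) * b) : a + a / (3 * z) * w ≤ b := by
  set q := √(z / (z + w)) with hq
  have hq2 : q ^ 2 * (z + w) = z := by
    rw [hq, Real.sq_sqrt (by positivity)]
    field_simp
  have hq0 : 0 ≤ q := Real.sqrt_nonneg _
  have hr : 0 ≤ w / (3 * z) := by positivity
  have hr1 : w / (3 * z) ≤ 1 := (div_le_one (by positivity)).2 hw3
  have h1 : q * (1 + w / (3 * z)) ≤ 1 := by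
    refine abs_le_of_sq_le_sq' ?_ zero_le_one |>.2
    have e : z + w = z * (1 + 3 * (w / (3 * z))) := by field_simp
    have h2 : q ^ 2 * (1 + 3 * (w / (3 * z))) = 1 := by
      rw [e] at hq2
      have : z * (q ^ 2 * (1 + 3 * (w / (3 * z)))) = z * 1 := by linarith
      exact mul_left_cancel₀ hz.ne' this
    rw [mul_pow, one_pow, ← h2]
    refine mul_le_mul_of_nonneg_left ?_ (sq_nonneg q)
    nlinarith
  have h3 : a * (1 + w / (3 * z)) ≤ b := by
    calc a * (1 + w / (3 * z)) ≤ (q * b) * (1 + w / (3 * z)) :=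
          mul_le_mul_of_nonneg_right h (by positivity)
      _ = (q * (1 + w / (3 * z))) * b := by ring
      _ ≤ 1 * b := mul_le_mul_of_nonneg_right h1 hb
      _ = b := one_mul b
  calc a + a / (3 * z) * w = a * (1 + w / (3 * z)) := by ring
    _ ≤ b := h3

/-- The cost inequality for a small perturbation of the density. -/
lemma IsOptimalTriple.perturb (h : IsOptimalTriple I θdown θup z f μ ν) (hz : 0 < z)
    (hx : 0 ≤ x) (hy : y ≤ 1) (hpos : ∀ s ∈ Icc x y, 0 < path f μ ν s)
    (hfin : ∫⁻ s in Icc x y, I (f s) ≠ ⊤)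
    (hk : Measurable k) (hM : ∀ s, |k s| ≤ M)
    (hsupp : ∀ s ∉ Icc x y, k s = 0) (h0 : ∫ s in Icc x y, k s = 0)
    (hΓ : 0 ≤ -∫ s in Icc x y, s * k s) {ε : ℝ} (hε : 0 < ε)
    (hε3 : ε * (-∫ s in Icc x y, s * k s) ≤ 3 * z)
    (hposε : ∀ s ∈ Icc x y, 0 < path f μ ν s + ε * ∫ r in Icc 0 s, k r)
    (hfinε : ∫⁻ s in Icc x y, I (f s + ε * k s) ≠ ⊤) :
    (∫⁻ s in Icc x y, I (f s)).toReal + (openCost I θdown θup f μ ν).toReal / (3 * z) *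
      (ε * (-∫ s in Icc x y, s * k s)) ≤ (∫⁻ s in Icc x y, I (f s + ε * k s)).toReal := by
  have hsub : Icc x y ⊆ Icc 0 1 := Icc_subset_Icc hx hy
  have hkint : Integrable k := by
    rw [← integrableOn_iff_integrable_of_support_subset (s := Icc x y)
      (fun s hs => by_contra fun hc => hs (hsupp s hc))]
    exact Measure.integrableOn_of_bounded (by simp) hk.aestronglyMeasurable
      (Eventually.of_forall hM)
  set f' : ℝ → ℝ := fun s => f s + ε * k s with hf'
  have hT : IsTriple f' μ ν := ⟨h.triple.integrable.add (hkint.const_mul ε), h.triple.finite_pos,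
    h.triple.finite_neg, h.triple.singular_pos, h.triple.singular_neg, h.triple.hahn⟩
  have hpath : ∀ t, path f' μ ν t = path f μ ν t + ε * ∫ s in Icc 0 t, k s :=
    path_add_mul h.triple hkint ε
  have hout : ∀ t ∉ Icc x y, ∫ s in Icc 0 t, k s = 0 := by
    intro t ht
    rcases lt_or_ge t x with h1 | h1
    · refine setIntegral_eq_zero_of_forall_eq_zero fun s hs => hsupp s fun hs' => ?_
      linarith [hs.2, hs'.1]
    · have h2 : y < t := not_le.1 fun h2 => ht ⟨h1, h2⟩
      exact (setIntegral_eq_of_subset_of_forall_sdiff_eq_zero measurableSet_Icc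
        (Icc_subset_Icc hx h2.le) (fun s hs => hsupp s hs.2)).trans h0
  have hpath' : ∀ t ∉ Icc x y, path f' μ ν t = path f μ ν t := fun t ht => by
    rw [hpath, hout t ht, mul_zero, add_zero]
  have hpos' : ∀ t ∈ Ico (0 : ℝ) 1, 0 ≤ path f' μ ν t := by
    intro t ht
    by_cases h1 : t ∈ Icc x y
    · rw [hpath]; exact (hposε t h1).le
    · rw [hpath' t h1]; exact h.nonneg t (Ico_subset_Icc_self ht)
  set Γ := -∫ s in Icc x y, s * k s with hΓdef
  have harea : ∫ s in (0 : ℝ)..1, path f' μ ν s = z + ε * Γ := by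
    have hi1 : IntervalIntegrable (path f μ ν) volume 0 1 :=
      (intervalIntegrable_iff_integrableOn_Ioc_of_le zero_le_one).2
        (h.triple.path_integrableOn (by simp))
    have hi2 : IntervalIntegrable (path f' μ ν) volume 0 1 :=
      (intervalIntegrable_iff_integrableOn_Ioc_of_le zero_le_one).2
        (hT.path_integrableOn (by simp))
    have := intervalIntegral.integral_sub hi2 hi1
    rw [h.area] at this
    have e : ∀ t, path f' μ ν t - path f μ ν t = ε * ∫ s in Icc 0 t, k s := fun t => by
      rw [hpath]; ring
    simp only [e] at this
    rw [intervalIntegral.integral_const_mul, integral_primitive hx hy hk hM hsupp h0] at this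
    linarith
  have hmin := h.minimal f' μ ν hT hpos' (by
    rw [harea]; linarith [mul_nonneg hε.le hΓ])
  rw [harea] at hmin
  -- The cost outside [x, y] and of the singular parts, common to both paths: k has mean zero, so
  -- the path changes only on [x, y].
  set R := (∫⁻ s in Icc (0 : ℝ) 1 \ Icc x y,
    {s | 0 < path f μ ν s}.indicator (fun s => I (f s)) s) + θdown * ν (Ico 0 1) + θup * μ (Ico 0 1)
    with hR
  have split : ∀ F : ℝ → ℝ≥0∞, ∫⁻ s in Icc (0 : ℝ) 1, F s =
      (∫⁻ s in Icc x y, F s) + ∫⁻ s in Icc (0 : ℝ) 1 \ Icc x y, F s := by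
    intro F
    rw [← lintegral_union (measurableSet_Icc.diff measurableSet_Icc) disjoint_sdiff_self_right,
      union_sdiff_cancel hsub]
  have hc1 : openCost I θdown θup f μ ν = (∫⁻ s in Icc x y, I (f s)) + R := by
    rw [openCost, split, hR, add_assoc, add_assoc, add_assoc]
    congr 1
    refine setLIntegral_congr_fun measurableSet_Icc fun s hs => ?_
    exact indicator_of_mem (s := {s | 0 < path f μ ν s}) (hpos s hs) _
  have hc2 : openCost I θdown θup f' μ ν = (∫⁻ s in Icc x y, I (f' s)) + R := by
    rw [openCost, split, hR, add_assoc, add_assoc, add_assoc]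
    congr 1
    · refine setLIntegral_congr_fun measurableSet_Icc fun s hs => ?_
      refine indicator_of_mem (s := {s | 0 < path f' μ ν s}) ?_ _
      rw [mem_ofPred_eq, hpath]
      exact hposε s hs
    · congr 1
      refine setLIntegral_congr_fun (measurableSet_Icc.diff measurableSet_Icc) fun s hs => ?_
      have : f' s = f s := by simp [hf', hsupp s hs.2]
      simp only [indicator, mem_ofPred_eq, hpath' s hs.2, this]
  have hRtop : R ≠ ⊤ := by
    have := h.cost_lt_top.ne
    rw [hc1] at this
    exact (ENNReal.add_ne_top.1 this).2
  have hmin' := ENNReal.toReal_mono (ENNReal.mul_ne_top ENNReal.ofReal_ne_top (by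
    rw [hc2]; exact ENNReal.add_ne_top.2 ⟨hfinε, hRtop⟩)) hmin
  rw [ENNReal.toReal_mul, ENNReal.toReal_ofReal (Real.sqrt_nonneg _)] at hmin'
  have := mul_le_of_le_sqrt_mul hz (mul_nonneg hε.le hΓ) hε3 ENNReal.toReal_nonneg hmin'
  rw [hc2, ENNReal.toReal_add hfinε hRtop] at this
  have e : (openCost I θdown θup f μ ν).toReal = (∫⁻ s in Icc x y, I (f s)).toReal + R.toReal := by
    rw [hc1, ENNReal.toReal_add hfin hRtop]
  linarith

end

section

variable {f k : ℝ → ℝ} {μ ν : Measure ℝ} {I : ℝ → ℝ≥0∞} {δ : ℝ} {θdown θup : ℝ≥0∞} {z : ℝ}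
  {α β x y M : ℝ}

lemma setLIntegral_rate (hI : IsGoodConvexRate I) {F : ℝ → ℝ} (hF : Measurable F) {C : ℝ}
    (hdom : ∀ s ∈ Icc x y, F s ∈ effDom I) (hC : ∀ s ∈ Icc x y, |(I (F s)).toReal| ≤ C) :
    ∫⁻ s in Icc x y, I (F s) ≠ ⊤ ∧
      (∫⁻ s in Icc x y, I (F s)).toReal = ∫ s in Icc x y, (I (F s)).toReal ∧
      IntegrableOn (fun s => (I (F s)).toReal) (Icc x y) := by
  have hm : Measurable fun s => I (F s) := hI.measurable.comp hF
  refine ⟨?_, ?_, ?_⟩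
  · refine ne_top_of_le_ne_top ?_ (setLIntegral_mono' measurableSet_Icc
      (g := fun _ => ENNReal.ofReal C) fun s hs => ?_)
    · rw [setLIntegral_const]
      exact ENNReal.mul_ne_top ENNReal.ofReal_ne_top (by simp)
    · rw [← ENNReal.ofReal_toReal (hdom s hs)]
      exact ENNReal.ofReal_le_ofReal ((le_abs_self _).trans (hC s hs))
  · rw [integral_toReal hm.aemeasurable]
    rw [ae_restrict_iff' measurableSet_Icc]
    exact Eventually.of_forall fun s hs => (hdom s hs).lt_top
  · refine Measure.integrableOn_of_bounded (M := C) (by simp)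
      hm.ennreal_toReal.aestronglyMeasurable ?_
    rw [ae_restrict_iff' measurableSet_Icc]
    exact Eventually.of_forall hC

/-- The first-order condition for perturbations of the density that do not decrease the area. -/
lemma IsOptimalTriple.first_order (h : IsOptimalTriple I θdown θup z f μ ν) (hz : 0 < z)
    (hδ : 0 < δ) (hIδ : I (-δ) = 0) (hI : IsGoodConvexRate I) (h_dom : -δ ∈ interior (effDom I))
    (h_diff : ∀ v ∈ interior (effDom I), DifferentiableAt ℝ (fun y => (I y).toReal) v)
    (ha : IsActive f μ ν α β) (hf : ∀ s ∈ Ioo α β, f s = rightDeriv (path f μ ν) s)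
    (hαx : α < x) (hxy : x < y) (hyβ : y < β)
    (hgx : rightDeriv (path f μ ν) x ∈ interior (effDom I))
    (hk : Measurable k) (hM : ∀ s, |k s| ≤ M)
    (hsupp : ∀ s ∉ Icc x y, k s = 0) (h0 : ∫ s in Icc x y, k s = 0)
    (hΓ : 0 ≤ -∫ s in Icc x y, s * k s) :
    (openCost I θdown θup f μ ν).toReal / (3 * z) * (-∫ s in Icc x y, s * k s) ≤
      ∫ s in Icc x y, k s * deriv (fun v => (I v).toReal) (rightDeriv (path f μ ν) s) := by
  set g := rightDeriv (path f μ ν) with hg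
  set D := deriv fun v => (I v).toReal with hD
  set Γ := -∫ s in Icc x y, s * k s with hΓdef
  have hφ := h.concaveOn_path hz hδ hIδ ha.nonneg ha.le_one ha.pos
  have hanti : AntitoneOn g (Ioo α β) := antitoneOn_rightDeriv hφ
  have hgm : Measurable g := measurable_rightDeriv _
  have hsub : Icc x y ⊆ Ioo α β := fun u hu => ⟨hαx.trans_le hu.1, hu.2.trans_lt hyβ⟩
  have hsub1 : Ioo α β ⊆ Icc 0 1 := fun u hu =>
    ⟨ha.nonneg.trans hu.1.le, hu.2.le.trans ha.le_one⟩
  have hxm : x ∈ Icc x y := ⟨le_rfl, hxy.le⟩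
  have hym : y ∈ Icc x y := ⟨hxy.le, le_rfl⟩
  have hord : OrdConnected (interior (effDom I)) := hI.convex_effDom.interior.ordConnected
  have hgy : g y ∈ interior (effDom I) := hord.out h_dom hgx
    ⟨h.le_rightDeriv hz hδ hIδ ha (hsub hym), hanti (hsub hxm) (hsub hym) hxy.le⟩
  -- A compact set in the interior of the domain that contains all slopes on [x, y] and their
  -- perturbations for small ε. It supplies the bounds for the domination.
  obtain ⟨r, hr, hK⟩ : ∃ r > 0, Icc (g y - r) (g x + r) ⊆ interior (effDom I) := by
    obtain ⟨r₁, hr₁, h₁⟩ := Metric.isOpen_iff.1 isOpen_interior _ hgy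
    obtain ⟨r₂, hr₂, h₂⟩ := Metric.isOpen_iff.1 isOpen_interior _ hgx
    refine ⟨min r₁ r₂ / 2, by positivity, hord.out (h₁ ?_) (h₂ ?_)⟩
    · rw [Metric.mem_ball, Real.dist_eq, sub_sub_cancel_left, abs_neg, abs_of_pos (by positivity)]
      have := min_le_left r₁ r₂
      linarith
    · rw [Metric.mem_ball, Real.dist_eq, add_sub_cancel_left, abs_of_pos (by positivity)]
      have := min_le_right r₁ r₂
      linarith
  have hDc : ContinuousOn D (interior (effDom I)) := hI.continuousOn_deriv h_diff
  have hIc : ContinuousOn (fun v => (I v).toReal) (interior (effDom I)) :=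
    fun v hv => (h_diff v hv).continuousAt.continuousWithinAt
  obtain ⟨C, hC⟩ := isCompact_Icc.exists_bound_of_continuousOn (hDc.mono hK)
  obtain ⟨C₁, hC₁⟩ := isCompact_Icc.exists_bound_of_continuousOn (hIc.mono hK)
  obtain ⟨s₀, hs₀, hmin⟩ := isCompact_Icc.exists_isMinOn ⟨x, hxm⟩
    ((hφ.continuousOn isOpen_Ioo).mono hsub)
  have hpos : ∀ s ∈ Icc x y, 0 < path f μ ν s := fun s hs =>
    h.path_pos hz hδ hIδ (hsub1 (hsub hs)) (ha.pos s (hsub hs))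
  have hm0 := hpos s₀ hs₀
  have hM0 : 0 ≤ M := (abs_nonneg _).trans (hM 0)
  have hgK : ∀ s ∈ Icc x y, g s ∈ Icc (g y) (g x) := fun s hs =>
    ⟨hanti (hsub hs) (hsub hym) hs.2, hanti (hsub hxm) (hsub hs) hs.1⟩
  have hFK : ∀ ε, 0 < ε → ε * M < r → ∀ s ∈ Icc x y, g s + ε * k s ∈ Icc (g y - r) (g x + r) := by
    intro ε hε hεM s hs
    have h1 := hgK s hs
    have h2 : |ε * k s| ≤ r := by
      rw [abs_mul, abs_of_pos hε]
      exact (mul_le_mul_of_nonneg_left (hM s) hε.le).trans hεM.le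
    rw [abs_le] at h2
    exact ⟨by linarith [h1.1, h2.1], by linarith [h1.2, h2.2]⟩
  have hgK' : ∀ s ∈ Icc x y, g s ∈ Icc (g y - r) (g x + r) := fun s hs =>
    ⟨by linarith [(hgK s hs).1], by linarith [(hgK s hs).2]⟩
  have hkint : Integrable k := by
    rw [← integrableOn_iff_integrable_of_support_subset (s := Icc x y)
      (fun s hs => by_contra fun hc => hs (hsupp s hc))]
    exact Measure.integrableOn_of_bounded (by simp) hk.aestronglyMeasurable
      (Eventually.of_forall hM)
  have hDm : Measurable D := measurable_deriv _
  have hev : ∀ (a b : ℝ), 0 < b → ∀ᶠ ε in 𝓝[>] (0 : ℝ), ε * a < b := by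
    intro a b hb
    have : Tendsto (fun ε : ℝ => ε * a) (𝓝[>] 0) (𝓝 (0 * a)) :=
      (Continuous.tendsto (by fun_prop) 0).mono_left nhdsWithin_le_nhds
    rw [zero_mul] at this
    exact this.eventually_lt_const hb
  have key : ∀ᶠ ε in 𝓝[>] (0 : ℝ), (openCost I θdown θup f μ ν).toReal / (3 * z) * Γ ≤
      ∫ s in Icc x y, k s * D (g s + ε * k s) := by
    filter_upwards [hev M r hr, hev (∫ s, |k s|) _ hm0, hev Γ (3 * z) (by positivity),
      self_mem_nhdsWithin] with ε hε1 hε2 hε3 hε0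
    have hε0 : 0 < ε := hε0
    have hF := hFK ε hε0 hε1
    obtain ⟨a1, a2, a3⟩ := setLIntegral_rate (x := x) (y := y) hI hgm
      (fun s hs => interior_subset (hK (hgK' s hs))) (fun s hs => hC₁ _ (hgK' s hs))
    obtain ⟨b1, b2, b3⟩ := setLIntegral_rate (x := x) (y := y) hI (hgm.add (hk.const_mul ε))
      (fun s hs => interior_subset (hK (hF s hs))) (fun s hs => hC₁ _ (hF s hs))
    have e1 : ∫⁻ s in Icc x y, I (f s) = ∫⁻ s in Icc x y, I (g s) :=
      setLIntegral_congr_fun measurableSet_Icc fun s hs => by simp only [hf s (hsub hs), hg]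
    have e2 : ∫⁻ s in Icc x y, I (f s + ε * k s) = ∫⁻ s in Icc x y, I (g s + ε * k s) :=
      setLIntegral_congr_fun measurableSet_Icc fun s hs => by simp only [hf s (hsub hs), hg]
    have hper := h.perturb hz (hsub1 (hsub hxm)).1 (hsub1 (hsub hym)).2 hpos (by rw [e1]; exact a1)
      hk hM hsupp h0 hΓ hε0 hε3.le
      (fun s hs => by
        have h1 : path f μ ν s₀ ≤ path f μ ν s := hmin hs
        have h2 : |∫ r in Icc 0 s, k r| ≤ ∫ s, |k s| :=
          abs_integral_le_integral_abs.trans (setIntegral_le_integral hkint.abs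
            (Eventually.of_forall fun x => abs_nonneg _))
        have h3 : |ε * ∫ r in Icc 0 s, k r| ≤ ε * ∫ s, |k s| := by
          rw [abs_mul, abs_of_pos hε0]
          exact mul_le_mul_of_nonneg_left h2 hε0.le
        linarith [neg_le_of_abs_le h3])
      (by rw [e2]; exact b1)
    rw [e1, e2, a2] at hper
    simp only [Pi.add_apply] at b2 b3
    rw [b2] at hper
    have hint : IntegrableOn (fun s => k s * D (g s + ε * k s)) (Icc x y) := by
      refine Measure.integrableOn_of_bounded (M := M * C) (by simp)
        (hk.mul (hDm.comp (hgm.add (hk.const_mul ε)))).aestronglyMeasurable ?_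
      rw [ae_restrict_iff' measurableSet_Icc]
      refine Eventually.of_forall fun s hs => ?_
      rw [norm_mul]
      exact mul_le_mul (hM s) (hC _ (hF s hs)) (norm_nonneg _) hM0
    -- The tangent is taken at the perturbed slope, which bounds the perturbed cost from above.
    -- After division by ε only the continuity of ∇I is needed.
    have hle : ∫ s in Icc x y, (I (g s + ε * k s)).toReal ≤
        ∫ s in Icc x y, ((I (g s)).toReal + ε * (k s * D (g s + ε * k s))) := by
      refine setIntegral_mono_on b3 (a3.add (hint.const_mul ε)) measurableSet_Icc fun s hs => ?_
      have := hI.deriv_mul_le h_diff (hK (hF s hs)) (interior_subset (hK (hgK' s hs)))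
      rw [← hD] at this
      linarith
    rw [integral_add a3 (hint.const_mul ε), integral_const_mul] at hle
    have : ε * ((openCost I θdown θup f μ ν).toReal / (3 * z) * Γ) ≤
        ε * ∫ s in Icc x y, k s * D (g s + ε * k s) := by linarith
    exact le_of_mul_le_mul_left this hε0
  refine ge_of_tendsto ?_ key
  refine tendsto_integral_filter_of_dominated_convergence (fun _ => M * C) ?_ ?_ ?_ ?_
  · exact Eventually.of_forall fun ε =>
      (hk.mul (hDm.comp (hgm.add (hk.const_mul ε)))).aestronglyMeasurable
  · filter_upwards [hev M r hr, self_mem_nhdsWithin] with ε hε1 hε0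
    rw [ae_restrict_iff' measurableSet_Icc]
    refine Eventually.of_forall fun s hs => ?_
    rw [norm_mul]
    exact mul_le_mul (hM s) (hC _ (hFK ε hε0 hε1 s hs)) (norm_nonneg _) hM0
  · exact integrableOn_const (by simp)
  · rw [ae_restrict_iff' measurableSet_Icc]
    refine Eventually.of_forall fun s hs => Tendsto.const_mul _ ?_
    have h1 : ContinuousAt D (g s) := hDc.continuousAt (isOpen_interior.mem_nhds (hK (hgK' s hs)))
    refine h1.tendsto.comp ?_
    have h2 : Tendsto (fun ε : ℝ => g s + ε * k s) (𝓝[>] 0) (𝓝 (g s + 0 * k s)) :=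
      (Continuous.tendsto (by fun_prop) 0).mono_left nhdsWithin_le_nhds
    simpa using h2

end

/-! ### The affine form of ∇I along the slopes -/

section

/-- A bounded function whose integrals against the test functions `k` of mean zero are bounded
below by a positive multiple of the moment `-∫ s * k s`, if this is non-negative, is affine and
decreasing. -/
lemma ae_eq_affine_of_variation {p : ℝ → ℝ} {x y κ C : ℝ} (hxy : x < y) (hp : Measurable p)
    (hC : ∀ s ∈ Icc x y, |p s| ≤ C)
    (H : ∀ (k : ℝ → ℝ) (M : ℝ), Measurable k → (∀ s, |k s| ≤ M) → (∀ s ∉ Icc x y, k s = 0) →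
      ∫ s in Icc x y, k s = 0 → 0 ≤ -∫ s in Icc x y, s * k s →
        κ * (-∫ s in Icc x y, s * k s) ≤ ∫ s in Icc x y, k s * p s) :
    ∃ A B : ℝ, B ≤ -κ ∧ ∀ᵐ s, s ∈ Icc x y → p s = A + B * s := by
  have hm : MeasurableSet (Icc x y) := measurableSet_Icc
  have hint : ∀ (q : ℝ → ℝ) (M : ℝ), Measurable q → (∀ s ∈ Icc x y, |q s| ≤ M) →
      IntegrableOn q (Icc x y) := fun q M hq hM => by
    refine Measure.integrableOn_of_bounded (M := M) (by simp) hq.aestronglyMeasurable ?_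
    rw [ae_restrict_iff' hm]
    exact Eventually.of_forall hM
  -- Centring makes w orthogonal to the constants; on functions of mean zero it has the same moment
  -- as s.
  set m := (x + y) / 2 with hm_def
  set w : ℝ → ℝ := fun s => s - m with hw
  have hwb : ∀ s ∈ Icc x y, |w s| ≤ y - x := fun s hs => by
    rw [abs_le]; constructor <;> simp only [hw, hm_def] <;> linarith [hs.1, hs.2]
  have hwm : Measurable w := by fun_prop
  have hL : 0 < y - x := sub_pos.2 hxy
  have hC0 : 0 ≤ C := (abs_nonneg _).trans (hC x ⟨le_rfl, hxy.le⟩)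
  have toI : ∀ q : ℝ → ℝ, ∫ s in Icc x y, q s = ∫ s in x..y, q s := fun q => by
    rw [integral_Icc_eq_integral_Ioc, intervalIntegral.integral_of_le hxy.le]
  have i1 : ∫ _ in Icc x y, (1 : ℝ) = y - x := by rw [toI]; simp
  have iw : ∫ s in Icc x y, w s = 0 := by
    rw [toI]
    simp only [hw]
    rw [intervalIntegral.integral_sub (by simp) (by simp)]
    simp [hm_def]
    ring
  have iww : 0 < ∫ s in Icc x y, w s * w s := by
    rw [toI]
    have : ∀ s, w s * w s = (s - m) ^ 2 := fun s => by simp only [hw]; ring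
    simp only [this]
    rw [intervalIntegral.integral_comp_sub_right (fun s => s ^ 2), integral_pow]
    have : (y - m) ^ (2 + 1) - (x - m) ^ (2 + 1) = (y - x) ^ 3 / 4 := by rw [hm_def]; ring
    rw [this]
    positivity
  set W := ∫ s in Icc x y, w s * w s with hW
  have hpI := hint p C hp hC
  have hwI := hint w _ hwm hwb
  have hwwI : IntegrableOn (fun s => w s * w s) (Icc x y) :=
    hint _ ((y - x) * (y - x)) (hwm.mul hwm) fun s hs => by
      rw [abs_mul]; exact mul_le_mul (hwb s hs) (hwb s hs) (abs_nonneg _) hL.le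
  have hwpI : IntegrableOn (fun s => w s * p s) (Icc x y) :=
    hint _ ((y - x) * C) (hwm.mul hp) fun s hs => by
      rw [abs_mul]; exact mul_le_mul (hwb s hs) (hC s hs) (abs_nonneg _) hL.le
  -- Projection of p on the span of 1 and w in L²; the residual r is orthogonal to both.
  set A := (∫ s in Icc x y, p s) / (y - x) with hA
  set B := (∫ s in Icc x y, w s * p s) / W with hB
  set r : ℝ → ℝ := fun s => p s - A * 1 - B * w s with hr
  have hrm : Measurable r := by fun_prop
  have hrb : ∀ s ∈ Icc x y, |r s| ≤ C + |A| + |B| * (y - x) := fun s hs => by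
    have h1 := abs_sub (p s - A * 1) (B * w s)
    have h2 := abs_sub (p s) (A * 1)
    rw [abs_mul] at h1
    rw [mul_one] at h2
    have h3 := mul_le_mul_of_nonneg_left (hwb s hs) (abs_nonneg B)
    have h4 := hC s hs
    simp only [hr, mul_one] at h1 ⊢
    linarith
  have hrI := hint r _ hrm hrb
  have hoI : IntegrableOn (fun _ : ℝ => (1 : ℝ)) (Icc x y) := integrableOn_const (by simp)
  have hwrI : IntegrableOn (fun s => w s * r s) (Icc x y) :=
    hint _ ((y - x) * _) (hwm.mul hrm) fun s hs => by
      rw [abs_mul]; exact mul_le_mul (hwb s hs) (hrb s hs) (abs_nonneg _) hL.le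
  have lin : ∀ (q₁ q₂ q₃ : ℝ → ℝ) (a b : ℝ), IntegrableOn q₁ (Icc x y) → IntegrableOn q₂ (Icc x y) →
      IntegrableOn q₃ (Icc x y) → ∫ s in Icc x y, (q₁ s + a * q₂ s + b * q₃ s) =
        (∫ s in Icc x y, q₁ s) + a * (∫ s in Icc x y, q₂ s) + b * ∫ s in Icc x y, q₃ s := by
    intro q₁ q₂ q₃ a b h1 h2 h3
    have h4 : IntegrableOn (fun s => q₁ s + a * q₂ s) (Icc x y) := h1.add (h2.const_mul a)
    rw [integral_add h4 (h3.const_mul b), integral_add h1 (h2.const_mul a), integral_const_mul,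
      integral_const_mul]
  have ir : ∫ s in Icc x y, r s = 0 := by
    have e : ∀ s, r s = p s + -A * 1 + -B * w s := fun s => by simp only [hr]; ring
    simp only [e]
    rw [lin _ _ _ _ _ hpI hoI hwI, i1, iw, hA]
    field_simp
    ring
  have iwr : ∫ s in Icc x y, w s * r s = 0 := by
    have e : ∀ s, w s * r s = w s * p s + -A * w s + -B * (w s * w s) := fun s => by
      simp only [hr]; ring
    simp only [e]
    rw [lin _ _ _ _ _ hwpI hwI hwwI, iw, ← hW, hB]
    field_simp
    ring
  have test : ∀ (q : ℝ → ℝ) (M : ℝ), Measurable q → (∀ s ∈ Icc x y, |q s| ≤ M) →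
      ∫ s in Icc x y, q s = 0 → 0 ≤ -∫ s in Icc x y, w s * q s →
      κ * (-∫ s in Icc x y, w s * q s) ≤ ∫ s in Icc x y, q s * p s := by
    intro q M hq hM h0 hΓ
    have hM0 : 0 ≤ M := (abs_nonneg _).trans (hM x ⟨le_rfl, hxy.le⟩)
    have hqI := hint q M hq hM
    have hwqI : IntegrableOn (fun s => w s * q s) (Icc x y) :=
      hint _ ((y - x) * M) (hwm.mul hq) fun s hs => by
        rw [abs_mul]; exact mul_le_mul (hwb s hs) (hM s hs) (abs_nonneg _) hL.le
    have ind : ∀ s ∈ Icc x y, (Icc x y).indicator q s = q s := fun s hs => indicator_of_mem hs _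
    have e0 : ∫ s in Icc x y, (Icc x y).indicator q s = ∫ s in Icc x y, q s :=
      setIntegral_congr_fun hm ind
    have e1 : ∫ s in Icc x y, s * (Icc x y).indicator q s = ∫ s in Icc x y, w s * q s := by
      have e : ∫ s in Icc x y, s * (Icc x y).indicator q s
          = ∫ s in Icc x y, (w s * q s + m * q s) :=
        setIntegral_congr_fun hm fun s hs => by simp only [ind s hs, hw]; ring
      rw [e, integral_add hwqI (hqI.const_mul m), integral_const_mul, h0, mul_zero, add_zero]
    have e2 : ∫ s in Icc x y, (Icc x y).indicator q s * p s = ∫ s in Icc x y, q s * p s :=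
      setIntegral_congr_fun hm fun s hs => by simp only [ind s hs]
    have := H ((Icc x y).indicator q) M (hq.indicator hm) (fun s => ?_)
      (fun s hs => indicator_of_notMem hs _) (by rw [e0, h0]) (by rw [e1]; exact hΓ)
    · rwa [e1, e2] at this
    · by_cases hs : s ∈ Icc x y
      · rw [ind s hs]; exact hM s hs
      · rw [indicator_of_notMem hs, abs_zero]; exact hM0
  refine ⟨A - B * m, B, ?_, ?_⟩
  -- The test function -w has positive moment W, so the hypothesis reads κ W ≤ -B W.
  · have := test (fun s => -w s) (y - x) hwm.neg (fun s hs => by rw [abs_neg]; exact hwb s hs)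
      (by rw [integral_neg, iw, neg_zero]) (by simp only [mul_neg]; rw [integral_neg]; linarith)
    simp only [mul_neg, neg_mul] at this
    rw [integral_neg, integral_neg, ← hW] at this
    rw [hB, div_le_iff₀ iww]
    linarith
  -- The test function -r has zero moment, so 0 ≤ -∫ r p = -∫ r², and r vanishes almost everywhere.
  · have h1 := test (fun s => -r s) _ hrm.neg (fun s hs => by rw [abs_neg]; exact hrb s hs)
      (by rw [integral_neg, ir, neg_zero])
      (by simp only [mul_neg]; rw [integral_neg, iwr]; simp)
    have hrrI : IntegrableOn (fun s => r s * r s) (Icc x y) :=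
      hint _ (_ * _) (hrm.mul hrm) fun s hs => by
        rw [abs_mul]
        exact mul_le_mul (hrb s hs) (hrb s hs) (abs_nonneg _) ((abs_nonneg _).trans (hrb s hs))
    have e : ∀ s, -r s * p s = -(r s * r s + A * r s + B * (w s * r s)) := fun s => by
      simp only [hr]; ring
    simp only [mul_neg] at h1
    rw [integral_neg, iwr] at h1
    simp only [e] at h1
    rw [integral_neg, lin _ _ _ _ _ hrrI hrI hwrI, ir, iwr] at h1
    have h2 : ∫ s in Icc x y, r s * r s = 0 :=
      le_antisymm (by linarith) (integral_nonneg fun s => mul_self_nonneg _)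
    rw [integral_eq_zero_iff_of_nonneg (fun s => mul_self_nonneg _) hrrI] at h2
    rw [EventuallyEq, ae_restrict_iff' hm] at h2
    filter_upwards [h2] with s hs hsm
    have := mul_self_eq_zero.1 (hs hsm)
    simp only [hr, hw] at this
    linarith

variable {f : ℝ → ℝ} {μ ν : Measure ℝ} {I : ℝ → ℝ≥0∞} {δ : ℝ} {θdown θup : ℝ≥0∞} {z : ℝ}
  {α β : ℝ}

/-- The Euler-Lagrange equation in integrated form: the derivative of the rate function along the
slopes of an optimal path is affine and decreasing. -/
lemma IsOptimalTriple.exists_affine (h : IsOptimalTriple I θdown θup z f μ ν) (hz : 0 < z)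
    (hδ : 0 < δ) (hIδ : I (-δ) = 0) (hI : IsGoodConvexRate I) (h_dom : -δ ∈ interior (effDom I))
    (h_diff : ∀ v ∈ interior (effDom I), DifferentiableAt ℝ (fun y => (I y).toReal) v)
    (ha : IsActive f μ ν α β) (hf : ∀ s ∈ Ioo α β, f s = rightDeriv (path f μ ν) s)
    {γ : ℝ} (hαγ : α ≤ γ) (hγβ : γ < β)
    (hg : ∀ s ∈ Ioo γ β, rightDeriv (path f μ ν) s ∈ interior (effDom I)) :
    ∃ b lam : ℝ, 0 < lam ∧ ∀ t ∈ Ioo γ β,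
      deriv (fun v => (I v).toReal) (rightDeriv (path f μ ν) t) = b - lam * t := by
  have hφ := h.concaveOn_path hz hδ hIδ ha.nonneg ha.le_one ha.pos
  have hanti := antitoneOn_rightDeriv hφ
  set g := rightDeriv (path f μ ν) with hg_def
  set D := deriv (fun v => (I v).toReal) with hD
  have hDmono := hI.monotoneOn_deriv h_diff
  have hDc := hI.continuousOn_deriv h_diff
  set κ := (openCost I θdown θup f μ ν).toReal / (3 * z) with hκ
  have hκ0 : 0 < κ := by
    have := ENNReal.toReal_pos h.cost_pos.ne' h.cost_lt_top.ne
    positivity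
  have hsub : ∀ {s}, s ∈ Ioo γ β → s ∈ Ioo α β := fun hs => ⟨hαγ.trans_lt hs.1, hs.2⟩
  have hpm : Measurable (fun s => D (g s)) := (measurable_deriv _).comp (measurable_rightDeriv _)
  have loc : ∀ x y, γ < x → x < y → y < β →
      ∃ A B : ℝ, B ≤ -κ ∧ ∀ t ∈ Ico x y, D (g t) = A + B * t := by
    intro x y hx hxy hy
    have hmem : ∀ s ∈ Icc x y, s ∈ Ioo γ β := fun s hs => ⟨hx.trans_le hs.1, hs.2.trans_lt hy⟩
    have hx' := hmem x ⟨le_rfl, hxy.le⟩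
    have hy' := hmem y ⟨hxy.le, le_rfl⟩
    obtain ⟨A, B, hB, hae⟩ := ae_eq_affine_of_variation (κ := κ) (C := max |D (g x)| |D (g y)|)
      hxy hpm (fun s hs => by
        have h1 := hDmono (hg _ (hmem s hs)) (hg _ hx') (hanti (hsub hx') (hsub (hmem s hs)) hs.1)
        have h2 := hDmono (hg _ hy') (hg _ (hmem s hs)) (hanti (hsub (hmem s hs)) (hsub hy') hs.2)
        rw [max_comm]
        exact abs_le_max_abs_abs h2 h1)
      (fun k M hk hM hsupp h0 hΓ => h.first_order hz hδ hIδ hI h_dom h_diff ha hf (hsub hx').1 hxy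
        hy (hg x hx') hk hM hsupp h0 hΓ)
    refine ⟨A, B, hB, fun t ht => ?_⟩
    have ht' := hmem t ⟨ht.1, ht.2.le⟩
    have h1 : Tendsto (fun s => D (g s)) (𝓝[>] t) (𝓝 (D (g t))) :=
      (hDc.continuousAt (isOpen_interior.mem_nhds (hg t ht'))).tendsto.comp
        (tendsto_rightDeriv_right hφ (hsub ht'))
    have h2 : Tendsto (fun s => A + B * s) (𝓝[>] t) (𝓝 (A + B * t)) :=
      (Continuous.tendsto (by fun_prop) t).mono_left nhdsWithin_le_nhds
    -- Equality almost everywhere gives such points arbitrarily close to the right of t. Right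
    -- continuity of D ∘ g extends it to t itself.
    have hfr : ∃ᶠ s in 𝓝[>] t, D (g s) = A + B * s := by
      intro hev
      have hev' := hev.and (Ioo_mem_nhdsGT ht.2)
      obtain ⟨u, hu, hsubu⟩ := (mem_nhdsGT_iff_exists_Ioo_subset).1 hev'
      have : volume (Ioo t u) = 0 := by
        refine measure_mono_null ?_ (ae_iff.1 hae)
        intro s hs hc
        have := hsubu hs
        exact this.1 (hc ⟨ht.1.trans this.2.1.le, this.2.2.le⟩)
      rw [Real.volume_Ioo, ENNReal.ofReal_eq_zero] at this
      have := mem_Ioi.1 hu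
      linarith
    exact tendsto_nhds_unique_of_frequently_eq h1 h2 hfr
  -- Two anchor points contained in every window used below: agreement there forces all local affine
  -- functions to coincide.
  set x₀ := (2 * γ + β) / 3 with hx₀
  set x₁ := (γ + 2 * β) / 3 with hx₁
  obtain ⟨A, B, hB, hAB⟩ := loc x₀ ((x₁ + β) / 2) (by linarith) (by linarith) (by linarith)
  refine ⟨A, -B, by linarith, fun t ht => ?_⟩
  obtain ⟨A', B', -, hAB'⟩ := loc ((γ + min t x₀) / 2) ((max t x₁ + β) / 2)
    (by linarith [lt_min ht.1 (show γ < x₀ by linarith)])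
    (by linarith [min_le_right t x₀, le_max_right t x₁])
    (by linarith [max_lt ht.2 (show x₁ < β by linarith)])
  have l1 := lt_min ht.1 (show γ < x₀ by linarith)
  have l2 := max_lt ht.2 (show x₁ < β by linarith)
  have e0 := hAB x₀ ⟨le_rfl, by linarith⟩
  have e1 := hAB x₁ ⟨by linarith, by linarith⟩
  have e0' := hAB' x₀ ⟨by linarith [min_le_right t x₀], by linarith [le_max_right t x₁]⟩
  have e1' := hAB' x₁ ⟨by linarith [min_le_right t x₀], by linarith [le_max_right t x₁]⟩
  have et := hAB' t ⟨by linarith [min_le_left t x₀], by linarith [le_max_left t x₁]⟩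
  have hBB : B = B' := by
    have : (B - B') * (x₁ - x₀) = 0 := by linarith
    rcases mul_eq_zero.1 this with h | h <;> linarith
  subst hBB
  rw [et]
  linarith

end

/-! ### Dependence on the values on [0, 1] only -/

section Congr

variable {φ ψ : ℝ → ℝ} {I : ℝ → ℝ≥0∞} {t v p : ℝ}

lemma hasDerivWithinAt_Iic_congr (h : EqOn φ ψ (Icc 0 1)) (ht : t ∈ Ioc (0 : ℝ) 1) :
    HasDerivWithinAt φ v (Iic t) t ↔ HasDerivWithinAt ψ v (Iic t) t := by
  refine Filter.EventuallyEq.hasDerivWithinAt_iff ?_ (h ⟨ht.1.le, ht.2⟩)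
  filter_upwards [self_mem_nhdsWithin, nhdsWithin_le_nhds (Ioi_mem_nhds ht.1)] with s hs hs'
  exact h ⟨(mem_Ioi.1 hs').le, (mem_Iic.1 hs).trans ht.2⟩

lemma hasDerivWithinAt_Ici_congr (h : EqOn φ ψ (Icc 0 1)) (ht : t ∈ Ico (0 : ℝ) 1) :
    HasDerivWithinAt φ v (Ici t) t ↔ HasDerivWithinAt ψ v (Ici t) t := by
  refine Filter.EventuallyEq.hasDerivWithinAt_iff ?_ (h ⟨ht.1, ht.2.le⟩)
  filter_upwards [self_mem_nhdsWithin, nhdsWithin_le_nhds (Iio_mem_nhds ht.2)] with s hs hs'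
  exact h ⟨ht.1.trans (mem_Ici.1 hs), (mem_Iio.1 hs').le⟩

lemma T0_congr (h : EqOn φ ψ (Icc 0 1)) : T0 φ = T0 ψ := by
  unfold T0
  congr 1
  ext t
  exact and_congr_right fun ht => by rw [h ht]

lemma T1_congr (h : EqOn φ ψ (Icc 0 1)) : T1 φ = T1 ψ := by
  unfold T1
  congr 1
  ext t
  exact and_congr_right fun ht => by rw [h ht]

lemma T00_congr (h : EqOn φ ψ (Icc 0 1)) : T00 I φ = T00 I ψ := by
  have : maxSlopeTimes I φ = maxSlopeTimes I ψ := by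
    ext t
    exact and_congr_right fun ht => by simp only [hasDerivWithinAt_Iic_congr h ht]
  unfold T00
  rw [this, T0_congr h]

lemma leftEL_congr (h : EqOn φ ψ (Icc 0 1)) (ht : t ∈ Ioc (0 : ℝ) 1) :
    LeftEL I φ p t ↔ LeftEL I ψ p t := by
  simp only [LeftEL, hasDerivWithinAt_Iic_congr h ht]

lemma rightEL_congr (h : EqOn φ ψ (Icc 0 1)) (ht : t ∈ Ico (0 : ℝ) 1) :
    RightEL I φ p t ↔ RightEL I ψ p t := by
  simp only [RightEL, hasDerivWithinAt_Ici_congr h ht]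

lemma EulerLagrangeAt.of_left_right (hl : LeftEL I φ p t) (hr : RightEL I φ p t) :
    EulerLagrangeAt I φ p t := by
  refine ⟨hl, hr, fun hu => ?_⟩
  obtain ⟨v, hv, hv'⟩ := hl
  obtain ⟨w, hw, hw'⟩ := hr
  obtain rfl := hu _ _ hv' hw'
  refine ⟨v, ?_, hv'⟩
  have := hv.union hw
  rwa [Iic_union_Ici, hasDerivWithinAt_univ] at this

/-- The left derivative of a function that vanishes to the left is zero. -/
lemma eq_zero_of_hasDerivWithinAt_Iic (hv : HasDerivWithinAt φ v (Iic t) t)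
    (h0 : ∀ᶠ s in 𝓝[<] t, φ s = 0) : v = 0 := by
  have hc : Tendsto φ (𝓝[<] t) (𝓝 (φ t)) := hv.continuousWithinAt.mono Iio_subset_Iic_self
  have ht : φ t = 0 := tendsto_nhds_unique hc
    (tendsto_const_nhds.congr' (h0.mono fun s hs => hs.symm))
  rw [← hasDerivWithinAt_Iio_iff_Iic, hasDerivWithinAt_iff_tendsto_slope' (by simp)] at hv
  refine tendsto_nhds_unique hv (tendsto_const_nhds.congr' (h0.mono fun s hs => ?_))
  rw [slope_def_field, hs, ht]
  simp

end Congr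

/-! ### The interval of positivity -/

section

variable {f : ℝ → ℝ} {μ ν : Measure ℝ} {I : ℝ → ℝ≥0∞} {δ : ℝ} {θdown θup : ℝ≥0∞} {z : ℝ}

lemma T0_le {φ : ℝ → ℝ} {t : ℝ} (ht : t ∈ Icc (0 : ℝ) 1) (hpos : 0 < φ t) : T0 φ ≤ t :=
  csInf_le ⟨0, fun _ hs => hs.1.1⟩ ⟨ht, hpos⟩

lemma le_T1 {φ : ℝ → ℝ} {t : ℝ} (ht : t ∈ Icc (0 : ℝ) 1) (hpos : 0 < φ t) : t ≤ T1 φ :=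
  le_csSup ⟨1, fun _ hs => hs.1.2⟩ ⟨ht, hpos⟩

lemma IsOptimalTriple.path_eq_zero_of_lt_T0 (h : IsOptimalTriple I θdown θup z f μ ν) {t : ℝ}
    (ht1 : t ≤ 1) (ht : t < T0 (path f μ ν)) : path f μ ν t = 0 := by
  rcases lt_or_ge t 0 with h0 | h0
  · exact path_of_neg _ _ _ h0
  · by_contra hc
    exact ht.not_ge (T0_le ⟨h0, ht1⟩ ((h.nonneg t ⟨h0, ht1⟩).lt_of_ne (Ne.symm hc)))

lemma IsOptimalTriple.path_eq_zero_of_T1_lt (h : IsOptimalTriple I θdown θup z f μ ν) {t : ℝ}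
    (ht : t ∈ Icc (0 : ℝ) 1) (ht' : T1 (path f μ ν) < t) : path f μ ν t = 0 := by
  by_contra hc
  exact ht'.not_ge (le_T1 ht ((h.nonneg t ht).lt_of_ne (Ne.symm hc)))

/-- Positive area provides positive times, with a second one by right continuity, so the interval is
not degenerate. Right continuity also makes the path vanish at T₁ itself if T₁ < 1. -/
lemma IsOptimalTriple.isActive (h : IsOptimalTriple I θdown θup z f μ ν) (hz : 0 < z)
    (hδ : 0 < δ) (hIδ : I (-δ) = 0) :
    IsActive f μ ν (T0 (path f μ ν)) (T1 (path f μ ν)) := by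
  obtain ⟨t₀, ht₀, hpos₀⟩ : ∃ t ∈ Ico (0 : ℝ) 1, 0 < path f μ ν t := by
    by_contra hc
    push Not at hc
    have := IsTriple.integral_nonpos hc
    rw [h.area] at this
    linarith
  obtain ⟨t₁, hpos₁, ht₁⟩ := (((h.triple.path_right t₀).eventually_const_lt hpos₀).and
    (Ioo_mem_nhdsGT ht₀.2)).exists
  have ht₁' : t₁ ∈ Icc (0 : ℝ) 1 := ⟨ht₀.1.trans ht₁.1.le, ht₁.2.le⟩
  have hne : {t | t ∈ Icc (0 : ℝ) 1 ∧ 0 < path f μ ν t}.Nonempty := ⟨t₁, ht₁', hpos₁⟩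
  refine ⟨le_csInf hne fun s hs => hs.1.1, ?_, csSup_le hne fun s hs => hs.1.2, ?_, ?_⟩
  · exact (T0_le ⟨ht₀.1, ht₀.2.le⟩ hpos₀).trans_lt (ht₁.1.trans_le (le_T1 ht₁' hpos₁))
  · intro t ht
    obtain ⟨x, hx, hxt⟩ := exists_lt_of_csInf_lt hne ht.1
    obtain ⟨y, hy, hty⟩ := exists_lt_of_lt_csSup hne ht.2
    exact h.prePath_pos_of_between hz hδ hIδ hx.1.1 hy.1.2 hxt hty hx.2 hy.2
  · intro t ht
    have h0 : 0 ≤ t := (ht₁'.1.trans (le_T1 ht₁' hpos₁)).trans ht.1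
    refine tendsto_nhds_unique (h.triple.path_right t) (tendsto_const_nhds.congr' ?_)
    filter_upwards [Ioo_mem_nhdsGT ht.2] with s hs
    exact (h.path_eq_zero_of_T1_lt ⟨h0.trans hs.1.le, hs.2.le⟩ (ht.1.trans_lt hs.1)).symm

/-- If T₁ = 1, there is no atom at 1. If T₁ < 1, the path is zero at T₁ and does not jump to zero.
-/
lemma IsOptimalTriple.tendsto_path_left_T1 (h : IsOptimalTriple I θdown θup z f μ ν) (hz : 0 < z)
    (hδ : 0 < δ) (hIδ : I (-δ) = 0) :
    Tendsto (path f μ ν) (𝓝[<] (T1 (path f μ ν))) (𝓝 (path f μ ν (T1 (path f μ ν)))) := by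
  have ha := h.isActive hz hδ hIδ
  have : prePath f μ ν (T1 (path f μ ν)) = path f μ ν (T1 (path f μ ν)) := by
    rcases ha.le_one.eq_or_lt with h1 | h1
    · rw [h1, h.prePath_one]
    · have h0 := ha.zero_after _ ⟨le_rfl, h1⟩
      rw [h0, h.prePath_eq_zero hz hδ hIδ ⟨ha.nonneg.trans ha.lt.le, h1.le⟩ h0]
  rw [← this]
  exact h.triple.path_left _

/-- An optimal path has a positive slope or jumps upwards, so that the upper end point of the
domain of the rate function is positive. -/
lemma IsOptimalTriple.rbar_pos (h : IsOptimalTriple I θdown θup z f μ ν) (hz : 0 < z)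
    (hI : IsGoodConvexRate I) (hθup_dom : θup < ⊤ → ∀ r : ℝ, 0 < r → I r < ⊤) {r : ℝ}
    (hr : (r : EReal) = rbar I) : 0 < r := by
  by_contra hc
  push Not at hc
  have hθ : θup = ⊤ := by
    by_contra hθ
    have h1 : (1 : ℝ) ∈ effDom I := (hθup_dom (lt_top_iff_ne_top.2 hθ) 1 one_pos).ne
    have := coe_le_rbar h1
    rw [← hr, EReal.coe_le_coe_iff] at this
    linarith
  have hμ : μ (Ico 0 1) = 0 := by
    by_contra hμ
    have := h.cost_lt_top
    rw [openCost, hθ, ENNReal.top_mul hμ] at this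
    simp at this
  have hf : ∀ᵐ t, t ∈ Ico (0 : ℝ) 1 → 0 < path f μ ν t → f t ≤ 0 := by
    filter_upwards [h.ae_mem_effDom hI] with t ht ht1 ht2
    have := coe_le_rbar (ht (Ico_subset_Icc_self ht1) ht2)
    rw [← hr, EReal.coe_le_coe_iff] at this
    linarith
  have := IsTriple.integral_nonpos fun t ht => h.triple.path_nonpos hμ hf ht
  rw [h.area] at this
  linarith

end

/-! ### End points and the Euler-Lagrange equation -/

section

variable {f : ℝ → ℝ} {μ ν : Measure ℝ} {I : ℝ → ℝ≥0∞} {δ : ℝ} {θdown θup : ℝ≥0∞} {z : ℝ}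

lemma IsOptimalTriple.rightDeriv_le_rbar (h : IsOptimalTriple I θdown θup z f μ ν) (hz : 0 < z)
    (hδ : 0 < δ) (hIδ : I (-δ) = 0) (hI : IsGoodConvexRate I) (h_dom : -δ ∈ interior (effDom I))
    {t : ℝ} (ht : t ∈ Ioo (T0 (path f μ ν)) (T1 (path f μ ν))) :
    (rightDeriv (path f μ ν) t : EReal) ≤ rbar I :=
  coe_le_rbar (h.rightDeriv_mem_effDom hz hδ hIδ hI h_dom (h.isActive hz hδ hIδ) ht)

lemma IsOptimalTriple.exists_left_deriv (h : IsOptimalTriple I θdown θup z f μ ν) (hz : 0 < z)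
    (hδ : 0 < δ) (hIδ : I (-δ) = 0) {t : ℝ}
    (ht : t ∈ Ioc (T0 (path f μ ν)) (T1 (path f μ ν))) :
    ∃ v, Tendsto (rightDeriv (path f μ ν)) (𝓝[<] t) (𝓝 v) ∧ -δ ≤ v ∧
      (∀ s ∈ Ioo (T0 (path f μ ν)) t, v ≤ rightDeriv (path f μ ν) s) ∧
      HasDerivWithinAt (path f μ ν) v (Iic t) t := by
  have ha := h.isActive hz hδ hIδ
  have hφ := h.concaveOn_path hz hδ hIδ ha.nonneg ha.le_one ha.pos
  obtain ⟨v, hv, hδv, hvle⟩ := exists_tendsto_rightDeriv_left hφ ht.1 ht.2 (m := -δ)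
    fun s hs => h.le_rightDeriv hz hδ hIδ ha ⟨hs.1, hs.2.trans_le ht.2⟩
  refine ⟨v, hv, hδv, hvle, hasDerivWithinAt_left_of_tendsto hφ ht.1 ht.2 ?_ hv hvle⟩
  rcases ht.2.eq_or_lt with h1 | h1
  · rw [h1]
    exact h.tendsto_path_left_T1 hz hδ hIδ
  · exact ((hφ.continuousOn isOpen_Ioo).continuousAt
      (isOpen_Ioo.mem_nhds ⟨ht.1, h1⟩)).tendsto.mono_left nhdsWithin_le_nhds

/-- Where the path vanishes just before t, a left derivative can only be zero, but a maximal slope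
is positive by definition. -/
lemma IsOptimalTriple.mem_Ioc_of_mem_maxSlopeTimes (h : IsOptimalTriple I θdown θup z f μ ν)
    (hz : 0 < z) (hδ : 0 < δ) (hIδ : I (-δ) = 0) {t : ℝ}
    (ht : t ∈ maxSlopeTimes I (path f μ ν)) : t ∈ Ioc (T0 (path f μ ν)) (T1 (path f μ ν)) := by
  obtain ⟨ht01, r, hr0, -, hr⟩ := ht
  have ha := h.isActive hz hδ hIδ
  constructor
  · by_contra hc
    push Not at hc
    refine hr0.ne' (eq_zero_of_hasDerivWithinAt_Iic hr ?_)
    filter_upwards [self_mem_nhdsWithin] with s hs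
    exact h.path_eq_zero_of_lt_T0 ((mem_Iio.1 hs).le.trans ht01.2) ((mem_Iio.1 hs).trans_le hc)
  · by_contra hc
    push Not at hc
    refine hr0.ne' (eq_zero_of_hasDerivWithinAt_Iic hr ?_)
    filter_upwards [Ioo_mem_nhdsLT hc] with s hs
    exact h.path_eq_zero_of_T1_lt ⟨(ha.nonneg.trans ha.lt.le).trans hs.1.le,
      hs.2.le.trans ht01.2⟩ hs.1

lemma IsOptimalTriple.T0_le_T00 (h : IsOptimalTriple I θdown θup z f μ ν)
    (hz : 0 < z) (hδ : 0 < δ) (hIδ : I (-δ) = 0) :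
    T0 (path f μ ν) ≤ T00 I (path f μ ν) := by
  unfold T00
  split_ifs with hne
  · obtain ⟨t, ht⟩ := hne
    exact (h.mem_Ioc_of_mem_maxSlopeTimes hz hδ hIδ ht).1.le.trans
      (le_csSup ⟨1, fun s hs => hs.1.2⟩ ht)
  · exact le_rfl

/-- After `T00` the slopes lie in the interior of the domain of the rate function. -/
lemma IsOptimalTriple.rightDeriv_mem_interior (h : IsOptimalTriple I θdown θup z f μ ν)
    (hz : 0 < z) (hδ : 0 < δ) (hIδ : I (-δ) = 0) (hI : IsGoodConvexRate I)
    (h_dom : -δ ∈ interior (effDom I)) (hθup_dom : θup < ⊤ → ∀ r : ℝ, 0 < r → I r < ⊤) {t : ℝ}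
    (ht : t ∈ Ioo (T00 I (path f μ ν)) (T1 (path f μ ν))) :
    rightDeriv (path f μ ν) t ∈ interior (effDom I) := by
  have ha := h.isActive hz hδ hIδ
  have hφ := h.concaveOn_path hz hδ hIδ ha.nonneg ha.le_one ha.pos
  have ht' : t ∈ Ioo (T0 (path f μ ν)) (T1 (path f μ ν)) :=
    ⟨(h.T0_le_T00 hz hδ hIδ).trans_lt ht.1, ht.2⟩
  refine hI.mem_interior_of_lt_rbar h_dom (h.le_rightDeriv hz hδ hIδ ha ht')
    ((h.rightDeriv_le_rbar hz hδ hIδ hI h_dom ht').lt_of_ne fun he => ?_)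
  obtain ⟨v, hv, -, hvle, hd⟩ := h.exists_left_deriv hz hδ hIδ (Ioo_subset_Ioc_self ht')
  -- If the slope at t is r̄, then so are all earlier slopes, since they are at least as large and
  -- at most r̄. The left derivative at t is thus r̄, which puts t among the times bounded by T₀⁰.
  have h1 : v = rightDeriv (path f μ ν) t := by
    refine tendsto_nhds_unique hv (tendsto_const_nhds.congr' ?_)
    filter_upwards [Ioo_mem_nhdsLT ht'.1] with s hs
    have hs' : s ∈ Ioo (T0 (path f μ ν)) (T1 (path f μ ν)) := ⟨hs.1, hs.2.trans ht.2⟩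
    refine le_antisymm (antitoneOn_rightDeriv hφ hs' ht' hs.2.le) ?_
    have := h.rightDeriv_le_rbar hz hδ hIδ hI h_dom hs'
    rwa [← he, EReal.coe_le_coe_iff] at this
  have hmem : t ∈ maxSlopeTimes I (path f μ ν) :=
    ⟨⟨ha.nonneg.trans_lt ht'.1, ht.2.le.trans ha.le_one⟩, _, h.rbar_pos hz hI hθup_dom he, he,
      h1 ▸ hd⟩
  have h2 : t ≤ T00 I (path f μ ν) := by
    rw [T00, if_pos ⟨t, hmem⟩]
    exact le_csSup ⟨1, fun s hs => hs.1.2⟩ hmem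
  exact ht.1.not_ge h2

/-- In the coercive case the upper end point of the domain of the rate function is not attained. -/
lemma IsOptimalTriple.T00_eq_T0 (h : IsOptimalTriple I θdown θup z f μ ν) (hz : 0 < z)
    (hδ : 0 < δ) (hIδ : I (-δ) = 0) (hI : IsGoodConvexRate I) (h_dom : -δ ∈ interior (effDom I))
    (hco : Coercive I) : T00 I (path f μ ν) = T0 (path f μ ν) := by
  rw [T00, if_neg]
  rintro ⟨t, ht⟩
  have ha := h.isActive hz hδ hIδ
  have ht' := h.mem_Ioc_of_mem_maxSlopeTimes hz hδ hIδ ht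
  obtain ⟨-, r, -, hr, hd⟩ := ht
  obtain ⟨v, -, -, hvle, hd'⟩ := h.exists_left_deriv hz hδ hIδ ht'
  obtain rfl : r = v := (uniqueDiffWithinAt_Iic t).eq_deriv _ hd hd'
  obtain ⟨s, hs⟩ := nonempty_Ioo.2 ht'.1
  have hs' : s ∈ Ioo (T0 (path f μ ν)) (T1 (path f μ ν)) := ⟨hs.1, hs.2.trans_le ht'.2⟩
  have h1 := h.rightDeriv_mem_effDom hz hδ hIδ hI h_dom ha hs'
  have h2 := coe_le_rbar h1
  rw [← hr, EReal.coe_le_coe_iff] at h2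
  -- Slopes before t are at least r̄ and lie in the domain, so they equal r̄ and I is finite there,
  -- against coercivity.
  rw [le_antisymm h2 (hvle s hs)] at h1
  exact hco (hI.nonCoercive hIδ h_dom hr (lt_top_iff_ne_top.2 h1))

lemma hasGradient_of_deriv
    (h_diff : ∀ v ∈ interior (effDom I), DifferentiableAt ℝ (fun y => (I y).toReal) v) {v p : ℝ}
    (hv : v ∈ interior (effDom I)) (hp : deriv (fun y => (I y).toReal) v = p) :
    HasGradient I p v :=
  ⟨hv, hp ▸ (h_diff v hv).hasDerivAt⟩

/-- The left derivative is a limit of slopes and lies between -δ and an earlier slope, hence in the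
interior of the domain, where ∇I is continuous. The equation passes to the limit, also at T₁. -/
lemma IsOptimalTriple.leftEL (h : IsOptimalTriple I θdown θup z f μ ν) (hz : 0 < z)
    (hδ : 0 < δ) (hIδ : I (-δ) = 0) (hI : IsGoodConvexRate I) (h_dom : -δ ∈ interior (effDom I))
    (h_diff : ∀ v ∈ interior (effDom I), DifferentiableAt ℝ (fun y => (I y).toReal) v)
    {γ b lam : ℝ} (hγ : T0 (path f μ ν) ≤ γ)
    (hint : ∀ t ∈ Ioo γ (T1 (path f μ ν)), rightDeriv (path f μ ν) t ∈ interior (effDom I))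
    (heq : ∀ t ∈ Ioo γ (T1 (path f μ ν)),
      deriv (fun v => (I v).toReal) (rightDeriv (path f μ ν) t) = b - lam * t)
    {t : ℝ} (ht : t ∈ Ioc γ (T1 (path f μ ν))) : LeftEL I (path f μ ν) (b - lam * t) t := by
  obtain ⟨v, hv, hδv, hvle, hd⟩ := h.exists_left_deriv hz hδ hIδ ⟨hγ.trans_lt ht.1, ht.2⟩
  obtain ⟨s, hs⟩ := nonempty_Ioo.2 ht.1
  have hvi : v ∈ interior (effDom I) := hI.convex_effDom.interior.ordConnected.out h_dom
    (hint s ⟨hs.1, hs.2.trans_le ht.2⟩) ⟨hδv, hvle s ⟨hγ.trans_lt hs.1, hs.2⟩⟩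
  refine ⟨v, hd, hasGradient_of_deriv h_diff hvi ?_⟩
  have h1 := (((hI.continuousOn_deriv h_diff).continuousAt
    (isOpen_interior.mem_nhds hvi)).tendsto.comp hv)
  have h2 : Tendsto (fun s => b - lam * s) (𝓝[<] t) (𝓝 (b - lam * t)) :=
    (Continuous.tendsto (by fun_prop) t).mono_left nhdsWithin_le_nhds
  refine tendsto_nhds_unique h1 (h2.congr' ?_)
  filter_upwards [Ioo_mem_nhdsLT ht.1] with s hs
  exact (heq s ⟨hs.1, hs.2.trans_le ht.2⟩).symm

lemma IsOptimalTriple.rightEL (h : IsOptimalTriple I θdown θup z f μ ν) (hz : 0 < z)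
    (hδ : 0 < δ) (hIδ : I (-δ) = 0)
    (h_diff : ∀ v ∈ interior (effDom I), DifferentiableAt ℝ (fun y => (I y).toReal) v)
    {γ b lam : ℝ} (hγ : T0 (path f μ ν) ≤ γ)
    (hint : ∀ t ∈ Ioo γ (T1 (path f μ ν)), rightDeriv (path f μ ν) t ∈ interior (effDom I))
    (heq : ∀ t ∈ Ioo γ (T1 (path f μ ν)),
      deriv (fun v => (I v).toReal) (rightDeriv (path f μ ν) t) = b - lam * t)
    {t : ℝ} (ht : t ∈ Ioo γ (T1 (path f μ ν))) : RightEL I (path f μ ν) (b - lam * t) t := by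
  have ha := h.isActive hz hδ hIδ
  have hφ := h.concaveOn_path hz hδ hIδ ha.nonneg ha.le_one ha.pos
  exact ⟨_, hasDerivWithinAt_Ioi_iff_Ici.1
    (hasDerivWithinAt_rightDeriv hφ ⟨hγ.trans_lt ht.1, ht.2⟩),
    hasGradient_of_deriv h_diff (hint t ht) (heq t ht)⟩

/-- In the coercive case a finite right derivative at `T0` satisfies the Euler-Lagrange
equation. -/
lemma IsOptimalTriple.hasGradient_T0 (h : IsOptimalTriple I θdown θup z f μ ν) (hz : 0 < z)
    (hδ : 0 < δ) (hIδ : I (-δ) = 0) (hI : IsGoodConvexRate I) (h_dom : -δ ∈ interior (effDom I))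
    (h_diff : ∀ v ∈ interior (effDom I), DifferentiableAt ℝ (fun y => (I y).toReal) v)
    (hco : Coercive I) {b lam : ℝ} (hlam : 0 < lam)
    (hint : ∀ t ∈ Ioo (T0 (path f μ ν)) (T1 (path f μ ν)),
      rightDeriv (path f μ ν) t ∈ interior (effDom I))
    (heq : ∀ t ∈ Ioo (T0 (path f μ ν)) (T1 (path f μ ν)),
      deriv (fun v => (I v).toReal) (rightDeriv (path f μ ν) t) = b - lam * t)
    {v : ℝ} (hv : HasDerivWithinAt (path f μ ν) v (Ici (T0 (path f μ ν))) (T0 (path f μ ν))) :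
    HasGradient I (b - lam * T0 (path f μ ν)) v := by
  have ha := h.isActive hz hδ hIδ
  have hφ := h.concaveOn_path hz hδ hIδ ha.nonneg ha.le_one ha.pos
  set g := rightDeriv (path f μ ν) with hg
  obtain ⟨hlim, hle⟩ := tendsto_rightDeriv_of_hasDerivWithinAt hφ ha.lt hv
  obtain ⟨s₁, hs₁⟩ := nonempty_Ioo.2 ha.lt
  have hδv : -δ ≤ v := (h.le_rightDeriv hz hδ hIδ ha hs₁).trans (hle s₁ hs₁)
  -- It is not known beforehand that v is in the domain. Along the slopes near T₀ the gradient is at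
  -- most |b|, so I grows at most linearly from g s₁, and lower semicontinuity carries the bound to
  -- v. Coercivity then excludes v = r̄.
  have hIv : I v ≤ ENNReal.ofReal ((I (g s₁)).toReal + |b| * (v - g s₁)) := by
    refine (hI.lsc.isClosed_preimage _).mem_of_tendsto hlim ?_
    filter_upwards [Ioo_mem_nhdsGT hs₁.1] with s hs
    have hs' : s ∈ Ioo (T0 (path f μ ν)) (T1 (path f μ ν)) := ⟨hs.1, hs.2.trans hs₁.2⟩
    have h1 := hI.deriv_mul_le h_diff (hint s hs') (interior_subset (hint s₁ hs₁))
    rw [heq s hs'] at h1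
    have h2 : g s₁ ≤ g s := antitoneOn_rightDeriv hφ hs' hs₁ hs.2.le
    have h3 : b - lam * s ≤ |b| := by
      have := mul_nonneg hlam.le (ha.nonneg.trans hs.1.le)
      linarith [le_abs_self b]
    have h4 : (b - lam * s) * (g s - g s₁) ≤ |b| * (v - g s₁) :=
      mul_le_mul h3 (by linarith [hle s hs']) (by linarith) (abs_nonneg b)
    rw [mem_preimage, mem_Iic, ← ENNReal.ofReal_toReal (interior_subset (hint s hs'))]
    exact ENNReal.ofReal_le_ofReal (by linarith)
  have hvd : v ∈ effDom I := (hIv.trans_lt ENNReal.ofReal_lt_top).ne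
  have hvi : v ∈ interior (effDom I) := by
    refine hI.mem_interior_of_lt_rbar h_dom hδv ((coe_le_rbar hvd).lt_of_ne fun he => ?_)
    exact hco (hI.nonCoercive hIδ h_dom he (lt_top_iff_ne_top.2 hvd))
  refine hasGradient_of_deriv h_diff hvi ?_
  have h1 := (((hI.continuousOn_deriv h_diff).continuousAt
    (isOpen_interior.mem_nhds hvi)).tendsto.comp hlim)
  have h2 : Tendsto (fun s => b - lam * s) (𝓝[>] (T0 (path f μ ν)))
      (𝓝 (b - lam * T0 (path f μ ν))) :=
    (Continuous.tendsto (by fun_prop) _).mono_left nhdsWithin_le_nhds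
  refine tendsto_nhds_unique h1 (h2.congr' ?_)
  filter_upwards [Ioo_mem_nhdsGT ha.lt] with s hs
  exact (heq s hs).symm

end

end RRW

theorem theorem3 (I : ℝ → ENNReal) (hI : RRW.IsGoodConvexRate I)
    (δ : ℝ) (hδ : 0 < δ) (hIδ : I (-δ) = 0)
    (h_stable : I 0 ≠ 0)
    (h_dom : -δ ∈ interior (RRW.effDom I))
    (h_diff : ∀ v ∈ interior (RRW.effDom I), DifferentiableAt ℝ (fun y => (I y).toReal) v)
    (θdown θup : ENNReal) (hθdown : 0 < θdown) (hθup : 0 < θup)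
    (hθup_dom : θup < ⊤ → ∀ r : ℝ, 0 < r → I r < ⊤)
    (z : ℝ) (hz : 0 < z)
    (ψ : ℝ → ℝ) (hψ : RRW.IsOptimalPath I θdown θup z ψ) :
    (RRW.Coercive I → RRW.T00 I ψ = RRW.T0 ψ ∧ RRW.T0 ψ < RRW.T1 ψ) ∧
    (RRW.T00 I ψ < RRW.T1 ψ →
      ∃ b lam : ℝ, 0 < lam ∧
        (∀ t ∈ Set.Ioo (RRW.T00 I ψ) (RRW.T1 ψ), RRW.EulerLagrangeAt I ψ (b - lam * t) t) ∧
        (RRW.Coercive I →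
          ∀ t ∈ Set.Icc (0 : ℝ) 1, 0 < ψ t →
            (t ≠ RRW.T0 ψ → RRW.LeftEL I ψ (b - lam * t) t) ∧
            (t ≠ RRW.T0 ψ → t < 1 → RRW.RightEL I ψ (b - lam * t) t) ∧
            (t = RRW.T0 ψ → ∀ v : ℝ, HasDerivWithinAt ψ v (Set.Ici t) t →
              RRW.HasGradient I (b - lam * t) v))) := by
  obtain ⟨f₀, μ, ν, h₀, hψ₀⟩ := hψ.exists_triple hI hδ hIδ h_stable hθdown hθup hz
  obtain ⟨f, h, -, hpath, hf⟩ := h₀.exists_density hz hδ hIδ (h₀.isActive hz hδ hIδ)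
  rw [← hpath] at hψ₀ hf
  have hE : EqOn (RRW.path f μ ν) ψ (Icc 0 1) := fun t ht => hψ₀ t ht
  have ha := h.isActive hz hδ hIδ
  have h0 := h.T0_le_T00 hz hδ hIδ
  have hint := fun t => h.rightDeriv_mem_interior hz hδ hIδ hI h_dom hθup_dom (t := t)
  have hT0 := h.T00_eq_T0 hz hδ hIδ hI h_dom
  rw [← RRW.T00_congr hE, ← RRW.T0_congr hE, ← RRW.T1_congr hE]
  refine ⟨fun hco => ⟨hT0 hco, ha.lt⟩, fun hlt => ?_⟩
  obtain ⟨b, lam, hlam, heq⟩ := h.exists_affine hz hδ hIδ hI h_dom h_diff ha hf h0 hlt hint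
  have hL := fun t => h.leftEL hz hδ hIδ hI h_dom h_diff h0 hint heq (t := t)
  have hR := fun t => h.rightEL hz hδ hIδ h_diff h0 hint heq (t := t)
  have hIoo : ∀ t ∈ Ioo (RRW.T00 I (RRW.path f μ ν)) (RRW.T1 (RRW.path f μ ν)),
      t ∈ Ioo (0 : ℝ) 1 := fun t ht =>
    ⟨(ha.nonneg.trans h0).trans_lt ht.1, ht.2.trans_le ha.le_one⟩
  refine ⟨b, lam, hlam, fun t ht => ?_, fun hco t ht hpos => ?_⟩
  · have ht01 := hIoo t ht
    exact .of_left_right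
      ((RRW.leftEL_congr hE (Ioo_subset_Ioc_self ht01)).1 (hL t (Ioo_subset_Ioc_self ht)))
      ((RRW.rightEL_congr hE (Ioo_subset_Ico_self ht01)).1 (hR t ht))
  · rw [← hE ht] at hpos
    rw [hT0 hco] at hL hR hint heq
    have htT0 := RRW.T0_le ht hpos
    have htT1 := RRW.le_T1 ht hpos
    refine ⟨fun hne => ?_, fun hne ht1 => ?_, ?_⟩
    · have hlt' := lt_of_le_of_ne htT0 (Ne.symm hne)
      exact (RRW.leftEL_congr hE ⟨ha.nonneg.trans_lt hlt', ht.2⟩).1 (hL t ⟨hlt', htT1⟩)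
    · refine (RRW.rightEL_congr hE ⟨ht.1, ht1⟩).1
        (hR t ⟨lt_of_le_of_ne htT0 (Ne.symm hne), lt_of_le_of_ne htT1 fun he => ?_⟩)
      -- A right derivative is claimed only for t < 1, and there t = T₁ would mean that the path is
      -- zero at t.
      rw [ha.zero_after t ⟨he.ge, ht1⟩] at hpos
      exact lt_irrefl _ hpos
    · rintro rfl v hv
      exact h.hasGradient_T0 hz hδ hIδ hI h_dom h_diff hco hlam hint heq
        ((RRW.hasDerivWithinAt_Ici_congr hE ⟨ht.1, ha.lt.trans_le ha.le_one⟩).2 hv)
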